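/- Let $M>1$ be an integer and let $\Omega_M$ be the hierarchical group of order $M$: the sequences $x=(x_1,x_2,\dots)$ with $x_i\in\{0,\dots,M-1\}$ and only finitely many nonzero entries, with addition componentwise mod $M$, and with $|x-y|=\max\{i:x_i\ne y_i\}$ for $x\neq y$, $|x-x|=0$. Let $1<c<M$. The $c$-random walk is the continuous-time random walk on $\Omega_M$ with jump rate $1$ which at each jump chooses a distance $j\ge 1$ with probability $r_j=(1-\frac cM)(\frac cM)^{j-1}$ and then moves to a point uniformly distributed among those at distance $j$ from its current position; its transition probabilities are $p_t(x,y)=p_t(0,y-x)$ with $p_t(0,y)=e^{-t}\sum_{n\ge 0}\frac{t^n}{n!}p^{(n)}(0,y)$, where $p^{(n)}$ are the $n$-step transition probabilities of the discrete-time walk. Let $\mathcal B_b$ be the space of real functions on $\Omega_M$ with bounded support, $\mathcal B_b'$ its dual, with the topology of pointwise convergence on $\mathcal B_b$, and $\langle\cdot,\cdot\rangle$ the duality. A function (or signed measure) $u$ on $\Omega_M$ is regarded as an element of $\mathcal B_b'$ by $\langle u,\varphi\rangle=\sum_x u(x)\varphi(x)$. Let $\mathcal T_t\varphi(x)=\sum_y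 p_t(x,y)\varphi(y)$ and $G\varphi(x)=\int_0^\infty\mathcal T_t\varphi(x)\,dt$. At time $0$ let there be $\theta_x$ particles at each $x\in\Omega_M$, where $(\theta_x)_{x\in\Omega_M}$ are independent copies of a Poisson random variable $\theta$. The particles do not branch, and they move independently of each other and of $(\theta_x)$ according to $c$-random walks. Let $N_t(A)$ be the number of particles in $A\subset\Omega_M$ at time $t$, and, for $T>0$, let $$X_T(t)=\frac1{\sqrt T}\int_0^{Tt}(N_r-EN_r)\,dr,\qquad t\ge 0.$$ Then $G\varphi(x)$ is finite, with $t\mapsto\mathcal T_t\varphi(x)$ integrable on $(0,\infty)$, for all $\varphi\in\mathcal B_b$ and $x\in\Omega_M$; for all $t\ge0$ and $x\in\Omega_M$, $N_t(\{x\})$ is almost surely finite and integrable, and $r\mapsto N_r(\{x\})$ is almost surely integrable on $[0,t]$; and there is a centered Gaussian process $X=(X(t))_{t\ge0}$ with values in $\mathcal B_b'$ and covariance $$E\langle X(s),\varphi\rangle\langle X(t),\psi\rangle=2\,E\theta\,(s\wedge t)\,\langle G\varphi,\psi\rangle,\qquad s,t\ge 0,\ \varphi,\psi\in\mathcal B_b,$$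 such that, as $T\to\infty$, the finite-dimensional distributions of $X_T$ converge weakly to those of $X$: for all $t_1,\dots,t_n\ge0$, $(X_T(t_1),\dots,X_T(t_n))$ converges in law in $(\mathcal B_b')^n$ to $(X(t_1),\dots,X(t_n))$. -/

import Mathlib

open MeasureTheory ProbabilityTheory Filter Topology
open scoped NNReal

/-! ### The hierarchical group -/

/-- The hierarchical group `Ω_M` of order `M`: finitely supported sequences with entries in
`{0, …, M-1}`, added componentwise mod `M`.  The index `i : ℕ` stands for the coordinate
`x_{i+1}` (coordinates are numbered from `1` on paper). -/
def Hier (M : ℕ) : Type := ℕ →₀ ZMod M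

noncomputable instance (M : ℕ) : AddCommGroup (Hier M) :=
  inferInstanceAs (AddCommGroup (ℕ →₀ ZMod M))

noncomputable instance (M : ℕ) : DecidableEq (Hier M) := Classical.decEq _

instance (M : ℕ) : Countable (Hier M) :=
  haveI : Countable (ZMod M) := by
    cases M with
    | zero => exact inferInstanceAs (Countable ℤ)
    | succ n => exact inferInstanceAs (Countable (Fin (n + 1)))
  inferInstanceAs (Countable (ℕ →₀ ZMod M))

instance (M : ℕ) : MeasurableSpace (Hier M) := ⊤

instance (M : ℕ) : DiscreteMeasurableSpace (Hier M) := ⟨fun _ => trivial⟩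

/-- `|x|`, the hierarchical distance of `x` from `0`: the largest (1-based) index of a nonzero
coordinate, and `0` for `x = 0`. -/
def hierNorm {M : ℕ} (x : Hier M) : ℕ :=
  (Finsupp.support (x : ℕ →₀ ZMod M)).sup (fun i => i + 1)

/-- The hierarchical distance `|x - y|`. -/
noncomputable def hierDist {M : ℕ} (x y : Hier M) : ℕ := hierNorm (x - y)

/-- Balls of the hierarchical group are finite. -/
theorem finite_hierNorm_le (M : ℕ) [NeZero M] (R : ℕ) :
    {x : Hier M | hierNorm x ≤ R}.Finite := by
  refine Set.Finite.of_injOn (f := fun (x : Hier M) (i : Fin R) => (show ℕ →₀ ZMod M from x) i)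
    (t := Set.univ) (fun _ _ => Set.mem_univ _) ?_ Set.finite_univ
  intro x hx y hy hxy
  have key : ∀ w : Hier M, hierNorm w ≤ R → ∀ i, R ≤ i → (show ℕ →₀ ZMod M from w) i = 0 := by
    intro w hw i hi
    by_contra h
    have h1 : i + 1 ≤ hierNorm w :=
      Finset.le_sup (f := fun i => i + 1) (Finsupp.mem_support_iff.mpr h)
    omega
  refine Finsupp.ext fun i => ?_
  rcases lt_or_ge i R with hi | hi
  · exact congrFun hxy ⟨i, hi⟩
  · exact (key x hx i hi).trans (key y hy i hi).symm

/-! ### The `c`-random walk -/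

/-- `r_j = (1 - c/M) (c/M)^(j-1)`, the probability of a jump of size `j ≥ 1`. -/
noncomputable def jumpSizeProb (M : ℕ) (c : ℝ) (j : ℕ) : ℝ :=
  (1 - c / M) * (c / M) ^ (j - 1)

/-- Probability that one jump of the walk is equal to `y`: a size `j ≥ 1` is chosen with
probability `r_j`, then a point uniformly among all those at distance `j`. -/
noncomputable def jumpProb (M : ℕ) (c : ℝ) (y : Hier M) : ℝ :=
  if y = 0 then 0
  else jumpSizeProb M c (hierNorm y) / ({w : Hier M | hierNorm w = hierNorm y}.ncard : ℝ)

/-- `p^(n)(0,y)`, the `n`-step transition probability of the discrete time walk. -/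
noncomputable def stepProb (M : ℕ) (c : ℝ) : ℕ → Hier M → ℝ
  | 0 => fun y => if y = 0 then 1 else 0
  | n + 1 => fun y => ∑' w : Hier M, stepProb M c n w * jumpProb M c (y - w)

/-- `p_t(0,y)`, the transition probability of the continuous time walk with jump rate `1`;
`p_t(x,y) = p_t(0,y-x)`. -/
noncomputable def transProb (M : ℕ) (c : ℝ) (t : ℝ) (y : Hier M) : ℝ :=
  Real.exp (-t) * ∑' n : ℕ, t ^ n / (n.factorial : ℝ) * stepProb M c n y

/-- `Z` is a continuous time `c`-random walk started at `0`: it has independent increments, the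
increment over a time interval of length `h` has law `p_h(0, ·)`, and almost all paths are right
continuous with left limits for the discrete topology (i.e. they are step functions). -/
structure IsCRandomWalk (M : ℕ) (c : ℝ) {Ω : Type*} [MeasurableSpace Ω]
    (Z : ℝ≥0 → Ω → Hier M) (P : Measure Ω) : Prop where
  measurable : ∀ t, Measurable (Z t)
  start : ∀ᵐ ω ∂P, Z 0 ω = 0
  indep : HasIndepIncrements Z P
  law : ∀ (s h : ℝ≥0) (y : Hier M),
    P.real {ω | Z (s + h) ω - Z s ω = y} = transProb M c h y
  rightCont : ∀ᵐ ω ∂P, ∀ t, ∀ᶠ s in 𝓝[≥] t, Z s ω = Z t ω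
  leftLim : ∀ᵐ ω ∂P, ∀ t, ∃ y, ∀ᶠ s in 𝓝[<] t, Z s ω = y

/-! ### Test functions, their dual, semigroup and potential operator -/

/-- `B_b`: the real functions on `Ω_M` with bounded support. -/
def Bb (M : ℕ) : Submodule ℝ (Hier M → ℝ) where
  carrier := {φ | ∃ R : ℕ, ∀ x, φ x ≠ 0 → hierNorm x ≤ R}
  zero_mem' := ⟨0, fun _ h => absurd rfl h⟩
  add_mem' := by
    rintro φ ψ ⟨R, hR⟩ ⟨S, hS⟩
    refine ⟨max R S, fun x hx => ?_⟩
    by_cases h : φ x = 0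
    · have h' : ψ x ≠ 0 := fun h0 => hx (by simp [h, h0])
      exact (hS x h').trans (le_max_right _ _)
    · exact (hR x h).trans (le_max_left _ _)
  smul_mem' := by
    rintro a φ ⟨R, hR⟩
    refine ⟨R, fun x hx => hR x fun h0 => hx (by simp [h0])⟩

theorem Bb.finite_support {M : ℕ} [NeZero M] (φ : Bb M) :
    (Function.support (φ : Hier M → ℝ)).Finite := by
  obtain ⟨R, hR⟩ := φ.2
  exact (finite_hierNorm_le M R).subset fun x hx => hR x hx

/-- `B_b'`: the dual of `B_b`.  (`B_b` has countable dimension and carries its finest locally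
convex topology, for which every linear functional is continuous.) -/
def BbDual (M : ℕ) : Type := Bb M →ₗ[ℝ] ℝ

noncomputable instance (M : ℕ) : AddCommGroup (BbDual M) :=
  inferInstanceAs (AddCommGroup (Bb M →ₗ[ℝ] ℝ))

noncomputable instance (M : ℕ) : Module ℝ (BbDual M) :=
  inferInstanceAs (Module ℝ (Bb M →ₗ[ℝ] ℝ))

/-- `μ φ` is the duality `⟨μ, φ⟩`. -/
instance (M : ℕ) : FunLike (BbDual M) (Bb M) ℝ :=
  inferInstanceAs (FunLike (Bb M →ₗ[ℝ] ℝ) (Bb M) ℝ)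

/-- The dual topology on `B_b'`: the coarsest one that makes all the maps `μ ↦ ⟨μ, φ⟩`
continuous. -/
instance (M : ℕ) : TopologicalSpace (BbDual M) :=
  TopologicalSpace.induced (fun (μ : BbDual M) (φ : Bb M) => μ φ) Pi.topologicalSpace

instance (M : ℕ) : MeasurableSpace (BbDual M) := borel _

instance (M : ℕ) : BorelSpace (BbDual M) := ⟨rfl⟩

theorem BbDual.continuous_eval {M : ℕ} (φ : Bb M) : Continuous fun μ : BbDual M => μ φ :=
  (continuous_apply φ).comp continuous_induced_dom

/-- The indicator function of a point. -/
noncomputable def Bb.point {M : ℕ} (x : Hier M) : Bb M :=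
  ⟨Pi.single x 1, hierNorm x, fun y hy => by
    have : y = x := by
      by_contra h
      exact hy (Pi.single_eq_of_ne h _)
    rw [this]⟩

theorem BbDual.eval_eq_sum {M : ℕ} [NeZero M] (μ : BbDual M) (φ : Bb M) :
    μ φ = ∑ x ∈ (Bb.finite_support φ).toFinset, (φ : Hier M → ℝ) x * μ (Bb.point x) := by
  have h : φ = ∑ x ∈ (Bb.finite_support φ).toFinset, (φ : Hier M → ℝ) x • Bb.point x := by
    apply Subtype.ext
    funext y
    rw [AddSubmonoidClass.coe_finsetSum, Finset.sum_apply]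
    simp only [Submodule.coe_smul, Bb.point, Pi.smul_apply, Pi.single_apply, smul_eq_mul,
      mul_ite, mul_one, mul_zero]
    rw [Finset.sum_ite_eq]
    split_ifs with hy
    · rfl
    · simpa using hy
  have h2 : ∀ ν : Bb M →ₗ[ℝ] ℝ,
      ν φ = ∑ x ∈ (Bb.finite_support φ).toFinset, (φ : Hier M → ℝ) x * ν (Bb.point x) := by
    intro ν
    conv_lhs => rw [h]
    simp only [map_sum, map_smul, smul_eq_mul]
  exact h2 μ

/-- `B_b'` is homeomorphically embedded into the countable product of lines `ℝ^(Ω_M)`. -/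
theorem BbDual.isInducing {M : ℕ} [NeZero M] :
    IsInducing fun (μ : BbDual M) (x : Hier M) => μ (Bb.point x) := by
  refine IsInducing.of_comp (continuous_pi fun x => BbDual.continuous_eval _)
    (g := fun (u : Hier M → ℝ) (φ : Bb M) =>
      ∑ x ∈ (Bb.finite_support φ).toFinset, (φ : Hier M → ℝ) x * u x)
    (continuous_pi fun φ => continuous_finsetSum _ fun x _ =>
      continuous_const.mul (continuous_apply x)) ?_
  have h : ((fun (u : Hier M → ℝ) (φ : Bb M) =>
      ∑ x ∈ (Bb.finite_support φ).toFinset, (φ : Hier M → ℝ) x * u x) ∘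
      fun (μ : BbDual M) (x : Hier M) => μ (Bb.point x)) =
      fun (μ : BbDual M) (φ : Bb M) => μ φ := by
    funext μ φ
    exact (BbDual.eval_eq_sum μ φ).symm
  rw [h]
  exact ⟨rfl⟩

instance (M : ℕ) [NeZero M] : SecondCountableTopology (BbDual M) :=
  BbDual.isInducing.secondCountableTopology

/-- The element `φ ↦ ∑ₓ u(x) φ(x)` of `B_b'` given by a function `u` (a signed measure on
the discrete space `Ω_M`, through its point masses). -/
noncomputable def BbDual.ofFun {M : ℕ} [NeZero M] (u : Hier M → ℝ) : BbDual M :=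
  IsLinearMap.mk' (fun φ : Bb M => ∑' x, u x * (φ : Hier M → ℝ) x)
    { map_add := fun φ ψ => by
        have hs : ∀ φ : Bb M, Summable fun x => u x * (φ : Hier M → ℝ) x := fun φ =>
          summable_of_hasFiniteSupport
            ((Bb.finite_support φ).subset fun x hx => right_ne_zero_of_mul hx)
        rw [← (hs φ).tsum_add (hs ψ)]
        simp [mul_add]
      map_smul := fun a φ => by
        simp only [Submodule.coe_smul, Pi.smul_apply, smul_eq_mul]
        rw [← tsum_mul_left]
        exact tsum_congr fun x => by ring }

/-- The semigroup `𝒯_t φ(x) = ∑_y p_t(x,y) φ(y)` of the `c`-random walk. -/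
noncomputable def semigroup {M : ℕ} (c t : ℝ) (φ : Bb M) (x : Hier M) : ℝ :=
  ∑' y : Hier M, transProb M c t (y - x) * (φ : Hier M → ℝ) y

/-- The potential operator `G φ(x) = ∫_0^∞ 𝒯_t φ(x) dt`. -/
noncomputable def potential {M : ℕ} (c : ℝ) (φ : Bb M) (x : Hier M) : ℝ :=
  ∫ t in Set.Ioi (0 : ℝ), semigroup c t φ x

/-! ### The particle system and its occupation time fluctuations -/

/-- A system of independent `c`-random walks without branching.  At time `0` there are `θ x`
particles at the site `x`; the `θ x` are independent with law `ρ`.  The `j`-th particle from `x`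
(present if `j < θ x`) is at time `t` at `x + z x j t`, where the `z x j` are `c`-random walks,
independent of each other and of the initial configuration. -/
structure IsWalkSystem (M : ℕ) (c : ℝ) (ρ : Measure ℕ) {Ω : Type*} [MeasurableSpace Ω]
    (θ : Hier M → Ω → ℕ) (z : Hier M → ℕ → ℝ≥0 → Ω → Hier M) (P : Measure Ω) : Prop where
  measurable_initial : ∀ x, Measurable (θ x)
  law_initial : ∀ x, P.map (θ x) = ρ
  indep_initial : iIndepFun θ P
  walk : ∀ x j, IsCRandomWalk M c (z x j) P
  indep_walks : iIndepFun (fun (p : Hier M × ℕ) (ω : Ω) (t : ℝ≥0) => z p.1 p.2 t ω) P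
  indep_initial_walks : IndepFun (fun ω x => θ x ω)
    (fun (ω : Ω) (p : Hier M × ℕ) (t : ℝ≥0) => z p.1 p.2 t ω) P

/-- The particles (labelled by starting site and number) that are at `x` at time `t`. -/
def particlesAt {M : ℕ} {Ω : Type*} (θ : Hier M → Ω → ℕ)
    (z : Hier M → ℕ → ℝ≥0 → Ω → Hier M) (t : ℝ≥0) (x : Hier M) (ω : Ω) : Set (Hier M × ℕ) :=
  {p | p.2 < θ p.1 ω ∧ p.1 + z p.1 p.2 t ω = x}

/-- The empirical process `N_t`, through its point masses `N_t({x})`. -/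
noncomputable def empirical {M : ℕ} {Ω : Type*} (θ : Hier M → Ω → ℕ)
    (z : Hier M → ℕ → ℝ≥0 → Ω → Hier M) (t : ℝ≥0) (x : Hier M) (ω : Ω) : ℝ :=
  ((particlesAt θ z t x ω).ncard : ℝ)

/-- The `B_b'`-valued occupation time fluctuation process
`X_T(t) = (1 / F_T) ∫_0^{Tt} (N_r - E N_r) dr`. -/
noncomputable def occupationFluctuation {M : ℕ} [NeZero M] {Ω : Type*} [MeasurableSpace Ω]
    (P : Measure Ω) (θ : Hier M → Ω → ℕ) (z : Hier M → ℕ → ℝ≥0 → Ω → Hier M)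
    (F : ℝ≥0 → ℝ) (T t : ℝ≥0) (ω : Ω) : BbDual M :=
  BbDual.ofFun fun x => 1 / F T *
    ∫ r in (0 : ℝ)..(T * t : ℝ≥0),
      (empirical θ z r.toNNReal x ω - ∫ ω', empirical θ z r.toNNReal x ω' ∂P)

/-! ### Convergence of finite dimensional distributions -/

/-- Weak convergence of all finite dimensional distributions of the processes `X i` (on
`(Ω, P)`) to those of the process `Y` (on `(Ω', P')`) along `l`. -/
def TendstoFDD {ι S E Ω Ω' : Type*} [TopologicalSpace E] [SecondCountableTopology E]
    [MeasurableSpace E] [OpensMeasurableSpace E] [MeasurableSpace Ω] [MeasurableSpace Ω']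
    (X : ι → S → Ω → E) (l : Filter ι) (Y : S → Ω' → E)
    (P : Measure Ω) [IsProbabilityMeasure P] (P' : Measure Ω') [IsProbabilityMeasure P'] : Prop :=
  ∀ (n : ℕ) (t : Fin n → S),
    TendstoInDistribution (fun i ω k => X i (t k) ω) l (fun ω k => Y (t k) ω) (fun _ => P) P'

/-- `X` is a centered Gaussian process with values in `B_b'`: the real random variables
`⟨X(t), φ⟩` are jointly Gaussian and have mean `0`. -/
structure IsCenteredGaussianDual {M : ℕ} {Ω : Type*} [MeasurableSpace Ω]
    (X : ℝ≥0 → Ω → BbDual M) (P : Measure Ω) : Prop where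
  measurable : ∀ t, Measurable (X t)
  gaussian : IsGaussianProcess (fun (p : ℝ≥0 × Bb M) ω => X p.1 ω p.2) P
  centered : ∀ t φ, ∫ ω, X t ω φ ∂P = 0

open scoped ENNReal

/-! The initial configuration is Poisson and the particles are independent, so everything reduces to
moments of the occupation times of one walk, summed over its starting point `x`. Let `f_x` be a
linear combination, divided by `√T`, of the times that a walk from `x` spends at points `y_i` up to
times `T t_i`. The sum of `f_x` over all particles has the characteristic function `exp (λ Σ_x E(exp
(i f_x) - 1))`. Centring cancels the term of first order, so a Gaussian limit follows once `Σ_x E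
f_x²` converges and `Σ_x E|f_x|³` tends to `0` (`IsPoissonSystem.tendsto_integral_exp_siteSum`).

Summation over `x` removes the starting point, since counting measure is invariant. Second moments
become `T⁻¹ ∫∫ p_{|s-r|}(y' - y) ds dr`, where the integrand depends only on the time lag and is
integrable in it; the limit is `2 min(a,b) G(y' - y)` for time horizons `Ta` and `Tb`
(`tendsto_lintegral_lintegral_abs_sub`). In third moments the probability that a path is at one
place at three times factorizes by independence of increments, so they are of order at most `T
G(0)²` before scaling (`IsCRandomWalkLaw.tsum_lintegral_occ_pow_three_le`), while the scaling is
`T^(-3/2)`.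

All of this needs a finite Green function `G`, which is where `1 < c` enters. The function `g = Σ_k
c⁻ᵏ 1_{B_k}`, with `B_k` the ball of radius `k` around `0`, satisfies `δ₀ + 𝒫g ≤ g` for the one-jump
operator `𝒫` (`greenBound_superharmonic`); iteration bounds the Green function by `g`, and `g` is
bounded by a geometric series.

The limiting covariance is positive semidefinite because it is a limit of second moments. It is thus
the Gram matrix of vectors in a Hilbert space (`exists_inner_eq_kernel`), and an isonormal process
applied to these vectors gives the limit process (`exists_isonormal`). Finally, the dual space
embeds into a countable product of lines, where convergence of finitely many coordinates in law
implies convergence in law, with no tightness argument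
(`tendstoInDistribution_of_tendsto_integral_exp`). -/

theorem ENNReal.tsum_eq_sum_add_tsum_add (k : ℕ) (f : ℕ → ℝ≥0∞) :
    ∑' n, f n = ∑ n ∈ Finset.range k, f n + ∑' n, f (n + k) :=
  (Summable.sum_add_tsum_nat_add' ENNReal.summable).symm

/-! ### The ultrametric and the size of balls and spheres -/

section Ball

variable {M : ℕ}

/-- The `i`-th coordinate of an element of the hierarchical group. -/
def Hier.coord (x : Hier M) (i : ℕ) : ZMod M := (show ℕ →₀ ZMod M from x) i

theorem Hier.coord_ext {x y : Hier M} (h : ∀ i, x.coord i = y.coord i) : x = y :=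
  Finsupp.ext h

theorem Hier.coord_sub (x y : Hier M) (i : ℕ) : (x - y).coord i = x.coord i - y.coord i := rfl

theorem Hier.coord_neg (x : Hier M) (i : ℕ) : (-x).coord i = -x.coord i := rfl

theorem hierNorm_le_iff {x : Hier M} {k : ℕ} :
    hierNorm x ≤ k ↔ ∀ i, k ≤ i → x.coord i = 0 := by
  rw [hierNorm, Finset.sup_le_iff]
  constructor
  · intro h i hi
    by_contra hx
    have := h i (Finsupp.mem_support_iff.2 hx)
    omega
  · intro h i hi
    by_contra hk
    exact Finsupp.mem_support_iff.1 hi (h i (by omega))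

theorem hierNorm_zero : hierNorm (0 : Hier M) = 0 :=
  Nat.le_zero.1 (hierNorm_le_iff.2 fun _ _ => rfl)

theorem hierNorm_eq_zero {x : Hier M} : hierNorm x = 0 ↔ x = 0 := by
  constructor
  · intro h
    exact Hier.coord_ext fun i => hierNorm_le_iff.1 h.le i (Nat.zero_le _)
  · rintro rfl
    exact hierNorm_zero

theorem hierNorm_neg (x : Hier M) : hierNorm (-x) = hierNorm x := by
  refine le_antisymm (hierNorm_le_iff.2 fun i hi => ?_) (hierNorm_le_iff.2 fun i hi => ?_)
  · rw [Hier.coord_neg, hierNorm_le_iff.1 le_rfl i hi, neg_zero]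
  · have := hierNorm_le_iff.1 (le_refl (hierNorm (-x))) i hi
    rwa [Hier.coord_neg, neg_eq_zero] at this

theorem hierNorm_sub_le {x y : Hier M} {k : ℕ} (hx : hierNorm x ≤ k) (hy : hierNorm y ≤ k) :
    hierNorm (x - y) ≤ k :=
  hierNorm_le_iff.2 fun i hi => by
    rw [Hier.coord_sub, hierNorm_le_iff.1 hx i hi, hierNorm_le_iff.1 hy i hi, sub_zero]

/-- The isosceles property of an ultrametric: were `x - y` shorter than `x`, then `x = (x - y) -
(-y)` would be a difference of two elements shorter than `x`. -/
theorem hierNorm_sub_of_lt {x y : Hier M} (h : hierNorm y < hierNorm x) :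
    hierNorm (x - y) = hierNorm x := by
  refine le_antisymm (hierNorm_sub_le le_rfl h.le) ?_
  by_contra hlt
  rw [not_le] at hlt
  have h1 : hierNorm (x - y - -y) ≤ hierNorm x - 1 :=
    hierNorm_sub_le (by omega) (by rw [hierNorm_neg]; omega)
  rw [sub_neg_eq_add, sub_add_cancel] at h1
  omega

variable (M) in
/-- The ball of radius `k` around `0`, as a finite set. -/
noncomputable def hierBall [NeZero M] (k : ℕ) : Finset (Hier M) :=
  (finite_hierNorm_le M k).toFinset

variable [NeZero M]

theorem mem_hierBall {k : ℕ} {x : Hier M} : x ∈ hierBall M k ↔ hierNorm x ≤ k := by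
  simp [hierBall]

theorem card_hierBall (k : ℕ) : (hierBall M k).card = M ^ k := by
  have h : (hierBall M k).card = (Finset.univ : Finset (Fin k → ZMod M)).card := by
    refine Finset.card_nbij' (fun x i => x.coord i)
      (fun f => (show Hier M from Finsupp.onFinset (Finset.range k)
        (fun i => if h : i < k then f ⟨i, h⟩ else 0)
        fun i hi => by
          by_contra hk
          exact hi (by rw [dif_neg (by simpa using hk)])))
      (fun _ _ => Finset.mem_coe.2 (Finset.mem_univ _)) ?_ ?_ ?_
    · intro f _
      refine Finset.mem_coe.2 (mem_hierBall.2 (hierNorm_le_iff.2 fun i hi => ?_))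
      change (if h : i < k then f ⟨i, h⟩ else 0) = 0
      rw [dif_neg (by omega)]
    · intro x hx
      refine Hier.coord_ext fun i => ?_
      change (if h : i < k then x.coord i else 0) = x.coord i
      split_ifs with h
      · rfl
      · exact (hierNorm_le_iff.1 (mem_hierBall.1 (Finset.mem_coe.1 hx)) i (by omega)).symm
    · intro f _
      funext i
      change (if h : (i : ℕ) < k then f ⟨i, h⟩ else 0) = f i
      rw [dif_pos i.2]
  rw [h, Finset.card_univ, Fintype.card_fun, Fintype.card_fin, ZMod.card]

theorem hierBall_mono {k l : ℕ} (h : k ≤ l) : hierBall M k ⊆ hierBall M l := fun _ hx =>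
  mem_hierBall.2 ((mem_hierBall.1 hx).trans h)

theorem ncard_hierSphere (k : ℕ) :
    ({w : Hier M | hierNorm w = k + 1}.ncard : ℝ) = (M : ℝ) ^ (k + 1) - (M : ℝ) ^ k := by
  have h : {w : Hier M | hierNorm w = k + 1} = ↑(hierBall M (k + 1) \ hierBall M k) := by
    ext w
    simp only [Set.mem_ofPred_eq, Finset.coe_sdiff, Set.mem_sdiff, Finset.mem_coe, mem_hierBall]
    omega
  rw [h, Set.ncard_coe_finset, Finset.card_sdiff_of_subset (hierBall_mono (Nat.le_succ k)),
    card_hierBall, card_hierBall,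
    Nat.cast_sub (Nat.pow_le_pow_right (Nat.pos_of_ne_zero (NeZero.ne M)) (Nat.le_succ k))]
  push_cast
  rfl

end Ball

/-! ### Transience: finiteness of the Green function -/

section Potential

variable {M : ℕ} {c : ℝ}

theorem jumpSizeProb_nonneg (hc : 0 < c) (hcM : c < M) (j : ℕ) : 0 ≤ jumpSizeProb M c j := by
  have hM : (0 : ℝ) < M := hc.trans hcM
  have h1 : c / M ≤ 1 := (div_le_one hM).2 hcM.le
  exact mul_nonneg (by linarith) (by positivity)

theorem jumpProb_nonneg (hc : 0 < c) (hcM : c < M) (y : Hier M) : 0 ≤ jumpProb M c y := by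
  unfold jumpProb
  split_ifs
  · exact le_rfl
  · exact div_nonneg (jumpSizeProb_nonneg hc hcM _) (Nat.cast_nonneg _)

theorem jumpProb_neg (y : Hier M) : jumpProb M c (-y) = jumpProb M c y := by
  simp only [jumpProb, neg_eq_zero, hierNorm_neg]

variable [NeZero M]

theorem jumpProb_of_hierNorm_eq {y : Hier M} {k : ℕ} (hy : hierNorm y = k + 1) :
    jumpProb M c y =
      (1 - c / M) * (c / M) ^ k / ((M : ℝ) ^ (k + 1) - (M : ℝ) ^ k) := by
  have h0 : y ≠ 0 := fun h => by
    rw [h, hierNorm_zero] at hy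
    omega
  rw [jumpProb, if_neg h0, jumpSizeProb, hy, ncard_hierSphere, Nat.add_sub_cancel]

/-- The sphere of radius `k + 1` carries the mass `(1 - c/M)(c/M)^k`, and these masses telescope: a
jump is longer than `k` with probability `(c/M)^k`. -/
theorem sum_jumpProb_hierBall (hM : 1 < M) (k : ℕ) :
    ∑ w ∈ hierBall M k, jumpProb M c w = 1 - (c / M) ^ k := by
  induction k with
  | zero =>
    have h : hierBall M 0 = {0} := by
      ext x
      rw [mem_hierBall, Nat.le_zero, hierNorm_eq_zero, Finset.mem_singleton]
    rw [h, Finset.sum_singleton]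
    simp [jumpProb]
  | succ k ih =>
    rw [← Finset.sum_sdiff (hierBall_mono (Nat.le_succ k)), ih,
      Finset.sum_congr rfl (g := fun _ =>
        (1 - c / M) * (c / M) ^ k / ((M : ℝ) ^ (k + 1) - (M : ℝ) ^ k)), Finset.sum_const,
      Finset.card_sdiff_of_subset (hierBall_mono (Nat.le_succ k)), card_hierBall, card_hierBall,
      nsmul_eq_mul,
      Nat.cast_sub (Nat.pow_le_pow_right (Nat.pos_of_ne_zero (NeZero.ne M)) (Nat.le_succ k))]
    · have hM' : (1 : ℝ) < M := by exact_mod_cast hM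
      have h1 : (0 : ℝ) < (M : ℝ) ^ (k + 1) - (M : ℝ) ^ k := by
        rw [pow_succ, ← mul_sub_one]
        exact mul_pos (by positivity) (by linarith)
      push_cast
      rw [mul_div_cancel₀ _ h1.ne']
      ring
    · intro w hw
      rw [Finset.mem_sdiff, mem_hierBall, mem_hierBall] at hw
      exact jumpProb_of_hierNorm_eq (by omega)

/-- A ball around `0` is a subgroup, so `w ↦ y - w` permutes it when it contains `y`. -/
theorem sum_jumpProb_sub_of_le (hM : 1 < M) {y : Hier M} {k : ℕ} (hy : hierNorm y ≤ k) :
    ∑ w ∈ hierBall M k, jumpProb M c (y - w) = 1 - (c / M) ^ k := by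
  rw [← sum_jumpProb_hierBall hM k]
  refine Finset.sum_nbij' (fun w => y - w) (fun w => y - w) ?_ ?_ ?_ ?_ ?_
  · exact fun w hw => mem_hierBall.2 (hierNorm_sub_le hy (mem_hierBall.1 hw))
  · exact fun w hw => mem_hierBall.2 (hierNorm_sub_le hy (mem_hierBall.1 hw))
  · simp
  · simp
  · simp

/-- By the isosceles property all points of the ball are at the same distance `m + 1` from `y`, so
the summands are equal. -/
theorem sum_jumpProb_sub_of_gt {y : Hier M} {k m : ℕ} (hk : k ≤ m)
    (hy : hierNorm y = m + 1) :
    ∑ w ∈ hierBall M k, jumpProb M c (y - w) =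
      (M : ℝ) ^ k * ((1 - c / M) * (c / M) ^ m / ((M : ℝ) ^ (m + 1) - (M : ℝ) ^ m)) := by
  rw [Finset.sum_congr rfl (g := fun _ =>
        (1 - c / M) * (c / M) ^ m / ((M : ℝ) ^ (m + 1) - (M : ℝ) ^ m)), Finset.sum_const,
      card_hierBall, nsmul_eq_mul]
  · push_cast
    rfl
  · intro w hw
    rw [mem_hierBall] at hw
    exact jumpProb_of_hierNorm_eq ((hierNorm_sub_of_lt (by omega)).trans hy)

/-- The `n`-step transition probabilities with values in `ℝ≥0∞`. -/
noncomputable def stepENN (M : ℕ) (c : ℝ) : ℕ → Hier M → ℝ≥0∞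
  | 0 => fun y => if y = 0 then 1 else 0
  | n + 1 => fun y => ∑' w : Hier M, stepENN M c n w * ENNReal.ofReal (jumpProb M c (y - w))

/-- A potential of the walk, which dominates the Green function. -/
noncomputable def greenBound (c : ℝ) (x : Hier M) : ℝ≥0∞ :=
  ∑' k : ℕ, if hierNorm x ≤ k then ENNReal.ofReal (c⁻¹ ^ k) else 0

omit [NeZero M] in
theorem greenBound_le (x : Hier M) : greenBound c x ≤ ∑' k : ℕ, ENNReal.ofReal (c⁻¹ ^ k) :=
  ENNReal.tsum_le_tsum fun k => by split_ifs <;> simp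

theorem tsum_inv_pow_ne_top (hc : 1 < c) : ∑' k : ℕ, ENNReal.ofReal (c⁻¹ ^ k) ≠ ∞ := by
  have h0 : 0 ≤ c⁻¹ := by positivity
  rw [← ENNReal.ofReal_tsum_of_nonneg (fun k => by positivity)
    (summable_geometric_of_lt_one h0 (inv_lt_one_of_one_lt₀ hc))]
  exact ENNReal.ofReal_ne_top

-- With `a = c/M` the left side is a finite geometric sum in `a`, and it equals `1 - a^(m+1)` times
-- the right side. The left side is the gain from balls that miss a point of norm `m + 1`, the right
-- side the loss from balls that contain it.
omit [NeZero M] in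
theorem greenBound_superharmonic_real (hc : 1 < c) (hcM : c < M) (m : ℕ) :
    ∑ k ∈ Finset.range (m + 1), c⁻¹ ^ k *
      ((M : ℝ) ^ k * ((1 - c / M) * (c / M) ^ m / ((M : ℝ) ^ (m + 1) - (M : ℝ) ^ m))) ≤
    ∑' k : ℕ, ((M : ℝ)⁻¹) ^ (k + (m + 1)) := by
  have hM : (1 : ℝ) < M := hc.trans hcM
  have hM0 : (0 : ℝ) < M := by linarith
  have hc0 : 0 < c := by linarith
  set a : ℝ := c / M with ha
  have ha0 : 0 < a := by positivity
  have ha1 : a < 1 := (div_lt_one hM0).2 hcM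
  have hMi : (M : ℝ)⁻¹ < 1 := inv_lt_one_of_one_lt₀ hM
  have h1 : ∀ k ∈ Finset.range (m + 1), c⁻¹ ^ k *
      ((M : ℝ) ^ k * ((1 - a) * a ^ m / ((M : ℝ) ^ (m + 1) - (M : ℝ) ^ m))) =
      (1 - a) / ((M : ℝ) ^ (m + 1) - (M : ℝ) ^ m) * a ^ (m + 1 - 1 - k) := by
    intro k hk
    rw [Finset.mem_range] at hk
    have h2 : c⁻¹ ^ k * (M : ℝ) ^ k = (a ^ k)⁻¹ := by
      rw [ha, ← mul_pow, ← inv_pow, inv_div]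
      congr 1
      field_simp
    have h3 : a ^ m = a ^ (m + 1 - 1 - k) * a ^ k := by
      rw [← pow_add]
      congr 1
      omega
    rw [← mul_assoc, h2, h3]
    field_simp
  rw [Finset.sum_congr rfl h1, ← Finset.mul_sum,
    Finset.sum_range_reflect (fun j => a ^ j) (m + 1), geom_sum_eq ha1.ne, tsum_congr fun k =>
      pow_add _ _ _, tsum_mul_right, tsum_geometric_of_lt_one (by positivity) hMi]
  have h4 : (M : ℝ) ^ (m + 1) - (M : ℝ) ^ m = (M : ℝ) ^ (m + 1) * (1 - (M : ℝ)⁻¹) := by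
    rw [mul_sub, mul_one, pow_succ, mul_inv_cancel_right₀ hM0.ne']
  have h5 : 0 < 1 - (M : ℝ)⁻¹ := by linarith
  have h6 : (1 - a) * ((a ^ (m + 1) - 1) / (a - 1)) = 1 - a ^ (m + 1) := by
    have : a - 1 ≠ 0 := by linarith
    field_simp
    ring
  rw [h4, div_mul_eq_mul_div, h6, inv_pow, ← mul_inv, mul_comm ((M : ℝ) ^ (m + 1)), ← one_div (_ * _)]
  gcongr
  have : 0 < a ^ (m + 1) := by positivity
  linarith

/-- If `B_k` contains `y`, one jump turns the value `c⁻ᵏ` of `c⁻ᵏ 1_{B_k}` at `y` into `c⁻ᵏ - M⁻ᵏ`.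
For `y ≠ 0` the total loss `Σ_{k ≥ |y|} M⁻ᵏ` covers what flows in from the smaller balls. For `y =
0` there are no smaller balls, and the loss at `k = 0`, which is `1`, pays for the point mass. -/
theorem greenBound_superharmonic (hc : 1 < c) (hcM : c < M) (y : Hier M) :
    (if y = 0 then 1 else 0) +
      ∑' w, greenBound c w * ENNReal.ofReal (jumpProb M c (y - w)) ≤ greenBound c y := by
  have hM : (1 : ℝ) < M := hc.trans hcM
  have hM1 : 1 < M := by exact_mod_cast hM
  have hM0 : (0 : ℝ) < M := by linarith
  have hc0 : 0 < c := by linarith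
  have ha0 : 0 < c / M := by positivity
  have ha1 : c / M < 1 := (div_lt_one hM0).2 hcM
  have hMi : (M : ℝ)⁻¹ < 1 := inv_lt_one_of_one_lt₀ hM
  have hMsum : ∀ m : ℕ, Summable fun k : ℕ => ((M : ℝ)⁻¹) ^ (k + m) := fun m =>
    (summable_nat_add_iff m).2 (summable_geometric_of_lt_one (by positivity) hMi)
  set S : ℕ → ℝ := fun k => ∑ w ∈ hierBall M k, jumpProb M c (y - w) with hS
  have hS0 : ∀ k, 0 ≤ S k := fun k =>
    Finset.sum_nonneg fun w _ => jumpProb_nonneg hc0 hcM _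
  have h1 : ∑' w, greenBound c w * ENNReal.ofReal (jumpProb M c (y - w)) =
      ∑' k : ℕ, ENNReal.ofReal (c⁻¹ ^ k * S k) := by
    simp only [greenBound, ← ENNReal.tsum_mul_right]
    rw [ENNReal.tsum_comm]
    refine tsum_congr fun k => ?_
    rw [tsum_eq_sum (s := hierBall M k), ENNReal.ofReal_mul (by positivity), hS,
      ENNReal.ofReal_sum_of_nonneg fun w _ => jumpProb_nonneg hc0 hcM _, Finset.mul_sum]
    · refine Finset.sum_congr rfl fun w hw => ?_
      rw [if_pos (mem_hierBall.1 hw)]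
    · intro w hw
      rw [if_neg (fun h => hw (mem_hierBall.2 h)), zero_mul]
  have htail : ∀ k, hierNorm y ≤ k →
      ENNReal.ofReal (c⁻¹ ^ k * S k) + ENNReal.ofReal ((M : ℝ)⁻¹ ^ k) =
        ENNReal.ofReal (c⁻¹ ^ k) := by
    intro k hk
    rw [← ENNReal.ofReal_add (mul_nonneg (by positivity) (hS0 k)) (by positivity), hS]
    simp only
    rw [sum_jumpProb_sub_of_le hM1 hk, mul_sub, mul_one, ← mul_pow]
    congr 1
    have : c⁻¹ * (c / M) = (M : ℝ)⁻¹ := by field_simp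
    rw [this]
    ring
  rw [h1, greenBound]
  rcases Nat.eq_zero_or_eq_succ_pred (hierNorm y) with h0 | hm
  · rw [if_pos (hierNorm_eq_zero.1 h0)]
    have h2 : ∀ k : ℕ, (if hierNorm y ≤ k then ENNReal.ofReal (c⁻¹ ^ k) else 0) =
        ENNReal.ofReal (c⁻¹ ^ k * S k) + ENNReal.ofReal ((M : ℝ)⁻¹ ^ k) := by
      intro k
      rw [if_pos (by omega), htail k (by omega)]
    rw [tsum_congr h2, ENNReal.tsum_add, add_comm]
    gcongr
    refine le_trans ?_ (ENNReal.le_tsum 0)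
    simp
  · set m := (hierNorm y).pred
    have hm' : hierNorm y = m + 1 := hm
    have hy0 : y ≠ 0 := fun h => by
      rw [h, hierNorm_zero] at hm'
      omega
    rw [if_neg hy0, zero_add, ENNReal.tsum_eq_sum_add_tsum_add (m + 1),
      ENNReal.tsum_eq_sum_add_tsum_add (m + 1) fun k : ℕ =>
        if hierNorm y ≤ k then ENNReal.ofReal (c⁻¹ ^ k) else 0]
    have h3 : ∀ k : ℕ, (if hierNorm y ≤ k + (m + 1) then ENNReal.ofReal (c⁻¹ ^ (k + (m + 1)))
        else 0) = ENNReal.ofReal (c⁻¹ ^ (k + (m + 1)) * S (k + (m + 1))) +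
          ENNReal.ofReal ((M : ℝ)⁻¹ ^ (k + (m + 1))) := by
      intro k
      rw [if_pos (by omega), htail _ (by omega)]
    rw [tsum_congr h3, ENNReal.tsum_add, add_comm]
    refine le_trans ?_ le_add_self
    gcongr
    rw [← ENNReal.ofReal_sum_of_nonneg fun k _ => mul_nonneg (by positivity) (hS0 k),
      ← ENNReal.ofReal_tsum_of_nonneg (fun k => by positivity) (hMsum _)]
    refine ENNReal.ofReal_le_ofReal (le_trans (le_of_eq ?_)
      (greenBound_superharmonic_real hc hcM m))
    refine Finset.sum_congr rfl fun k hk => ?_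
    rw [Finset.mem_range] at hk
    rw [hS]
    simp only
    rw [sum_jumpProb_sub_of_gt (by omega) hm']

/-- Comparison by induction: with the term `n = 0` split off, the partial Green sum is the point
mass plus one jump applied to the shorter sum, so superharmonicity closes the step. -/
theorem sum_stepENN_le (hc : 1 < c) (hcM : c < M) (N : ℕ) (y : Hier M) :
    ∑ n ∈ Finset.range N, stepENN M c n y ≤ greenBound c y := by
  induction N generalizing y with
  | zero => simp
  | succ N ih =>
    rw [Finset.sum_range_succ']
    refine le_trans ?_ (greenBound_superharmonic hc hcM y)
    rw [add_comm]
    refine add_le_add le_rfl ?_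
    simp only [stepENN]
    rw [← Summable.tsum_finsetSum fun n _ => ENNReal.summable]
    refine ENNReal.tsum_le_tsum fun w => ?_
    rw [← Finset.sum_mul]
    gcongr
    exact ih w

theorem tsum_stepENN_le (hc : 1 < c) (hcM : c < M) (y : Hier M) :
    ∑' n, stepENN M c n y ≤ greenBound c y := by
  rw [ENNReal.tsum_eq_iSup_nat]
  exact iSup_le fun N => sum_stepENN_le hc hcM N y

theorem tsum_stepENN_ne_top (hc : 1 < c) (hcM : c < M) (y : Hier M) :
    ∑' n, stepENN M c n y ≠ ∞ :=
  ne_top_of_le_ne_top (tsum_inv_pow_ne_top hc) ((tsum_stepENN_le hc hcM y).trans (greenBound_le y))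

theorem stepENN_ne_top (hc : 1 < c) (hcM : c < M) (n : ℕ) (y : Hier M) :
    stepENN M c n y ≠ ∞ :=
  ne_top_of_le_ne_top (tsum_stepENN_ne_top hc hcM y) (ENNReal.le_tsum n)

/-- Finite terms are enough for passing from `ℝ≥0∞` to `ℝ`; their finiteness is taken from the Green
bound, so no total mass of the step probabilities has to be computed. -/
theorem toReal_stepENN (hc : 1 < c) (hcM : c < M) (n : ℕ) (y : Hier M) :
    (stepENN M c n y).toReal = stepProb M c n y := by
  induction n generalizing y with
  | zero => simp only [stepENN, stepProb]; split_ifs <;> simp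
  | succ n ih =>
    simp only [stepENN, stepProb]
    rw [ENNReal.tsum_toReal_eq fun w =>
      ENNReal.mul_ne_top (stepENN_ne_top hc hcM n w) ENNReal.ofReal_ne_top]
    refine tsum_congr fun w => ?_
    rw [ENNReal.toReal_mul, ih, ENNReal.toReal_ofReal (jumpProb_nonneg (by linarith) hcM _)]

omit [NeZero M] in
theorem stepENN_neg (n : ℕ) (y : Hier M) : stepENN M c n (-y) = stepENN M c n y := by
  induction n generalizing y with
  | zero => simp only [stepENN, neg_eq_zero]
  | succ n ih =>
    simp only [stepENN]
    rw [← (Equiv.neg (Hier M)).tsum_eq]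
    refine tsum_congr fun w => ?_
    rw [Equiv.neg_apply, ih, ← jumpProb_neg]
    congr 3
    abel

/-- The transition probabilities `p_t(0, y)` with values in `ℝ≥0∞`. -/
noncomputable def transENN (M : ℕ) (c t : ℝ) (y : Hier M) : ℝ≥0∞ :=
  ∑' n : ℕ, ENNReal.ofReal (Real.exp (-t) * (t ^ n / (n.factorial : ℝ))) * stepENN M c n y

omit [NeZero M] in
theorem transENN_neg (t : ℝ) (y : Hier M) : transENN M c t (-y) = transENN M c t y := by
  simp only [transENN, stepENN_neg]

omit [NeZero M] in
theorem measurable_transENN (y : Hier M) : Measurable fun t => transENN M c t y := by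
  unfold transENN
  fun_prop

/-- The Green function of the walk. -/
noncomputable def greenENN (M : ℕ) (c : ℝ) (y : Hier M) : ℝ≥0∞ := ∑' n, stepENN M c n y

/-- The integral `Γ(n+1) = n!`. In probabilistic terms the mean waiting time between jumps is one,
so the Green functions in continuous and discrete time agree. -/
theorem lintegral_exp_neg_mul_pow (n : ℕ) :
    ∫⁻ t in Set.Ioi (0 : ℝ), ENNReal.ofReal (Real.exp (-t) * (t ^ n / (n.factorial : ℝ))) = 1 := by
  have h1 : ∀ t ∈ Set.Ioi (0 : ℝ), Real.exp (-t) * (t ^ n / (n.factorial : ℝ)) =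
      Real.exp (-t) * t ^ ((n + 1 : ℝ) - 1) / n.factorial := by
    intro t ht
    rw [add_sub_cancel_right, Real.rpow_natCast, mul_div_assoc]
  have h2 := Real.GammaIntegral_convergent (s := n + 1) (by positivity)
  rw [setLIntegral_congr_fun measurableSet_Ioi fun t ht => by rw [h1 t ht],
    ← ofReal_integral_eq_lintegral_ofReal (h2.div_const _), integral_div,
    ← Real.Gamma_eq_integral (by positivity), Real.Gamma_nat_eq_factorial,
    div_self (by positivity), ENNReal.ofReal_one]
  filter_upwards [ae_restrict_mem measurableSet_Ioi] with t ht
  have : (0 : ℝ) < t := ht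
  positivity

omit [NeZero M] in
theorem lintegral_transENN (y : Hier M) :
    ∫⁻ t in Set.Ioi (0 : ℝ), transENN M c t y = greenENN M c y := by
  unfold transENN greenENN
  rw [lintegral_tsum fun n => by fun_prop]
  refine tsum_congr fun n => ?_
  rw [lintegral_mul_const _ (by fun_prop), lintegral_exp_neg_mul_pow, one_mul]

theorem transENN_ne_top (hc : 1 < c) (hcM : c < M) {t : ℝ} (ht : 0 ≤ t) (y : Hier M) :
    transENN M c t y ≠ ∞ := by
  refine ne_top_of_le_ne_top (tsum_stepENN_ne_top hc hcM y) (ENNReal.tsum_le_tsum fun n => ?_)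
  have h : Real.exp (-t) * (t ^ n / (n.factorial : ℝ)) ≤ 1 := by
    rw [Real.exp_neg, inv_mul_le_one₀ (Real.exp_pos t)]
    exact Real.pow_div_factorial_le_exp t ht n
  exact mul_le_of_le_one_left (zero_le) (ENNReal.ofReal_le_one.2 h)

theorem toReal_transENN (hc : 1 < c) (hcM : c < M) {t : ℝ} (ht : 0 ≤ t) (y : Hier M) :
    (transENN M c t y).toReal = transProb M c t y := by
  rw [transENN, transProb, ENNReal.tsum_toReal_eq fun n =>
    ENNReal.mul_ne_top ENNReal.ofReal_ne_top (stepENN_ne_top hc hcM n y), ← tsum_mul_left]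
  refine tsum_congr fun n => ?_
  rw [ENNReal.toReal_mul, toReal_stepENN hc hcM, ENNReal.toReal_ofReal (by positivity), mul_assoc]

theorem ofReal_transProb (hc : 1 < c) (hcM : c < M) {t : ℝ} (ht : 0 ≤ t) (y : Hier M) :
    ENNReal.ofReal (transProb M c t y) = transENN M c t y := by
  rw [← toReal_transENN hc hcM ht, ENNReal.ofReal_toReal (transENN_ne_top hc hcM ht y)]

theorem integrableOn_transENN (hc : 1 < c) (hcM : c < M) (y : Hier M) :
    IntegrableOn (fun t => (transENN M c t y).toReal) (Set.Ioi 0) :=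
  integrable_toReal_of_lintegral_ne_top (measurable_transENN y).aemeasurable
    (by rw [lintegral_transENN]; exact tsum_stepENN_ne_top hc hcM y)

theorem integrableOn_transProb (hc : 1 < c) (hcM : c < M) (y : Hier M) :
    IntegrableOn (fun t => transProb M c t y) (Set.Ioi 0) :=
  (integrableOn_transENN hc hcM y).congr_fun
    (fun _ ht => toReal_transENN hc hcM (le_of_lt ht) y) measurableSet_Ioi

theorem integral_transProb (hc : 1 < c) (hcM : c < M) (y : Hier M) :
    ∫ t in Set.Ioi (0 : ℝ), transProb M c t y = (greenENN M c y).toReal := by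
  rw [← lintegral_transENN, ← integral_toReal (measurable_transENN y).aemeasurable]
  · exact setIntegral_congr_fun measurableSet_Ioi
      fun t ht => (toReal_transENN hc hcM (le_of_lt ht) y).symm
  · filter_upwards [ae_restrict_mem measurableSet_Ioi] with t ht
    exact (transENN_ne_top hc hcM (le_of_lt ht) y).lt_top

theorem semigroup_eq_sum (t : ℝ) (φ : Bb M) (x : Hier M) :
    semigroup c t φ x = ∑ y ∈ (Bb.finite_support φ).toFinset,
      transProb M c t (y - x) * (φ : Hier M → ℝ) y := by
  refine tsum_eq_sum fun y hy => ?_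
  rw [Set.Finite.mem_toFinset, Function.notMem_support] at hy
  rw [hy, mul_zero]

theorem integrableOn_semigroup (hc : 1 < c) (hcM : c < M) (φ : Bb M) (x : Hier M) :
    IntegrableOn (fun t => semigroup c t φ x) (Set.Ioi 0) := by
  simp only [semigroup_eq_sum]
  exact integrable_finsetSum _ fun y _ => (integrableOn_transProb hc hcM (y - x)).mul_const _

theorem potential_eq_sum (hc : 1 < c) (hcM : c < M) (φ : Bb M) (x : Hier M) :
    potential c φ x = ∑ y ∈ (Bb.finite_support φ).toFinset,
      (greenENN M c (y - x)).toReal * (φ : Hier M → ℝ) y := by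
  simp only [potential, semigroup_eq_sum]
  rw [integral_finsetSum _ fun y _ => (integrableOn_transProb hc hcM (y - x)).mul_const _]
  refine Finset.sum_congr rfl fun y _ => ?_
  rw [integral_mul_const, integral_transProb hc hcM]

end Potential

/-! ### Path laws and jointly measurable occupation times -/

section Paths

variable {M : ℕ} [NeZero M] {c : ℝ}

namespace IsCRandomWalk

variable {Ω : Type*} [MeasurableSpace Ω] {P : Measure Ω} {Z Z' : ℝ≥0 → Ω → Hier M}

omit [NeZero M] in
theorem measurable_path (hZ : IsCRandomWalk M c Z P) : Measurable fun ω t => Z t ω :=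
  measurable_pi_lambda _ hZ.measurable

omit [NeZero M] in
theorem isProbabilityMeasure (hZ : IsCRandomWalk M c Z P) : IsProbabilityMeasure P :=
  (hZ.indep 0 (fun _ => 0) (fun _ _ _ => le_rfl)).isProbabilityMeasure

theorem measure_sub_eq_of_le (hc : 1 < c) (hcM : c < M) (hZ : IsCRandomWalk M c Z P)
    {s t : ℝ≥0} (hst : s ≤ t) (y : Hier M) :
    P {ω | Z t ω - Z s ω = y} = transENN M c (t - s : ℝ≥0) y := by
  have := hZ.isProbabilityMeasure
  have h := hZ.law s (t - s) y
  rw [add_tsub_cancel_of_le hst] at h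
  rw [← ofReal_measureReal, h, ofReal_transProb hc hcM (NNReal.coe_nonneg _)]

/-- For `t ≤ s` the increment is reversed; the symmetry of the jump law absorbs the sign, which is
why only `|t - s|` appears. -/
theorem measure_sub_eq (hc : 1 < c) (hcM : c < M) (hZ : IsCRandomWalk M c Z P)
    (s t : ℝ≥0) (y : Hier M) :
    P {ω | Z t ω - Z s ω = y} = transENN M c |(t : ℝ) - s| y := by
  rcases le_total s t with h | h
  · rw [hZ.measure_sub_eq_of_le hc hcM h, NNReal.coe_sub h,
      abs_of_nonneg (sub_nonneg.2 (NNReal.coe_le_coe.2 h))]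
  · have h1 : {ω | Z t ω - Z s ω = y} = {ω | Z s ω - Z t ω = -y} := by
      ext ω
      simp only [Set.mem_ofPred_eq]
      rw [← neg_sub, neg_eq_iff_eq_neg]
    rw [h1, hZ.measure_sub_eq_of_le hc hcM h, transENN_neg, NNReal.coe_sub h, abs_sub_comm,
      abs_of_nonneg (sub_nonneg.2 (NNReal.coe_le_coe.2 h))]

theorem measure_eq_eq (hc : 1 < c) (hcM : c < M) (hZ : IsCRandomWalk M c Z P)
    {r s t : ℝ≥0} (hrs : r ≤ s) (hst : s ≤ t) :
    P {ω | Z r ω = Z s ω ∧ Z s ω = Z t ω} =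
      transENN M c |(s : ℝ) - r| 0 * transENN M c |(t : ℝ) - s| 0 := by
  have h := (hZ.indep.indepFun_sub_sub hrs hst).measure_inter_preimage_eq_mul {0} {0}
    (measurableSet_singleton _) (measurableSet_singleton _)
  rw [← hZ.measure_sub_eq hc hcM, ← hZ.measure_sub_eq hc hcM]
  refine Eq.trans (congrArg P ?_) h
  ext ω
  simp only [Set.mem_ofPred_eq, Set.mem_inter_iff, Set.mem_preimage, Pi.sub_apply,
    Set.mem_singleton_iff, sub_eq_zero]
  exact and_congr eq_comm eq_comm

/-- Outside the null set where the walk does not start at `0`, prescribing the positions is the same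
as prescribing the increments, which are independent. -/
theorem measure_finset_eq (hc : 1 < c) (hcM : c < M) (hZ : IsCRandomWalk M c Z P)
    {n : ℕ} {t : Fin (n + 1) → ℝ≥0} (ht : Monotone t) (ht0 : t 0 = 0)
    {b : Fin (n + 1) → Hier M} (hb0 : b 0 = 0) :
    P {ω | ∀ i : Fin n, Z (t i.succ) ω = b i.succ} =
      ∏ i : Fin n, transENN M c (t i.succ - t i.castSucc : ℝ≥0) (b i.succ - b i.castSucc) := by
  have h := (hZ.indep n t ht).measure_inter_preimage_eq_mul Finset.univ
    (sets := fun i => {b i.succ - b i.castSucc}) (fun _ _ => measurableSet_singleton _)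
  have h1 : ∀ i : Fin n, P ((fun ω => Z (t i.succ) ω - Z (t i.castSucc) ω) ⁻¹'
      {b i.succ - b i.castSucc}) =
      transENN M c (t i.succ - t i.castSucc : ℝ≥0) (b i.succ - b i.castSucc) := fun i =>
    hZ.measure_sub_eq_of_le hc hcM (ht (Fin.castSucc_lt_succ).le) _
  rw [Finset.prod_congr rfl fun i _ => h1 i] at h
  rw [← h]
  refine measure_congr ?_
  filter_upwards [hZ.start] with ω hω
  refine propext ?_
  change (∀ i : Fin n, Z (t i.succ) ω = b i.succ) ↔
    ω ∈ ⋂ i ∈ Finset.univ, (fun ω => Z (t i.succ) ω - Z (t (Fin.castSucc i)) ω) ⁻¹'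
      {b i.succ - b i.castSucc}
  simp only [Finset.mem_univ, Set.iInter_true, Set.mem_iInter, Set.mem_preimage,
    Set.mem_singleton_iff]
  constructor
  · intro hall
    have hall' : ∀ i : Fin (n + 1), Z (t i) ω = b i :=
      Fin.cases (by rw [ht0, hω, hb0]) hall
    exact fun i => by rw [hall', hall']
  · intro hinc
    have hall' : ∀ i : Fin (n + 1), Z (t i) ω = b i := by
      intro i
      induction i using Fin.induction with
      | zero => rw [ht0, hω, hb0]
      | succ i ih =>
        have := hinc i
        rwa [ih, sub_left_inj] at this
    exact fun i => hall' _

/-- A law on the product σ-algebra is determined by its finite-dimensional marginals, and these, on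
a countable discrete space, by the masses of points. Hence all particles have the same mark
distribution. -/
theorem map_path_eq (hc : 1 < c) (hcM : c < M) (hZ : IsCRandomWalk M c Z P)
    (hZ' : IsCRandomWalk M c Z' P) :
    P.map (fun ω t => Z t ω) = P.map (fun ω t => Z' t ω) := by
  have := hZ.isProbabilityMeasure
  refine (map_eq_iff_forall_finset_map_restrict_eq hZ.measurable_path.aemeasurable
    hZ'.measurable_path.aemeasurable).2 fun I => ?_
  refine Measure.ext_of_singleton fun a => ?_
  -- The sorted times are preceded by time `0` with position `0`, so that the first position is also
  -- an increment.
  set t : Fin (I.card + 1) → ℝ≥0 := Fin.cons 0 (I.orderEmbOfFin rfl)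
  set b : Fin (I.card + 1) → Hier M :=
    Fin.cons 0 fun i => a ⟨I.orderEmbOfFin rfl i, I.orderEmbOfFin_mem rfl i⟩
  have ht : Monotone t := by
    intro i j hij
    induction i using Fin.cases with
    | zero => exact zero_le
    | succ i =>
      induction j using Fin.cases with
      | zero => exact absurd hij (by simp)
      | succ j => exact (I.orderEmbOfFin rfl).monotone (Fin.succ_le_succ_iff.1 hij)
  have hpre : ∀ X : ℝ≥0 → Ω → Hier M, (fun ω => I.restrict fun t => X t ω) ⁻¹' {a} =
      {ω | ∀ i : Fin I.card, X (t i.succ) ω = b i.succ} := by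
    intro X
    ext ω
    simp only [Set.mem_preimage, Set.mem_singleton_iff, Set.mem_ofPred_eq, t, b, Fin.cons_succ]
    constructor
    · intro h i
      rw [← h]
      rfl
    · intro h
      funext ⟨s, hs⟩
      obtain ⟨i, hi⟩ : s ∈ Set.range (I.orderEmbOfFin rfl) := by
        rw [Finset.range_orderEmbOfFin]
        exact hs
      subst hi
      exact h i
  have hmeas : ∀ {X : ℝ≥0 → Ω → Hier M}, IsCRandomWalk M c X P →
      Measurable fun ω => I.restrict fun t => X t ω := fun hX =>
    (Finset.measurable_restrict I).comp hX.measurable_path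
  rw [Measure.map_apply (hmeas hZ) (measurableSet_singleton _),
    Measure.map_apply (hmeas hZ') (measurableSet_singleton _), hpre, hpre,
    hZ.measure_finset_eq hc hcM ht (Fin.cons_zero _ _) (Fin.cons_zero _ _),
    hZ'.measure_finset_eq hc hcM ht (Fin.cons_zero _ _) (Fin.cons_zero _ _)]

end IsCRandomWalk

/-- The point of the grid of mesh `1 / (n + 1)` that follows `r`. -/
noncomputable def gridRight (n : ℕ) (r : ℝ≥0) : ℝ≥0 := (⌊(n + 1) * r⌋₊ + 1) / (n + 1)

theorem lt_gridRight (n : ℕ) (r : ℝ≥0) : r < gridRight n r := by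
  rw [gridRight, lt_div_iff₀ (by positivity), mul_comm]
  exact Nat.lt_floor_add_one _

theorem gridRight_le (n : ℕ) (r : ℝ≥0) : gridRight n r ≤ r + 1 / (n + 1) := by
  rw [gridRight, add_div]
  gcongr
  rw [div_le_iff₀ (by positivity), mul_comm]
  exact Nat.floor_le (by positivity)

theorem tendsto_gridRight (r : ℝ≥0) :
    Tendsto (fun n => gridRight n r) atTop (𝓝[≥] r) := by
  refine tendsto_nhdsWithin_iff.2 ⟨?_, Eventually.of_forall fun n => (lt_gridRight n r).le⟩
  refine tendsto_of_tendsto_of_tendsto_of_le_of_le tendsto_const_nhds ?_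
    (fun n => (lt_gridRight n r).le) (fun n => gridRight_le n r)
  simpa using tendsto_const_nhds.add (tendsto_one_div_add_atTop_nhds_zero_nat (𝕜 := ℝ≥0))

/-- The pairs of a path and a time such that the path takes the value `y` at the points of a
grid that lie immediately to the right of this time.  For a right continuous path, this means
that its value at this time is `y`. -/
def visits (y : Hier M) : Set ((ℝ≥0 → Hier M) × ℝ) :=
  {p | ∀ᶠ n in atTop, p.1 (gridRight n p.2.toNNReal) = y}

-- Evaluation `(w, r) ↦ w r` is not jointly measurable on the space of all paths. Its grid versions
-- are, since `gridRight n` has countably many values, and `visits` is a lower limit of the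
-- corresponding sets.
omit [NeZero M] in
theorem measurableSet_visits (y : Hier M) : MeasurableSet (visits y) := by
  have h : ∀ n : ℕ, MeasurableSet
      {p : (ℝ≥0 → Hier M) × ℝ | p.1 (gridRight n p.2.toNNReal) = y} := by
    intro n
    have h1 : {p : (ℝ≥0 → Hier M) × ℝ | p.1 (gridRight n p.2.toNNReal) = y} =
        ⋃ m : ℕ, {p | ⌊((n : ℝ≥0) + 1) * p.2.toNNReal⌋₊ = m} ∩ {p | p.1 ((m + 1) / (n + 1)) = y} := by
      ext p
      simp [gridRight]
    rw [h1]
    refine MeasurableSet.iUnion fun m => MeasurableSet.inter ?_ ?_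
    · exact (Nat.measurable_floor.comp (by fun_prop :
        Measurable fun p : (ℝ≥0 → Hier M) × ℝ => ((n : ℝ≥0) + 1) * p.2.toNNReal))
        (measurableSet_singleton m)
    · exact (by fun_prop : Measurable fun p : (ℝ≥0 → Hier M) × ℝ => p.1 ((m + 1) / (n + 1)))
        (measurableSet_singleton y)
  have h2 : visits y = ⋃ N : ℕ, ⋂ n : ℕ, ⋂ _ : N ≤ n,
      {p : (ℝ≥0 → Hier M) × ℝ | p.1 (gridRight n p.2.toNNReal) = y} := by
    ext p
    simp [visits, eventually_atTop]
  rw [h2]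
  exact MeasurableSet.iUnion fun N => MeasurableSet.iInter fun n => MeasurableSet.iInter fun _ => h n

omit [NeZero M] in
theorem mem_visits_iff {w : ℝ≥0 → Hier M} (hw : ∀ t, ∀ᶠ s in 𝓝[≥] t, w s = w t) (r : ℝ)
    (y : Hier M) : (w, r) ∈ visits y ↔ w r.toNNReal = y := by
  have h : ∀ᶠ n in atTop, w (gridRight n r.toNNReal) = w r.toNNReal :=
    (tendsto_gridRight r.toNNReal).eventually (hw r.toNNReal)
  constructor
  · intro hy
    obtain ⟨n, h1, h2⟩ := (h.and hy).exists
    exact h1.symm.trans h2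
  · intro hy
    exact h.mono fun n hn => hn.trans hy

/-- The indicator function of `visits`. -/
noncomputable def visitInd (y : Hier M) (p : (ℝ≥0 → Hier M) × ℝ) : ℝ≥0∞ :=
  (visits y).indicator 1 p

omit [NeZero M] in
theorem measurable_visitInd (y : Hier M) : Measurable (visitInd y) :=
  measurable_one.indicator (measurableSet_visits y)

omit [NeZero M] in
theorem visitInd_le_one (y : Hier M) (p : (ℝ≥0 → Hier M) × ℝ) : visitInd y p ≤ 1 :=
  Set.indicator_le (fun _ _ => le_rfl) p

omit [NeZero M] in
theorem visitInd_eq_ite {w : ℝ≥0 → Hier M} {r : ℝ} (hw : ∀ y, (w, r) ∈ visits y ↔ w r.toNNReal = y)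
    (y : Hier M) : visitInd y (w, r) = if w r.toNNReal = y then 1 else 0 := by
  classical
  rw [visitInd, Set.indicator_apply]
  simp only [hw y, Pi.one_apply]

/-- The occupation time of `y` up to time `τ`. -/
noncomputable def occ (τ : ℝ) (y : Hier M) (w : ℝ≥0 → Hier M) : ℝ≥0∞ :=
  ∫⁻ r in Set.Ioc 0 τ, visitInd y (w, r)

omit [NeZero M] in
theorem measurable_occ (τ : ℝ) (y : Hier M) : Measurable (occ τ y) :=
  (measurable_visitInd y).lintegral_prod_right'

omit [NeZero M] in
theorem occ_le (τ : ℝ) (y : Hier M) (w : ℝ≥0 → Hier M) : occ τ y w ≤ ENNReal.ofReal τ := by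
  refine (lintegral_mono fun r => visitInd_le_one y (w, r)).trans (le_of_eq ?_)
  simp

omit [NeZero M] in
theorem occ_ne_top (τ : ℝ) (y : Hier M) (w : ℝ≥0 → Hier M) : occ τ y w ≠ ∞ :=
  ne_top_of_le_ne_top ENNReal.ofReal_ne_top (occ_le τ y w)

/-- The properties of the law of a `c`-random walk on the space of all paths which determine the
moments of its occupation times. -/
structure IsCRandomWalkLaw (M : ℕ) [NeZero M] (c : ℝ) (μ : Measure (ℝ≥0 → Hier M)) : Prop where
  isProbabilityMeasure : IsProbabilityMeasure μ
  visits : ∀ r : ℝ, ∀ᵐ w ∂μ, ∀ y : Hier M, (w, r) ∈ visits y ↔ w r.toNNReal = y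
  measure_sub : ∀ (s t : ℝ≥0) (y : Hier M),
    μ {w | w t - w s = y} = transENN M c |(t : ℝ) - s| y
  measure_eq_eq : ∀ {r s t : ℝ≥0}, r ≤ s → s ≤ t → μ {w | w r = w s ∧ w s = w t} =
    transENN M c |(s : ℝ) - r| 0 * transENN M c |(t : ℝ) - s| 0

omit [NeZero M] in
theorem measurable_eval_sub_eval (s t : ℝ≥0) :
    Measurable fun w : ℝ≥0 → Hier M => w t - w s := by
  have h : Measurable fun p : Hier M × Hier M => p.1 - p.2 := Measurable.of_discrete
  exact h.comp (by fun_prop : Measurable fun w : ℝ≥0 → Hier M => (w t, w s))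

theorem IsCRandomWalk.isCRandomWalkLaw (hc : 1 < c) (hcM : c < M) {Ω : Type*}
    [MeasurableSpace Ω] {P : Measure Ω} {Z : ℝ≥0 → Ω → Hier M} (hZ : IsCRandomWalk M c Z P) :
    IsCRandomWalkLaw M c (P.map fun ω t => Z t ω) where
  isProbabilityMeasure :=
    have := hZ.isProbabilityMeasure
    Measure.isProbabilityMeasure_map hZ.measurable_path.aemeasurable
  -- Right continuity is not an event of the product σ-algebra. Its consequence at one fixed time
  -- is, and so it passes to the image measure.
  visits r := by
    refine ae_all_iff.2 fun y => ?_
    rw [ae_map_iff hZ.measurable_path.aemeasurable]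
    · filter_upwards [hZ.rightCont] with ω hω
      exact mem_visits_iff hω r y
    · exact (measurable_prodMk_right (measurableSet_visits y)).iff
        (measurableSet_eq_fun (measurable_pi_apply r.toNNReal) measurable_const)
  measure_sub s t y := by
    rw [Measure.map_apply hZ.measurable_path
      (measurableSet_eq_fun (measurable_eval_sub_eval s t) measurable_const), ← hZ.measure_sub_eq hc hcM]
    rfl
  measure_eq_eq {r s t} hrs hst := by
    rw [Measure.map_apply hZ.measurable_path, ← hZ.measure_eq_eq hc hcM hrs hst]
    · rfl
    · exact (measurableSet_eq_fun (measurable_pi_apply r) (measurable_pi_apply s)).inter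
        (measurableSet_eq_fun (measurable_pi_apply s) (measurable_pi_apply t))

end Paths

/-! ### Moments of occupation times, summed over the starting point -/

section Moments

variable {M : ℕ} [NeZero M] {c : ℝ} {μ : Measure (ℝ≥0 → Hier M)}

theorem lintegral_comp_abs (f : ℝ → ℝ≥0∞) :
    ∫⁻ x, f |x| = 2 * ∫⁻ x in Set.Ioi 0, f x := by
  have h1 : ∫⁻ x in Set.Ioi 0, f |x| = ∫⁻ x in Set.Ioi 0, f x :=
    setLIntegral_congr_fun measurableSet_Ioi fun x hx => by rw [abs_of_pos hx]
  have h2 : ∫⁻ x in Set.Iio 0, f |x| = ∫⁻ x in Set.Ioi 0, f x := by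
    rw [← lintegral_indicator measurableSet_Iio, ← lintegral_neg_eq_self,
      ← lintegral_indicator measurableSet_Ioi]
    refine lintegral_congr fun x => ?_
    by_cases hx : 0 < x
    · simp [hx, abs_of_pos hx]
    · simp [hx]
  rw [← lintegral_add_compl _ (measurableSet_Ioi (a := (0 : ℝ))), h1, Set.compl_Ioi,
    setLIntegral_congr Iio_ae_eq_Iic.symm, h2, two_mul]

theorem lintegral_comp_abs_sub (f : ℝ → ℝ≥0∞) (r : ℝ) :
    ∫⁻ s, f |s - r| = 2 * ∫⁻ x in Set.Ioi 0, f x := by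
  rw [← lintegral_comp_abs f]
  exact lintegral_sub_right_eq_self (fun s => f |s|) r

theorem lintegral_eq_mul_lintegral_comp_mul {f : ℝ → ℝ≥0∞} (hf : Measurable f) {a : ℝ}
    (ha : 0 < a) : ∫⁻ x, f x = ENNReal.ofReal a * ∫⁻ x, f (a * x) := by
  conv_lhs => rw [← Real.smul_map_volume_mul_left ha.ne']
  rw [lintegral_smul_measure, lintegral_map hf (measurable_const_mul a), abs_of_pos ha, smul_eq_mul]

theorem setLIntegral_Ioc_eq_mul {f : ℝ → ℝ≥0∞} (hf : Measurable f) {a : ℝ}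
    (ha : 0 < a) (b : ℝ) : ∫⁻ x in Set.Ioc 0 (a * b), f x =
      ENNReal.ofReal a * ∫⁻ x in Set.Ioc 0 b, f (a * x) := by
  rw [← lintegral_indicator measurableSet_Ioc,
    lintegral_eq_mul_lintegral_comp_mul (hf.indicator measurableSet_Ioc) ha,
    ← lintegral_indicator measurableSet_Ioc]
  congr 1
  refine lintegral_congr fun x => ?_
  simp only [Set.indicator_apply, Set.mem_Ioc, mul_pos_iff_of_pos_left ha,
    mul_le_mul_iff_right₀ ha]

/-- Long time asymptotics of the double integral of an integrable function of the time lag. -/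
theorem tendsto_lintegral_lintegral_abs_sub {f : ℝ → ℝ≥0∞} (hf : Measurable f)
    (hfi : ∫⁻ x in Set.Ioi 0, f x ≠ ∞) (a b : ℝ≥0) :
    Tendsto (fun T : ℝ≥0 => (T : ℝ≥0∞)⁻¹ *
      ∫⁻ r in Set.Ioc (0 : ℝ) (T * a), ∫⁻ s in Set.Ioc (0 : ℝ) (T * b), f |s - r|) atTop
      (𝓝 (2 * (min a b : ℝ≥0) * ∫⁻ x in Set.Ioi 0, f x)) := by
  have hfabs : Measurable fun p : ℝ × ℝ => f |p.2 - p.1| := by fun_prop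
  -- Substitute `T r` for the outer variable and `v + T r` for the inner one: the prefactor cancels,
  -- and the lag `v` runs over the window from `-T r` to `T (b - r)`.
  have h1 : ∀ᶠ T : ℝ≥0 in atTop, (T : ℝ≥0∞)⁻¹ *
      ∫⁻ r in Set.Ioc (0 : ℝ) (T * a), ∫⁻ s in Set.Ioc (0 : ℝ) (T * b), f |s - r| =
      ∫⁻ r in Set.Ioc (0 : ℝ) a, ∫⁻ v, (Set.Ioc (-(T * r)) (T * (b - r))).indicator
        (fun v => f |v|) v := by
    filter_upwards [eventually_gt_atTop 0] with T hT
    rw [setLIntegral_Ioc_eq_mul (Measurable.lintegral_prod_right' hfabs) (NNReal.coe_pos.2 hT),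
      ENNReal.ofReal_coe_nnreal, ← mul_assoc,
      ENNReal.inv_mul_cancel (by simpa using hT.ne') ENNReal.coe_ne_top, one_mul]
    refine lintegral_congr fun r => ?_
    rw [← lintegral_indicator measurableSet_Ioc, ← lintegral_sub_right_eq_self
      (fun v => (Set.Ioc (-(T * r)) (T * (b - r))).indicator (fun v => f |v|) v) (T * r)]
    refine lintegral_congr fun v => ?_
    simp only [Set.indicator_apply, Set.mem_Ioc]
    refine if_congr (and_congr ?_ ?_) rfl rfl
    · constructor <;> intro h <;> linarith
    · rw [mul_sub]
      constructor <;> intro h <;> linarith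
  refine (tendsto_congr' h1).2 ?_
  have h2 : ∫⁻ r in Set.Ioc (0 : ℝ) a, (Set.Iio (b : ℝ)).indicator
      (fun _ => 2 * ∫⁻ x in Set.Ioi 0, f x) r = 2 * (min a b : ℝ≥0) * ∫⁻ x in Set.Ioi 0, f x := by
    rw [lintegral_indicator_const measurableSet_Iio, Measure.restrict_apply measurableSet_Iio]
    have h3 : (Set.Iio (b : ℝ) ∩ Set.Ioc 0 (a : ℝ) : Set ℝ) =ᵐ[volume]
        (Set.Ioc 0 (min a b : ℝ≥0) : Set ℝ) := by
      have : Set.Ioc (0 : ℝ) (min a b : ℝ≥0) = Set.Iic (b : ℝ) ∩ Set.Ioc 0 (a : ℝ) := by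
        ext x
        simp only [Set.mem_Ioc, NNReal.coe_min, le_min_iff, Set.mem_inter_iff, Set.mem_Iic]
        tauto
      rw [this]
      exact ae_eq_set_inter Iio_ae_eq_Iic (ae_eq_refl _)
    rw [measure_congr h3, Real.volume_Ioc, sub_zero, ENNReal.ofReal_coe_nnreal]
    ring
  rw [← h2]
  have hmeas : ∀ T : ℝ≥0, Measurable fun p : ℝ × ℝ =>
      (Set.Ioc (-(T * p.1)) (T * (b - p.1))).indicator (fun v => f |v|) p.2 := by
    intro T
    have : MeasurableSet {p : ℝ × ℝ | p.2 ∈ Set.Ioc (-((T : ℝ) * p.1)) (T * (b - p.1))} :=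
      (measurableSet_lt (f := fun p : ℝ × ℝ => -((T : ℝ) * p.1)) (g := fun p => p.2)
        (by fun_prop) (by fun_prop)).inter
        (measurableSet_le (f := fun p : ℝ × ℝ => p.2) (g := fun p => (T : ℝ) * (b - p.1))
          (by fun_prop) (by fun_prop))
    exact (by fun_prop : Measurable fun p : ℝ × ℝ => f |p.2|).indicator this
  refine tendsto_lintegral_filter_of_dominated_convergence
    (fun _ => 2 * ∫⁻ x in Set.Ioi 0, f x) (Eventually.of_forall fun T =>
      Measurable.lintegral_prod_right' (hmeas T)) ?_ ?_ ?_
  · refine Eventually.of_forall fun T => Eventually.of_forall fun r => ?_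
    rw [← lintegral_comp_abs f]
    exact lintegral_mono fun v => Set.indicator_le_self _ _ _
  · rw [lintegral_const]
    exact ENNReal.mul_ne_top (ENNReal.mul_ne_top ENNReal.ofNat_ne_top hfi)
      (by simp)
  -- For `0 < r < b` the window grows to the whole line, for `r > b` it eventually excludes each
  -- given `v`, and `r = b` is negligible. What remains is the length of `(0, a] ∩ (0, b)`.
  · have hne : ∀ᵐ r : ℝ ∂(volume.restrict (Set.Ioc (0 : ℝ) a)), r ≠ b :=
      Measure.ae_ne _ _
    filter_upwards [ae_restrict_mem measurableSet_Ioc, hne] with r hr hrb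
    have hlim : (Set.Iio (b : ℝ)).indicator (fun _ => 2 * ∫⁻ x in Set.Ioi 0, f x) r =
        ∫⁻ v, (Set.Iio (b : ℝ)).indicator (fun _ => f |v|) r := by
      rw [← lintegral_comp_abs f]
      by_cases h : r < b <;> simp [h]
    rw [hlim]
    have hT : Tendsto (fun T : ℝ≥0 => (T : ℝ)) atTop atTop := NNReal.tendsto_coe_atTop.2 tendsto_id
    refine tendsto_lintegral_filter_of_dominated_convergence (fun v => f |v|)
      (Eventually.of_forall fun T => (hmeas T).comp measurable_prodMk_left)
      (Eventually.of_forall fun T => Eventually.of_forall fun v => Set.indicator_le_self _ _ _)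
      ?_ ?_
    · rw [lintegral_comp_abs f]
      exact ENNReal.mul_ne_top ENNReal.ofNat_ne_top hfi
    · refine Eventually.of_forall fun v => tendsto_nhds_of_eventually_eq ?_
      have e1 : ∀ᶠ T : ℝ≥0 in atTop, -v < T * r :=
        (hT.atTop_mul_const hr.1).eventually_gt_atTop _
      rcases lt_or_gt_of_ne hrb with h | h
      · have e2 : ∀ᶠ T : ℝ≥0 in atTop, v ≤ T * (b - r) :=
          (hT.atTop_mul_const (sub_pos.2 h)).eventually_ge_atTop _
        filter_upwards [e1, e2] with T h3 h4
        rw [Set.indicator_of_mem (show r ∈ Set.Iio (b : ℝ) from h),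
          Set.indicator_of_mem (show v ∈ Set.Ioc _ _ from ⟨by linarith, h4⟩)]
      · have e2 : ∀ᶠ T : ℝ≥0 in atTop, -v < T * (r - b) :=
          (hT.atTop_mul_const (sub_pos.2 h)).eventually_gt_atTop _
        filter_upwards [e2] with T h3
        rw [Set.indicator_of_notMem (show r ∉ Set.Iio (b : ℝ) from not_lt.2 h.le),
          Set.indicator_of_notMem]
        rintro ⟨-, h4⟩
        have : (T : ℝ) * (b - r) = -(T * (r - b)) := by ring
        linarith

namespace IsCRandomWalkLaw

/-- For a given path `w` exactly one starting point, `y - w r`, puts the particle at `y` at time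
`r`. -/
theorem tsum_lintegral_visitInd (hμ : IsCRandomWalkLaw M c μ) (r : ℝ) (y : Hier M) :
    ∑' x, ∫⁻ w, visitInd (y - x) (w, r) ∂μ = 1 := by
  have := hμ.isProbabilityMeasure
  have hm : ∀ x, Measurable fun w => visitInd (y - x) (w, r) := fun x =>
    (measurable_visitInd (y - x)).comp measurable_prodMk_right
  rw [← lintegral_tsum fun x => (hm x).aemeasurable]
  have h3 : ∀ᵐ w ∂μ, ∑' x, visitInd (y - x) (w, r) = 1 := by
    filter_upwards [hμ.visits r] with w hw
    rw [tsum_eq_single (y - w r.toNNReal)]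
    · rw [visitInd_eq_ite hw, if_pos (by abel)]
    · intro x hx
      rw [visitInd_eq_ite hw, if_neg]
      intro h
      exact hx (by rw [h]; abel)
  rw [lintegral_congr_ae h3, lintegral_one, measure_univ]

theorem tsum_lintegral_occ (hμ : IsCRandomWalkLaw M c μ) (τ : ℝ) (y : Hier M) :
    ∑' x, ∫⁻ w, occ τ (y - x) w ∂μ = ENNReal.ofReal τ := by
  have := hμ.isProbabilityMeasure
  have h1 : ∀ x, ∫⁻ w, occ τ (y - x) w ∂μ =
      ∫⁻ r in Set.Ioc 0 τ, ∫⁻ w, visitInd (y - x) (w, r) ∂μ := fun x =>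
    lintegral_lintegral_swap (measurable_visitInd (y - x)).aemeasurable
  simp only [h1]
  rw [← lintegral_tsum fun x =>
    (Measurable.lintegral_prod_left' (measurable_visitInd (y - x))).aemeasurable]
  simp only [hμ.tsum_lintegral_visitInd]
  simp

/-- For fixed times and path only `x = y - w r` contributes to the sum, and what remains is the
event `w s - w r = y' - y`, whose probability depends only on the lag. -/
theorem tsum_lintegral_occ_mul_occ (hμ : IsCRandomWalkLaw M c μ) (τ τ' : ℝ) (y y' : Hier M) :
    ∑' x, ∫⁻ w, occ τ (y - x) w * occ τ' (y' - x) w ∂μ =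
      ∫⁻ r in Set.Ioc 0 τ, ∫⁻ s in Set.Ioc 0 τ', transENN M c |s - r| (y' - y) := by
  have := hμ.isProbabilityMeasure
  set F : Hier M → (ℝ≥0 → Hier M) → ℝ → ℝ → ℝ≥0∞ := fun x w r s =>
    visitInd (y - x) (w, r) * visitInd (y' - x) (w, s) with hF
  have hFm : ∀ x, Measurable fun q : (ℝ≥0 → Hier M) × ℝ × ℝ => F x q.1 q.2.1 q.2.2 := by
    intro x
    exact ((measurable_visitInd (y - x)).comp (by fun_prop)).mul
      ((measurable_visitInd (y' - x)).comp (by fun_prop))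
  set I : ℝ → Measure ℝ := fun τ => volume.restrict (Set.Ioc 0 τ) with hI
  have h1 : ∀ x, ∫⁻ w, occ τ (y - x) w * occ τ' (y' - x) w ∂μ =
      ∫⁻ q, ∫⁻ w, F x w q.1 q.2 ∂μ ∂((I τ).prod (I τ')) := by
    intro x
    have hv : ∀ (u : Hier M) w, Measurable fun r => visitInd u (w, r) := fun u w =>
      (measurable_visitInd u).comp measurable_prodMk_left
    have h2 : ∀ w, occ τ (y - x) w * occ τ' (y' - x) w =
        ∫⁻ q, F x w q.1 q.2 ∂((I τ).prod (I τ')) := fun w =>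
      (lintegral_prod_mul (hv (y - x) w).aemeasurable (hv (y' - x) w).aemeasurable).symm
    simp only [h2]
    exact lintegral_lintegral_swap (hFm x).aemeasurable
  simp only [h1]
  rw [← lintegral_tsum fun x => (Measurable.lintegral_prod_left' (hFm x)).aemeasurable]
  have h3 : ∀ r s : ℝ, 0 < r → 0 < s → ∑' x, ∫⁻ w, F x w r s ∂μ =
      transENN M c |s - r| (y' - y) := by
    intro r s hr0 hs0
    have hF' : ∀ x, Measurable fun w => F x w r s := fun x =>
      (hFm x).comp (measurable_prodMk_right (y := (r, s)))
    rw [← lintegral_tsum fun x => (hF' x).aemeasurable]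
    have h4 : ∀ᵐ w ∂μ, ∑' x, F x w r s =
        {w : ℝ≥0 → Hier M | w s.toNNReal - w r.toNNReal = y' - y}.indicator 1 w := by
      classical
      filter_upwards [hμ.visits r, hμ.visits s] with w hr hs
      rw [tsum_eq_single (y - w r.toNNReal), hF]
      · simp only [visitInd_eq_ite hr, visitInd_eq_ite hs, Set.indicator_apply,
          Set.mem_ofPred_eq, Pi.one_apply]
        rw [if_pos (by abel), one_mul]
        refine if_congr ?_ rfl rfl
        rw [sub_eq_iff_eq_add]
        constructor <;> intro h <;> rw [h] <;> abel
      · intro x hx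
        simp only [hF, visitInd_eq_ite hr]
        rw [if_neg, zero_mul]
        intro h
        exact hx (by rw [h]; abel)
    rw [lintegral_congr_ae h4, lintegral_indicator_one
      (measurableSet_eq_fun (measurable_eval_sub_eval _ _) measurable_const), hμ.measure_sub,
      Real.coe_toNNReal _ hs0.le, Real.coe_toNNReal _ hr0.le]
  have hm : Measurable fun q : ℝ × ℝ => transENN M c |q.2 - q.1| (y' - y) :=
    (measurable_transENN (y' - y)).comp (by fun_prop)
  rw [← lintegral_prod _ hm.aemeasurable]
  refine lintegral_congr_ae ?_
  have hpos : ∀ τ, ∀ᵐ r ∂(I τ), 0 < r := fun τ => by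
    filter_upwards [ae_restrict_mem measurableSet_Ioc] with r hr using hr.1
  have e1 : ∀ᵐ q ∂((I τ).prod (I τ')), 0 < q.1 :=
    Measure.quasiMeasurePreserving_fst.ae (hpos τ)
  have e2 : ∀ᵐ q ∂((I τ).prod (I τ')), 0 < q.2 :=
    Measure.quasiMeasurePreserving_snd.ae (hpos τ')
  filter_upwards [e1, e2] with q h1 h2 using h3 _ _ h1 h2

/-- Once the times are sorted, the probability is the product of two return probabilities, with lags
measured from the middle time. The sum over all three candidates for the middle time avoids
splitting the triple integral by order. -/
theorem measure_eq_eq_le (hμ : IsCRandomWalkLaw M c μ) (r s u : ℝ≥0) :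
    μ {w | w r = w s ∧ w s = w u} ≤
      transENN M c |(r : ℝ) - s| 0 * transENN M c |(u : ℝ) - s| 0 +
      transENN M c |(s : ℝ) - r| 0 * transENN M c |(u : ℝ) - r| 0 +
      transENN M c |(r : ℝ) - u| 0 * transENN M c |(s : ℝ) - u| 0 := by
  have key : ∀ {a b d : ℝ≥0}, a ≤ b → b ≤ d →
      μ {w | w a = w b ∧ w b = w d} =
        transENN M c |(a : ℝ) - b| 0 * transENN M c |(d : ℝ) - b| 0 := by
    intro a b d hab hbd
    rw [hμ.measure_eq_eq hab hbd, abs_sub_comm (b : ℝ)]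
  have perm : ∀ {a b d : ℝ≥0}, (∀ w : ℝ≥0 → Hier M, (w r = w s ∧ w s = w u) ↔
      (w a = w b ∧ w b = w d)) → μ {w | w r = w s ∧ w s = w u} = μ {w | w a = w b ∧ w b = w d} :=
    fun h => congrArg μ (Set.ext h)
  rcases le_total r s with h1 | h1 <;> rcases le_total s u with h2 | h2 <;>
    rcases le_total r u with h3 | h3
  · rw [key h1 h2, add_assoc]; exact le_self_add
  · rw [key h1 h2, add_assoc]; exact le_self_add
  · rw [perm (a := r) (b := u) (d := s) fun w => by grind, key h3 h2]
    exact le_add_self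
  · rw [perm (a := u) (b := r) (d := s) fun w => by grind, key h3 h1, mul_comm]
    exact le_add_self.trans le_self_add
  · rw [perm (a := s) (b := r) (d := u) fun w => by grind, key h1 h3]
    exact le_add_self.trans le_self_add
  · rw [perm (a := s) (b := u) (d := r) fun w => by grind, key h2 h3, mul_comm]
    exact le_add_self
  · rw [perm (a := u) (b := s) (d := r) fun w => by grind, key h2 h1, mul_comm, add_assoc]
    exact le_self_add
  · rw [perm (a := u) (b := s) (d := r) fun w => by grind, key h2 h1, mul_comm, add_assoc]
    exact le_self_add

omit [NeZero M] in
theorem lintegral_mul_lintegral_le (τ : ℝ) :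
    ∫⁻ b in Set.Ioc 0 τ, (∫⁻ a in Set.Ioc 0 τ, transENN M c |a - b| 0) *
      (∫⁻ d in Set.Ioc 0 τ, transENN M c |d - b| 0) ≤
      ENNReal.ofReal τ * (4 * greenENN M c 0 ^ 2) := by
  have h : ∀ b : ℝ, ∫⁻ a in Set.Ioc 0 τ, transENN M c |a - b| 0 ≤ 2 * greenENN M c 0 := by
    intro b
    rw [← lintegral_transENN, ← lintegral_comp_abs_sub _ b]
    exact setLIntegral_le_lintegral _ _
  refine (lintegral_mono fun b => mul_le_mul' (h b) (h b)).trans (le_of_eq ?_)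
  rw [lintegral_const]
  simp only [Measure.restrict_apply_univ, Real.volume_Ioc, sub_zero]
  ring

/-- The bound is linear in `τ`: with the middle time fixed, each of the two lags integrates to at
most `2 G(0)`. The factor `12 = 3 · 2²` counts the choices of the middle time. -/
theorem tsum_lintegral_occ_pow_three_le (hμ : IsCRandomWalkLaw M c μ) (τ : ℝ) (y : Hier M) :
    ∑' x, ∫⁻ w, occ τ (y - x) w ^ 3 ∂μ ≤ ENNReal.ofReal τ * (12 * greenENN M c 0 ^ 2) := by
  have := hμ.isProbabilityMeasure
  set F : Hier M → (ℝ≥0 → Hier M) → ℝ → ℝ → ℝ → ℝ≥0∞ := fun x w r s u =>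
    visitInd (y - x) (w, r) * visitInd (y - x) (w, s) * visitInd (y - x) (w, u) with hF
  have hFm : ∀ x, Measurable fun q : (ℝ≥0 → Hier M) × ℝ × ℝ × ℝ =>
      F x q.1 q.2.1 q.2.2.1 q.2.2.2 := by
    intro x
    exact (((measurable_visitInd (y - x)).comp (by fun_prop)).mul
      ((measurable_visitInd (y - x)).comp (by fun_prop))).mul
      ((measurable_visitInd (y - x)).comp (by fun_prop))
  set I := volume.restrict (Set.Ioc 0 τ) with hI
  have h1 : ∀ x, ∫⁻ w, occ τ (y - x) w ^ 3 ∂μ =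
      ∫⁻ q, ∫⁻ w, F x w q.1 q.2.1 q.2.2 ∂μ ∂(I.prod (I.prod I)) := by
    intro x
    have hv : ∀ w, Measurable fun r => visitInd (y - x) (w, r) := fun w =>
      (measurable_visitInd (y - x)).comp measurable_prodMk_left
    have h2 : ∀ w, occ τ (y - x) w ^ 3 = ∫⁻ q, F x w q.1 q.2.1 q.2.2 ∂(I.prod (I.prod I)) := by
      intro w
      have e : ∀ q : ℝ × ℝ × ℝ, F x w q.1 q.2.1 q.2.2 = visitInd (y - x) (w, q.1) *
          (visitInd (y - x) (w, q.2.1) * visitInd (y - x) (w, q.2.2)) := fun q => mul_assoc _ _ _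
      simp only [e]
      rw [lintegral_prod_mul (hv w).aemeasurable
        (g := fun q : ℝ × ℝ => visitInd (y - x) (w, q.1) * visitInd (y - x) (w, q.2))
        (((hv w).comp measurable_fst).mul ((hv w).comp measurable_snd)).aemeasurable,
        lintegral_prod_mul (hv w).aemeasurable (hv w).aemeasurable, occ]
      ring
    simp only [h2]
    exact lintegral_lintegral_swap (hFm x).aemeasurable
  simp only [h1]
  rw [← lintegral_tsum fun x => (Measurable.lintegral_prod_left' (hFm x)).aemeasurable]
  have h3 : ∀ r s u : ℝ, 0 < r → 0 < s → 0 < u → ∑' x, ∫⁻ w, F x w r s u ∂μ ≤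
      transENN M c |r - s| 0 * transENN M c |u - s| 0 +
      transENN M c |s - r| 0 * transENN M c |u - r| 0 +
      transENN M c |r - u| 0 * transENN M c |s - u| 0 := by
    intro r s u hr0 hs0 hu0
    have hF' : ∀ x, Measurable fun w => F x w r s u := fun x =>
      (hFm x).comp (measurable_prodMk_right (y := (r, s, u)))
    rw [← lintegral_tsum fun x => (hF' x).aemeasurable]
    have h4 : ∀ᵐ w ∂μ, ∑' x, F x w r s u = {w : ℝ≥0 → Hier M | w r.toNNReal = w s.toNNReal ∧
        w s.toNNReal = w u.toNNReal}.indicator 1 w := by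
      classical
      filter_upwards [hμ.visits r, hμ.visits s, hμ.visits u] with w hr hs hu
      rw [tsum_eq_single (y - w s.toNNReal), hF]
      · simp only [visitInd_eq_ite hr, visitInd_eq_ite hs, visitInd_eq_ite hu, Set.indicator_apply,
          Set.mem_ofPred_eq, Pi.one_apply, sub_sub_cancel]
        grind
      · intro x hx
        simp only [hF, visitInd_eq_ite hs]
        rw [if_neg, mul_zero, zero_mul]
        intro h
        exact hx (by rw [h]; abel)
    rw [lintegral_congr_ae h4, lintegral_indicator_one]
    · refine (hμ.measure_eq_eq_le _ _ _).trans (le_of_eq ?_)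
      rw [Real.coe_toNNReal _ hr0.le, Real.coe_toNNReal _ hs0.le, Real.coe_toNNReal _ hu0.le]
    · have hev : ∀ t : ℝ≥0, Measurable fun w : ℝ≥0 → Hier M => w t := measurable_pi_apply
      exact (measurableSet_eq_fun (hev _) (hev _)).inter (measurableSet_eq_fun (hev _) (hev _))
  set p : ℝ → ℝ≥0∞ := fun t => transENN M c |t| 0 with hp
  have hpm : Measurable p := (measurable_transENN 0).comp measurable_norm
  have h5 : ∀ᵐ q ∂(I.prod (I.prod I)), ∑' x, ∫⁻ w, F x w q.1 q.2.1 q.2.2 ∂μ ≤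
      p (q.1 - q.2.1) * p (q.2.2 - q.2.1) + p (q.2.1 - q.1) * p (q.2.2 - q.1) +
        p (q.1 - q.2.2) * p (q.2.1 - q.2.2) := by
    have hpos : ∀ᵐ r ∂I, 0 < r := by
      filter_upwards [ae_restrict_mem measurableSet_Ioc] with r hr using hr.1
    have e1 : ∀ᵐ q ∂(I.prod (I.prod I)), 0 < q.1 :=
      Measure.quasiMeasurePreserving_fst.ae hpos
    have e2 : ∀ᵐ q ∂(I.prod (I.prod I)), 0 < q.2.1 :=
      Measure.quasiMeasurePreserving_snd.ae (Measure.quasiMeasurePreserving_fst.ae hpos)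
    have e3 : ∀ᵐ q ∂(I.prod (I.prod I)), 0 < q.2.2 :=
      Measure.quasiMeasurePreserving_snd.ae (Measure.quasiMeasurePreserving_snd.ae hpos)
    filter_upwards [e1, e2, e3] with q h1 h2 h3'
    exact h3 _ _ _ h1 h2 h3'
  refine (lintegral_mono_ae h5).trans ?_
  have hb : ∫⁻ b, (∫⁻ a, p (a - b) ∂I) * (∫⁻ d, p (d - b) ∂I) ∂I ≤
      ENNReal.ofReal τ * (4 * greenENN M c 0 ^ 2) := lintegral_mul_lintegral_le τ
  have hprod : ∀ b : ℝ, ∫⁻ q, p (q.1 - b) * p (q.2 - b) ∂(I.prod I) =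
      (∫⁻ a, p (a - b) ∂I) * (∫⁻ d, p (d - b) ∂I) := fun b =>
    lintegral_prod_mul (f := fun a => p (a - b)) (g := fun d => p (d - b))
      (by fun_prop) (by fun_prop)
  have t1 : ∫⁻ q : ℝ × ℝ × ℝ, p (q.1 - q.2.1) * p (q.2.2 - q.2.1) ∂(I.prod (I.prod I)) ≤
      ENNReal.ofReal τ * (4 * greenENN M c 0 ^ 2) := by
    refine le_trans (le_of_eq ?_) hb
    rw [lintegral_prod_symm _ (by fun_prop), lintegral_prod _ (by fun_prop)]
    refine lintegral_congr fun b => ?_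
    have : ∀ d, ∫⁻ a, p (a - b) * p (d - b) ∂I = (∫⁻ a, p (a - b) ∂I) * p (d - b) := fun d =>
      lintegral_mul_const _ (by fun_prop)
    simp only [this]
    rw [lintegral_const_mul _ (by fun_prop)]
  have t2 : ∫⁻ q : ℝ × ℝ × ℝ, p (q.2.1 - q.1) * p (q.2.2 - q.1) ∂(I.prod (I.prod I)) ≤
      ENNReal.ofReal τ * (4 * greenENN M c 0 ^ 2) := by
    refine le_trans (le_of_eq ?_) hb
    rw [lintegral_prod _ (by fun_prop)]
    exact lintegral_congr fun b => hprod b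
  have t3 : ∫⁻ q : ℝ × ℝ × ℝ, p (q.1 - q.2.2) * p (q.2.1 - q.2.2) ∂(I.prod (I.prod I)) ≤
      ENNReal.ofReal τ * (4 * greenENN M c 0 ^ 2) := by
    refine le_trans (le_of_eq ?_) hb
    rw [lintegral_prod_symm _ (by fun_prop), lintegral_prod_symm _ (by fun_prop)]
    refine lintegral_congr fun b => ?_
    have : ∀ d, ∫⁻ a, p (a - b) * p (d - b) ∂I = (∫⁻ a, p (a - b) ∂I) * p (d - b) := fun d =>
      lintegral_mul_const _ (by fun_prop)
    simp only [this]
    rw [lintegral_const_mul _ (by fun_prop)]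
  rw [lintegral_add_left (by fun_prop), lintegral_add_left (by fun_prop)]
  refine (add_le_add (add_le_add t1 t2) t3).trans (le_of_eq ?_)
  ring

end IsCRandomWalkLaw

end Moments

/-! ### Poisson systems of marked particles and their central limit theorem -/

section Poisson

theorem hasSum_poisson_mul_natCast (lam : ℝ≥0) :
    HasSum (fun n : ℕ => Real.exp (-lam) * (lam : ℝ) ^ n / n.factorial * n) lam := by
  rw [← hasSum_nat_add_iff' 1]
  have h := (hasSum_one_poissonMeasure lam).mul_left (lam : ℝ)
  simp only [Finset.range_one, Finset.sum_singleton, Nat.cast_zero, mul_zero, sub_zero]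
  rw [mul_one] at h
  refine h.congr_fun fun n => ?_
  rw [Nat.factorial_succ, pow_succ]
  push_cast
  have : ((n : ℝ) + 1) ≠ 0 := by positivity
  field_simp

theorem integral_natCast_poissonMeasure (lam : ℝ≥0) :
    ∫ n, (n : ℝ) ∂poissonMeasure lam = lam := by
  rw [integral_poissonMeasure]
  exact (hasSum_poisson_mul_natCast lam).tsum_eq

theorem lintegral_natCast_poissonMeasure (lam : ℝ≥0) :
    ∫⁻ n, (n : ℝ≥0∞) ∂poissonMeasure lam = lam := by
  have hint : Integrable (fun n : ℕ => (n : ℝ)) (poissonMeasure lam) := by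
    rw [integrable_poissonMeasure_iff]
    simpa using (hasSum_poisson_mul_natCast lam).summable
  have h := ofReal_integral_eq_lintegral_ofReal hint (ae_of_all _ fun n => Nat.cast_nonneg n)
  rw [integral_natCast_poissonMeasure, ENNReal.ofReal_coe_nnreal] at h
  simpa using h.symm

theorem integral_pow_poissonMeasure (lam : ℝ≥0) (γ : ℂ) :
    ∫ n, γ ^ n ∂poissonMeasure lam = Complex.exp (lam * (γ - 1)) := by
  rw [integral_poissonMeasure]
  have h := (NormedSpace.expSeries_div_hasSum_exp ((lam : ℂ) * γ)).mul_left (Complex.exp (-lam))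
  rw [← Complex.exp_eq_exp_ℂ, ← Complex.exp_add] at h
  have h2 : -(lam : ℂ) + lam * γ = lam * (γ - 1) := by ring
  rw [h2] at h
  rw [← h.tsum_eq]
  refine tsum_congr fun n => ?_
  rw [Complex.real_smul, mul_pow]
  push_cast
  ring

/-- A Poisson system of marked particles: there are `θ x` particles at `x`, where the `θ x` are
independent with the Poisson law of mean `lam`, and the `j`-th of them has the mark `ζ x j`, where
the marks are independent with law `μ`, and independent of the numbers of particles. -/
structure IsPoissonSystem {X W Ω : Type*} [MeasurableSpace W] [MeasurableSpace Ω] (lam : ℝ≥0)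
    (μ : Measure W) (θ : X → Ω → ℕ) (ζ : X → ℕ → Ω → W) (P : Measure Ω) : Prop where
  measurable_num : ∀ x, Measurable (θ x)
  map_num : ∀ x, P.map (θ x) = poissonMeasure lam
  indep_num : iIndepFun θ P
  measurable_mark : ∀ x j, Measurable (ζ x j)
  map_mark : ∀ x j, P.map (ζ x j) = μ
  indep_mark : iIndepFun (fun (p : X × ℕ) ω => ζ p.1 p.2 ω) P
  indep : IndepFun (fun ω x => θ x ω) (fun ω (p : X × ℕ) => ζ p.1 p.2 ω) P

theorem measurable_prod_range_eval {W : Type*} [MeasurableSpace W] {E : Type*} [CommMonoid E]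
    [MeasurableSpace E] [MeasurableMul₂ E] {f : ℕ → W → E} (hf : ∀ j, Measurable (f j)) :
    Measurable fun p : ℕ × W => ∏ j ∈ Finset.range p.1, f j p.2 :=
  measurable_from_prod_countable_right fun n =>
    Finset.measurable_fun_prod (Finset.range n) fun j _ => hf j

theorem measurable_sum_range_eval {W : Type*} [MeasurableSpace W] {E : Type*} [AddCommMonoid E]
    [MeasurableSpace E] [MeasurableAdd₂ E] {f : ℕ → W → E} (hf : ∀ j, Measurable (f j)) :
    Measurable fun p : ℕ × W => ∑ j ∈ Finset.range p.1, f j p.2 :=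
  measurable_from_prod_countable_right fun n =>
    Finset.measurable_fun_sum (Finset.range n) fun j _ => hf j

namespace IsPoissonSystem

variable {X W Ω : Type*} [MeasurableSpace W] [MeasurableSpace Ω] {lam : ℝ≥0}
    {μ : Measure W} {θ : X → Ω → ℕ} {ζ : X → ℕ → Ω → W} {P : Measure Ω}

/-- The sum of `g x` over the particles at `x`. -/
def siteSum {E : Type*} [AddCommMonoid E] (θ : X → Ω → ℕ) (ζ : X → ℕ → Ω → W) (g : X → W → E)
    (x : X) (ω : Ω) : E :=
  ∑ j ∈ Finset.range (θ x ω), g x (ζ x j ω)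

theorem measurable_siteSum (h : IsPoissonSystem lam μ θ ζ P) {E : Type*} [AddCommMonoid E]
    [MeasurableSpace E] [MeasurableAdd₂ E] {g : X → W → E} (hg : ∀ x, Measurable (g x)) (x : X) :
    Measurable (siteSum θ ζ g x) :=
  (measurable_sum_range_eval fun j => (hg x).comp (h.measurable_mark x j)).comp
    ((h.measurable_num x).prodMk measurable_id)

/-- The `j`-th mark counts on the event `j < θ x`, which is independent of it, and the probabilities
of these events sum to the mean of `θ x`. -/
theorem lintegral_siteSum (h : IsPoissonSystem lam μ θ ζ P) {g : X → W → ℝ≥0∞}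
    (hg : ∀ x, Measurable (g x)) (x : X) :
    ∫⁻ ω, siteSum θ ζ g x ω ∂P = lam * ∫⁻ w, g x w ∂μ := by
  have h1 : ∀ ω, siteSum θ ζ g x ω = ∑' j, {n : ℕ | j < n}.indicator 1 (θ x ω) * g x (ζ x j ω) := by
    intro ω
    rw [tsum_eq_sum (s := Finset.range (θ x ω)), siteSum]
    · refine Finset.sum_congr rfl fun j hj => ?_
      rw [Set.indicator_of_mem (show θ x ω ∈ {n : ℕ | j < n} from Finset.mem_range.1 hj),
        Pi.one_apply, one_mul]
    · intro j hj
      rw [Set.indicator_of_notMem, zero_mul]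
      exact fun hlt => hj (Finset.mem_range.2 hlt)
  have hind : ∀ j : ℕ, Measurable ({n : ℕ | j < n}.indicator (1 : ℕ → ℝ≥0∞)) := fun j =>
    Measurable.of_discrete
  have h2 : ∀ j, ∫⁻ ω, {n : ℕ | j < n}.indicator 1 (θ x ω) * g x (ζ x j ω) ∂P =
      (∫⁻ n, {n : ℕ | j < n}.indicator 1 n ∂poissonMeasure lam) * ∫⁻ w, g x w ∂μ := by
    intro j
    have hi : IndepFun (fun ω => {n : ℕ | j < n}.indicator (1 : ℕ → ℝ≥0∞) (θ x ω))
        (fun ω => g x (ζ x j ω)) P :=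
      h.indep.comp (φ := fun n : X → ℕ => {n : ℕ | j < n}.indicator (1 : ℕ → ℝ≥0∞) (n x))
        (ψ := fun w : X × ℕ → W => g x (w (x, j)))
        ((hind j).comp (measurable_pi_apply x)) ((hg x).comp (measurable_pi_apply (x, j)))
    have := lintegral_mul_eq_lintegral_mul_lintegral_of_indepFun
      ((hind j).comp (h.measurable_num x)) ((hg x).comp (h.measurable_mark x j)) hi
    refine this.trans ?_
    rw [← h.map_num x, ← h.map_mark x j, lintegral_map (hind j) (h.measurable_num x),
      lintegral_map (hg x) (h.measurable_mark x j)]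
    rfl
  have hm : ∀ j : ℕ, Measurable fun ω =>
      {n : ℕ | j < n}.indicator (1 : ℕ → ℝ≥0∞) (θ x ω) * g x (ζ x j ω) := fun j =>
    ((hind j).comp (h.measurable_num x)).mul ((hg x).comp (h.measurable_mark x j))
  simp only [h1]
  rw [lintegral_tsum fun j => (hm j).aemeasurable]
  simp only [h2]
  rw [ENNReal.tsum_mul_right, ← lintegral_tsum fun j => (hind j).aemeasurable,
    ← lintegral_natCast_poissonMeasure]
  congr 1
  refine lintegral_congr fun n => ?_
  rw [tsum_eq_sum (s := Finset.range n)]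
  · rw [Finset.sum_congr rfl (g := fun _ => 1), Finset.sum_const, Finset.card_range, nsmul_eq_mul,
      mul_one]
    intro j hj
    rw [Set.indicator_of_mem (show n ∈ {n : ℕ | j < n} from Finset.mem_range.1 hj), Pi.one_apply]
  · intro j hj
    rw [Set.indicator_of_notMem]
    exact fun hlt => hj (Finset.mem_range.2 hlt)

/-- **Campbell's formula**. -/
theorem lintegral_tsum_siteSum [Countable X] (h : IsPoissonSystem lam μ θ ζ P)
    {g : X → W → ℝ≥0∞} (hg : ∀ x, Measurable (g x)) :
    ∫⁻ ω, ∑' x, siteSum θ ζ g x ω ∂P = lam * ∑' x, ∫⁻ w, g x w ∂μ := by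
  rw [lintegral_tsum fun x => (h.measurable_siteSum hg x).aemeasurable, ← ENNReal.tsum_mul_left]
  exact tsum_congr fun x => h.lintegral_siteSum hg x

theorem integral_prod_prod_mark (h : IsPoissonSystem lam μ θ ζ P) {g : X → W → ℂ}
    (hg : ∀ x, Measurable (g x)) (A : Finset X) (n : X → ℕ) :
    ∫ ω, ∏ x ∈ A, ∏ j ∈ Finset.range (n x), g x (ζ x j ω) ∂P =
      ∏ x ∈ A, (∫ w, g x w ∂μ) ^ n x := by
  classical
  set S : Finset (X × ℕ) :=
    (A.sigma fun x => Finset.range (n x)).map (Equiv.sigmaEquivProd X ℕ).toEmbedding with hS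
  have hmem : ∀ p : X × ℕ, p ∈ S ↔ p.1 ∈ A ∧ p.2 ∈ Finset.range (n p.1) := by
    rintro ⟨x, j⟩
    simp [hS]
  have h1 : ∀ ω, ∏ x ∈ A, ∏ j ∈ Finset.range (n x), g x (ζ x j ω) =
      ∏ p : S, g p.1.1 (ζ p.1.1 p.1.2 ω) := by
    intro ω
    rw [Finset.prod_coe_sort S fun p => g p.1 (ζ p.1 p.2 ω), Finset.prod_finset_product S A
      (fun x => Finset.range (n x)) hmem]
  have h2 : ∏ x ∈ A, (∫ w, g x w ∂μ) ^ n x = ∏ p : S, ∫ w, g p.1.1 w ∂μ := by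
    rw [Finset.prod_coe_sort S fun p => ∫ w, g p.1 w ∂μ, Finset.prod_finset_product S A
      (fun x => Finset.range (n x)) hmem]
    exact Finset.prod_congr rfl fun x _ => by
      simp only [Finset.prod_const, Finset.card_range]
  simp only [h1]
  rw [h2]
  have hi := (h.indep_mark.precomp (g := ((↑) : S → X × ℕ)) Subtype.val_injective)
  rw [hi.integral_fun_prod_comp (f := fun p : S => g p.1.1)
    (fun p => (h.measurable_mark _ _).aemeasurable) fun p => (hg _).aestronglyMeasurable]
  refine Finset.prod_congr rfl fun p _ => ?_
  rw [← h.map_mark p.1.1 p.1.2, integral_map (h.measurable_mark _ _).aemeasurable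
    (hg _).aestronglyMeasurable]

/-- With the numbers of particles frozen, by Fubini and independence, the marks contribute `∏ (∫ g
x)^(θ x)`; the generating function of the Poisson law does the rest. -/
theorem integral_prod_prod [Countable X] [IsProbabilityMeasure P]
    (h : IsPoissonSystem lam μ θ ζ P)
    {g : X → W → ℂ} (hg : ∀ x, Measurable (g x)) (hg1 : ∀ x w, ‖g x w‖ ≤ 1) (A : Finset X) :
    ∫ ω, ∏ x ∈ A, ∏ j ∈ Finset.range (θ x ω), g x (ζ x j ω) ∂P =
      ∏ x ∈ A, Complex.exp (lam * (∫ w, g x w ∂μ - 1)) := by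
  classical
  set H : (X → ℕ) × (X × ℕ → W) → ℂ := fun q =>
    ∏ x ∈ A, ∏ j ∈ Finset.range (q.1 x), g x (q.2 (x, j)) with hH
  have hHm : Measurable H := by
    refine Finset.measurable_fun_prod A fun x _ => ?_
    exact (measurable_prod_range_eval (f := fun j (w : X × ℕ → W) => g x (w (x, j)))
      fun j => (hg x).comp (measurable_pi_apply (x, j))).comp
      (by fun_prop : Measurable fun q : (X → ℕ) × (X × ℕ → W) => (q.1 x, q.2))
  have hθ : Measurable fun ω x => θ x ω := measurable_pi_lambda _ h.measurable_num
  have hζ : Measurable fun ω (p : X × ℕ) => ζ p.1 p.2 ω :=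
    measurable_pi_lambda _ fun p => h.measurable_mark p.1 p.2
  have := Measure.isProbabilityMeasure_map (μ := P) hθ.aemeasurable
  have := Measure.isProbabilityMeasure_map (μ := P) hζ.aemeasurable
  have hH1 : ∀ q, ‖H q‖ ≤ 1 := by
    intro q
    rw [hH, norm_prod]
    refine Finset.prod_le_one (fun _ _ => norm_nonneg _) fun x _ => ?_
    rw [norm_prod]
    exact Finset.prod_le_one (fun _ _ => norm_nonneg _) fun j _ => hg1 _ _
  have e1 : ∫ ω, ∏ x ∈ A, ∏ j ∈ Finset.range (θ x ω), g x (ζ x j ω) ∂P =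
      ∫ q, H q ∂(P.map fun ω => ((fun x => θ x ω), fun p : X × ℕ => ζ p.1 p.2 ω)) := by
    rw [integral_map (hθ.prodMk hζ).aemeasurable hHm.aestronglyMeasurable]
  rw [e1, h.indep.map_prod_eq_prod_map_map hθ.aemeasurable hζ.aemeasurable,
    integral_prod _ (Integrable.of_bound hHm.aestronglyMeasurable 1 (ae_of_all _ hH1))]
  have e2 : ∀ n : X → ℕ, ∫ w, H (n, w) ∂(P.map fun ω (p : X × ℕ) => ζ p.1 p.2 ω) =
      ∏ x ∈ A, (∫ w, g x w ∂μ) ^ n x := by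
    intro n
    have hHn : Measurable fun w => H (n, w) := hHm.comp measurable_prodMk_left
    rw [integral_map hζ.aemeasurable hHn.aestronglyMeasurable]
    exact h.integral_prod_prod_mark hg A n
  simp only [e2]
  have hpow : Measurable fun n : X → ℕ => ∏ x ∈ A, (∫ w, g x w ∂μ) ^ n x :=
    Finset.measurable_fun_prod A fun x _ =>
      (Measurable.of_discrete (f := fun m : ℕ => (∫ w, g x w ∂μ) ^ m)).comp (measurable_pi_apply x)
  rw [integral_map hθ.aemeasurable hpow.aestronglyMeasurable]
  have e3 : ∀ ω, ∏ x ∈ A, (∫ w, g x w ∂μ) ^ θ x ω =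
      ∏ x : A, (∫ w, g x.1 w ∂μ) ^ θ x.1 ω := fun ω =>
    (Finset.prod_coe_sort A fun x => (∫ w, g x w ∂μ) ^ θ x ω).symm
  simp only [e3]
  rw [(h.indep_num.precomp (g := ((↑) : A → X)) Subtype.val_injective).integral_fun_prod_comp
    (f := fun (x : A) (m : ℕ) => (∫ w, g x.1 w ∂μ) ^ m)
    (fun x => (h.measurable_num _).aemeasurable) (fun x => Measurable.of_discrete.aestronglyMeasurable),
    ← Finset.prod_coe_sort A]
  refine Finset.prod_congr rfl fun x _ => ?_
  rw [← integral_pow_poissonMeasure, ← h.map_num x.1,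
    integral_map (h.measurable_num _).aemeasurable Measurable.of_discrete.aestronglyMeasurable]

theorem ae_summable_siteSum [Countable X] [IsProbabilityMeasure P]
    (h : IsPoissonSystem lam μ θ ζ P) {f : X → W → ℝ} (hf : ∀ x, Measurable (f x))
    (hfs : ∑' x, ∫⁻ w, ‖f x w‖ₑ ∂μ ≠ ∞) :
    ∀ᵐ ω ∂P, Summable fun x => siteSum θ ζ f x ω := by
  have h1 : ∫⁻ ω, ∑' x, siteSum θ ζ (fun x w => ‖f x w‖ₑ) x ω ∂P ≠ ∞ := by
    rw [h.lintegral_tsum_siteSum fun x => (hf x).enorm]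
    exact ENNReal.mul_ne_top ENNReal.coe_ne_top hfs
  filter_upwards [ae_lt_top' (AEMeasurable.tsum fun x =>
    (h.measurable_siteSum (fun x => (hf x).enorm) x).aemeasurable) h1] with ω hω
  refine Summable.of_enorm (ne_top_of_le_ne_top hω.ne (ENNReal.tsum_le_tsum fun x => ?_))
  exact enorm_sum_le _ _

/-- The characteristic function of a sum over the particles of a Poisson system. -/
theorem integral_exp_tsum_siteSum [Countable X] [IsProbabilityMeasure P] [IsProbabilityMeasure μ]
    (h : IsPoissonSystem lam μ θ ζ P) {f : X → W → ℝ} (hf : ∀ x, Measurable (f x))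
    (hfs : ∑' x, ∫⁻ w, ‖f x w‖ₑ ∂μ ≠ ∞)
    (hsum : Summable fun x => ∫ w, Complex.exp (f x w * Complex.I) ∂μ - 1) :
    ∫ ω, Complex.exp ((∑' x, siteSum θ ζ f x ω : ℝ) * Complex.I) ∂P =
      Complex.exp (lam * ∑' x, (∫ w, Complex.exp (f x w * Complex.I) ∂μ - 1)) := by
  have e1 : ∀ A : Finset X, ∫ ω, Complex.exp ((∑ x ∈ A, siteSum θ ζ f x ω : ℝ) * Complex.I) ∂P =
      Complex.exp (lam * ∑ x ∈ A, (∫ w, Complex.exp (f x w * Complex.I) ∂μ - 1)) := by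
    intro A
    rw [Finset.mul_sum, Complex.exp_sum, ← h.integral_prod_prod (by fun_prop)
      (fun x w => (Complex.norm_exp_ofReal_mul_I _).le)]
    refine integral_congr_ae (ae_of_all _ fun ω => ?_)
    simp only [siteSum]
    push_cast
    rw [Finset.sum_mul, Complex.exp_sum]
    refine Finset.prod_congr rfl fun x _ => ?_
    rw [Finset.sum_mul, Complex.exp_sum]
  -- The formula is exact on finite sets of sites. Dominated convergence applies along `atTop` on
  -- `Finset X`, which is countably generated because `X` is countable.
  have l1 : Tendsto (fun A : Finset X =>
      ∫ ω, Complex.exp ((∑ x ∈ A, siteSum θ ζ f x ω : ℝ) * Complex.I) ∂P) atTop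
      (𝓝 (∫ ω, Complex.exp ((∑' x, siteSum θ ζ f x ω : ℝ) * Complex.I) ∂P)) := by
    refine tendsto_integral_filter_of_dominated_convergence (fun _ => 1)
      (Eventually.of_forall fun A => ?_)
      (Eventually.of_forall fun A => ae_of_all _ fun ω => (Complex.norm_exp_ofReal_mul_I _).le)
      (integrable_const _) ?_
    · have : Measurable fun ω => ∑ x ∈ A, siteSum θ ζ f x ω :=
        Finset.measurable_fun_sum A fun x _ => h.measurable_siteSum hf x
      exact (by fun_prop : Measurable fun ω =>
        Complex.exp ((∑ x ∈ A, siteSum θ ζ f x ω : ℝ) * Complex.I)).aestronglyMeasurable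
    · filter_upwards [h.ae_summable_siteSum hf hfs] with ω hω
      have hcont : Continuous fun s : ℝ => Complex.exp (s * Complex.I) := by fun_prop
      exact (hcont.tendsto _).comp hω.hasSum
  have l2 : Tendsto (fun A : Finset X =>
      Complex.exp (lam * ∑ x ∈ A, (∫ w, Complex.exp (f x w * Complex.I) ∂μ - 1))) atTop
      (𝓝 (Complex.exp (lam * ∑' x, (∫ w, Complex.exp (f x w * Complex.I) ∂μ - 1)))) :=
    (Complex.continuous_exp.tendsto _).comp (hsum.hasSum.const_mul _)
  simp only [e1] at l1
  exact tendsto_nhds_unique l1 l2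

/-- The remainder of the second order expansion of `exp (i x)`. -/
theorem norm_exp_mul_I_sub_le (x : ℝ) :
    ‖Complex.exp (x * Complex.I) - 1 - x * Complex.I + (x : ℂ) ^ 2 / 2‖ ≤ 4 * |x| ^ 3 := by
  have hn : ‖(x * Complex.I : ℂ)‖ = |x| := by simp
  -- Taylor's bound serves for small `x`. For `|x| ≥ 1` each of the four terms is bounded
  -- separately, with total at most `(1 + 1 + 1 + 1/2) |x|³`.
  rcases le_total |x| 1 with hx | hx
  · have h := Complex.exp_bound (x := x * Complex.I) (by rwa [hn]) (n := 3) (by norm_num)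
    rw [hn] at h
    simp only [Finset.sum_range_succ, Finset.sum_range_zero, pow_zero, pow_one, mul_pow,
      Complex.I_sq] at h
    norm_num [Nat.factorial] at h
    have e : Complex.exp (x * Complex.I) - 1 - x * Complex.I + (x : ℂ) ^ 2 / 2 =
        Complex.exp (x * Complex.I) - (1 + x * Complex.I + -(x : ℂ) ^ 2 / 2) := by ring
    rw [e]
    refine h.trans ?_
    have : 0 ≤ |x| ^ 3 := by positivity
    linarith
  · have h1 : ‖Complex.exp (x * Complex.I) - 1 - x * Complex.I + (x : ℂ) ^ 2 / 2‖ ≤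
        1 + 1 + |x| + |x| ^ 2 / 2 := by
      refine (norm_add_le _ _).trans (add_le_add ((norm_sub_le _ _).trans (add_le_add
        ((norm_sub_le _ _).trans (add_le_add ?_ ?_)) ?_)) ?_)
      · exact (Complex.norm_exp_ofReal_mul_I x).le
      · simp
      · exact hn.le
      · simp
    have h2 : |x| ≤ |x| ^ 3 := le_self_pow₀ hx (by norm_num)
    have h3 : |x| ^ 2 ≤ |x| ^ 3 := pow_le_pow_right₀ hx (by norm_num)
    linarith

/-- **Central limit theorem** for sums over the particles of a Poisson system, in terms of
characteristic functions. -/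
theorem tendsto_integral_exp_siteSum [Countable X] [IsProbabilityMeasure P]
    [IsProbabilityMeasure μ] (h : IsPoissonSystem lam μ θ ζ P) {ι : Type*} {l : Filter ι}
    {f : ι → X → W → ℝ} (hf : ∀ i x, Measurable (f i x)) {B : ι → ℝ}
    (hB : ∀ i x w, |f i x w| ≤ B i) (hfs : ∀ i, ∑' x, ∫⁻ w, ‖f i x w‖ₑ ∂μ ≠ ∞) {v : ℝ}
    (h2 : Tendsto (fun i => ∑' x, ∫ w, f i x w ^ 2 ∂μ) l (𝓝 v))
    (h3 : Tendsto (fun i => ∑' x, ∫⁻ w, ‖f i x w‖ₑ ^ 3 ∂μ) l (𝓝 0)) :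
    Tendsto (fun i => ∫ ω, Complex.exp
      ((∑' x, siteSum θ ζ (f i) x ω - lam * ∑' x, ∫ w, f i x w ∂μ : ℝ) * Complex.I) ∂P) l
      (𝓝 (Complex.exp (-(lam * v / 2 : ℝ)))) := by
  -- The bounds `B i` serve only integrability and summability for fixed `i`; they need not be
  -- uniform in `i`.
  have hint : ∀ i x, Integrable (f i x) μ := fun i x =>
    Integrable.of_bound (hf i x).aestronglyMeasurable (B i) (ae_of_all _ (hB i x))
  have hint2 : ∀ i x, Integrable (fun w => f i x w ^ 2) μ := fun i x => by
    refine Integrable.of_bound ((hf i x).pow_const 2).aestronglyMeasurable (B i ^ 2)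
      (ae_of_all _ fun w => ?_)
    rw [norm_pow]
    exact pow_le_pow_left₀ (norm_nonneg _) (hB i x w) 2
  have hint3 : ∀ i x, Integrable (fun w => |f i x w| ^ 3) μ := fun i x => by
    refine Integrable.of_bound (((hf i x).abs).pow_const 3).aestronglyMeasurable (B i ^ 3)
      (ae_of_all _ fun w => ?_)
    rw [norm_pow, Real.norm_eq_abs, abs_abs]
    exact pow_le_pow_left₀ (abs_nonneg _) (hB i x w) 3
  have hintE : ∀ i x, Integrable (fun w => Complex.exp (f i x w * Complex.I)) μ := fun i x => by
    have := hf i x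
    exact Integrable.of_bound (by fun_prop : Measurable fun w =>
      Complex.exp (f i x w * Complex.I)).aestronglyMeasurable 1
      (ae_of_all _ fun w => (Complex.norm_exp_ofReal_mul_I _).le)
  have habs : ∀ i, Summable fun x => ∫ w, |f i x w| ∂μ := fun i => by
    have e : ∀ x, ∫ w, |f i x w| ∂μ = (∫⁻ w, ‖f i x w‖ₑ ∂μ).toReal := fun x => by
      rw [← integral_norm_eq_lintegral_enorm (hf i x).aestronglyMeasurable]
      rfl
    simp only [e]
    exact ENNReal.summable_toReal (hfs i)
  have hs1 : ∀ i, Summable fun x => ∫ w, f i x w ∂μ := fun i =>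
    Summable.of_norm_bounded (habs i) fun x => norm_integral_le_integral_norm _
  have hs2 : ∀ i, Summable fun x => ∫ w, f i x w ^ 2 ∂μ := fun i => by
    refine Summable.of_nonneg_of_le (fun x => integral_nonneg fun w => sq_nonneg _)
      (fun x => ?_) ((habs i).mul_left (B i))
    rw [← integral_const_mul]
    refine integral_mono (hint2 i x) ((hint i x).abs.const_mul _) fun w => ?_
    simp only
    rw [← sq_abs, sq]
    exact mul_le_mul_of_nonneg_right (hB i x w) (abs_nonneg _)
  have hs3 : ∀ i, Summable fun x => ∫ w, |f i x w| ^ 3 ∂μ := fun i => by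
    refine Summable.of_nonneg_of_le (fun x => integral_nonneg fun w => by positivity)
      (fun x => ?_) ((habs i).mul_left (B i ^ 2))
    rw [← integral_const_mul]
    refine integral_mono (hint3 i x) ((hint i x).abs.const_mul _) fun w => ?_
    simp only
    rw [pow_succ]
    exact mul_le_mul_of_nonneg_right (pow_le_pow_left₀ (abs_nonneg _) (hB i x w) 2) (abs_nonneg _)
  set R : ι → X → ℂ := fun i x => ∫ w, (Complex.exp (f i x w * Complex.I) - 1 -
    f i x w * Complex.I + (f i x w : ℂ) ^ 2 / 2) ∂μ with hR
  have hRle : ∀ i x, ‖R i x‖ ≤ 4 * ∫ w, |f i x w| ^ 3 ∂μ := fun i x => by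
    rw [← integral_const_mul]
    exact norm_integral_le_of_norm_le ((hint3 i x).const_mul _)
      (ae_of_all _ fun w => norm_exp_mul_I_sub_le _)
  have hRs : ∀ i, Summable (R i) := fun i =>
    Summable.of_norm_bounded ((hs3 i).mul_left 4) (hRle i)
  have hRlim : Tendsto (fun i => ∑' x, R i x) l (𝓝 0) := by
    have e : ∀ i, ∑' x, ∫ w, |f i x w| ^ 3 ∂μ = (∑' x, ∫⁻ w, ‖f i x w‖ₑ ^ 3 ∂μ).toReal := by
      intro i
      have e1 : ∀ x, ∫ w, |f i x w| ^ 3 ∂μ = (∫⁻ w, ‖f i x w‖ₑ ^ 3 ∂μ).toReal := fun x => by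
        rw [integral_eq_lintegral_of_nonneg_ae (ae_of_all _ fun w => by positivity)
          (hint3 i x).aestronglyMeasurable]
        congr 1
        refine lintegral_congr fun w => ?_
        rw [ENNReal.ofReal_pow (abs_nonneg _), Real.enorm_eq_ofReal_abs]
      rw [ENNReal.tsum_toReal_eq fun x => ?_]
      · exact tsum_congr e1
      · have := (hint3 i x).lintegral_lt_top
        refine ne_of_lt (lt_of_eq_of_lt (lintegral_congr fun w => ?_) this)
        rw [ENNReal.ofReal_pow (abs_nonneg _), Real.enorm_eq_ofReal_abs]
    have h4 : Tendsto (fun i => 4 * ∑' x, ∫ w, |f i x w| ^ 3 ∂μ) l (𝓝 0) := by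
      simp only [e]
      have := (ENNReal.tendsto_toReal ENNReal.zero_ne_top).comp h3
      simpa using this.const_mul 4
    refine squeeze_zero_norm (fun i => ?_) h4
    rw [← tsum_mul_left]
    exact tsum_of_norm_bounded ((hs3 i).mul_left 4).hasSum (hRle i)
  have hRe : ∀ i x, ∫ w, Complex.exp (f i x w * Complex.I) ∂μ - 1 =
      R i x + (∫ w, f i x w ∂μ : ℝ) * Complex.I - (∫ w, f i x w ^ 2 ∂μ : ℝ) / 2 := by
    intro i x
    have c1 : Integrable (fun w => (f i x w : ℂ) * Complex.I) μ := (hint i x).ofReal.mul_const _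
    have c2 : Integrable (fun w => (f i x w : ℂ) ^ 2 / 2) μ := by
      have := (hint2 i x).ofReal (𝕜 := ℂ)
      simpa using this.div_const 2
    rw [hR]
    simp only
    have d1 : Integrable (fun w => Complex.exp (f i x w * Complex.I) - 1) μ :=
      (hintE i x).sub (integrable_const _)
    have d2 : Integrable (fun w => Complex.exp (f i x w * Complex.I) - 1 -
        f i x w * Complex.I) μ := d1.sub c1
    rw [integral_add d2 c2, integral_sub d1 c1, integral_sub (hintE i x) (integrable_const _), integral_mul_const, integral_div,
      ← integral_complex_ofReal, ← integral_complex_ofReal]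
    simp
    ring
  have hsum : ∀ i, HasSum (fun x => ∫ w, Complex.exp (f i x w * Complex.I) ∂μ - 1)
      (∑' x, R i x + (∑' x, ∫ w, f i x w ∂μ : ℝ) * Complex.I -
        (∑' x, ∫ w, f i x w ^ 2 ∂μ : ℝ) / 2) := by
    intro i
    simp only [hRe]
    exact ((hRs i).hasSum.add ((Complex.hasSum_ofReal.2 (hs1 i).hasSum).mul_right _)).sub
      ((Complex.hasSum_ofReal.2 (hs2 i).hasSum).div_const _)
  -- The centring removes exactly the linear term of the exponent. What is left is half the sum of
  -- second moments, with a minus sign, and the remainder, which the third moments control.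
  have key : ∀ i, ∫ ω, Complex.exp
      ((∑' x, siteSum θ ζ (f i) x ω - lam * ∑' x, ∫ w, f i x w ∂μ : ℝ) * Complex.I) ∂P =
      Complex.exp (lam * (∑' x, R i x - (∑' x, ∫ w, f i x w ^ 2 ∂μ : ℝ) / 2)) := by
    intro i
    have e : ∀ ω, Complex.exp
        ((∑' x, siteSum θ ζ (f i) x ω - lam * ∑' x, ∫ w, f i x w ∂μ : ℝ) * Complex.I) =
        Complex.exp ((∑' x, siteSum θ ζ (f i) x ω : ℝ) * Complex.I) *
        Complex.exp (-(lam * (∑' x, ∫ w, f i x w ∂μ : ℝ) * Complex.I)) := by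
      intro ω
      rw [← Complex.exp_add]
      congr 1
      push_cast
      ring
    simp only [e]
    rw [integral_mul_const, h.integral_exp_tsum_siteSum (hf i) (hfs i) (hsum i).summable,
      (hsum i).tsum_eq, ← Complex.exp_add]
    congr 1
    ring
  simp only [key]
  refine (Complex.continuous_exp.tendsto _).comp ?_
  have h2c : Tendsto (fun i => ((∑' x, ∫ w, f i x w ^ 2 ∂μ : ℝ) : ℂ)) l (𝓝 (v : ℂ)) :=
    (Complex.continuous_ofReal.tendsto _).comp h2
  have := (hRlim.sub (h2c.div_const 2)).const_mul (lam : ℂ)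
  convert this using 2
  push_cast
  ring

end IsPoissonSystem

end Poisson

/-! ### The system of walks as a Poisson system of paths -/

section System

open IsPoissonSystem

variable {M : ℕ} [NeZero M] {c : ℝ} {Ω : Type*} [MeasurableSpace Ω] {P : Measure Ω}
  [IsProbabilityMeasure P] {lam : ℝ≥0} {θ : Hier M → Ω → ℕ}
  {z : Hier M → ℕ → ℝ≥0 → Ω → Hier M}

/-- The paths of the particles, as random elements of the path space. -/
def paths (z : Hier M → ℕ → ℝ≥0 → Ω → Hier M) (x : Hier M) (j : ℕ) (ω : Ω) (t : ℝ≥0) : Hier M :=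
  z x j t ω

/-- The number of particles at `y` at time `r`, counted through `visitInd`. -/
noncomputable def count (θ : Hier M → Ω → ℕ) (z : Hier M → ℕ → ℝ≥0 → Ω → Hier M) (r : ℝ)
    (y : Hier M) (ω : Ω) : ℝ≥0∞ :=
  ∑' x, siteSum θ (paths z) (fun x w => visitInd (y - x) (w, r)) x ω

namespace IsWalkSystem

omit [IsProbabilityMeasure P] in
theorem isPoissonSystem (hc : 1 < c) (hcM : c < M)
    (h : IsWalkSystem M c (poissonMeasure lam) θ z P) :
    IsPoissonSystem lam (P.map (paths z 0 0)) θ (paths z) P where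
  measurable_num := h.measurable_initial
  map_num := h.law_initial
  indep_num := h.indep_initial
  measurable_mark x j := (h.walk x j).measurable_path
  map_mark x j := (h.walk x j).map_path_eq hc hcM (h.walk 0 0)
  indep_mark := h.indep_walks
  indep := h.indep_initial_walks

omit [IsProbabilityMeasure P] in
theorem isCRandomWalkLaw (hc : 1 < c) (hcM : c < M)
    (h : IsWalkSystem M c (poissonMeasure lam) θ z P) :
    IsCRandomWalkLaw M c (P.map (paths z 0 0)) :=
  (h.walk 0 0).isCRandomWalkLaw hc hcM

omit [IsProbabilityMeasure P] in
theorem lintegral_count (hc : 1 < c) (hcM : c < M)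
    (h : IsWalkSystem M c (poissonMeasure lam) θ z P) (r : ℝ) (y : Hier M) :
    ∫⁻ ω, count θ z r y ω ∂P = lam := by
  have hm : ∀ x : Hier M, Measurable fun w => visitInd (y - x) (w, r) := fun x =>
    (measurable_visitInd (y - x)).comp measurable_prodMk_right
  refine ((h.isPoissonSystem hc hcM).lintegral_tsum_siteSum hm).trans ?_
  rw [(h.isCRandomWalkLaw hc hcM).tsum_lintegral_visitInd, mul_one]

omit [IsProbabilityMeasure P] in
theorem measurable_count (hc : 1 < c) (hcM : c < M)
    (h : IsWalkSystem M c (poissonMeasure lam) θ z P) (r : ℝ) (y : Hier M) :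
    Measurable (count θ z r y) := by
  have hm : ∀ x : Hier M, Measurable fun w => visitInd (y - x) (w, r) := fun x =>
    (measurable_visitInd (y - x)).comp measurable_prodMk_right
  exact Measurable.tsum fun x => (h.isPoissonSystem hc hcM).measurable_siteSum hm x

omit [MeasurableSpace Ω] in
omit [NeZero M] in
theorem measurable_count_time (y : Hier M) (ω : Ω) : Measurable fun r => count θ z r y ω := by
  refine Measurable.tsum fun x => Finset.measurable_fun_sum _ fun j _ => ?_
  exact (measurable_visitInd (y - x)).comp measurable_prodMk_left

omit [MeasurableSpace Ω] in
omit [NeZero M] in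
theorem lintegral_count_time (τ : ℝ) (y : Hier M) (ω : Ω) :
    ∫⁻ r in Set.Ioc 0 τ, count θ z r y ω =
      ∑' x, siteSum θ (paths z) (fun x w => occ τ (y - x) w) x ω := by
  have hm : ∀ x j, Measurable fun r => visitInd (y - x) (paths z x j ω, r) := fun x j =>
    (measurable_visitInd (y - x)).comp measurable_prodMk_left
  unfold count siteSum
  rw [lintegral_tsum fun x => (Finset.measurable_fun_sum _ fun j _ => hm x j).aemeasurable]
  refine tsum_congr fun x => ?_
  rw [lintegral_finsetSum _ fun j _ => hm x j]
  rfl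

-- There are countably many labels, so almost surely all paths are right continuous at once, and
-- counting through `visitInd` is then correct at all times and points simultaneously.
omit [IsProbabilityMeasure P] in
omit [NeZero M] in
theorem ae_count_eq (h : IsWalkSystem M c (poissonMeasure lam) θ z P) :
    ∀ᵐ ω ∂P, ∀ (r : ℝ) (y : Hier M),
      count θ z r y ω = (particlesAt θ z r.toNNReal y ω).encard := by
  have hr : ∀ᵐ ω ∂P, ∀ p : Hier M × ℕ, ∀ t, ∀ᶠ s in 𝓝[≥] t, z p.1 p.2 s ω = z p.1 p.2 t ω :=
    ae_all_iff.2 fun p => (h.walk p.1 p.2).rightCont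
  filter_upwards [hr] with ω hω r y
  classical
  rw [← ENNReal.tsum_set_one, tsum_subtype (particlesAt θ z r.toNNReal y ω) fun _ => (1 : ℝ≥0∞),
    ENNReal.tsum_prod', count]
  refine tsum_congr fun x => ?_
  rw [tsum_eq_sum (s := Finset.range (θ x ω)), siteSum]
  · refine Finset.sum_congr rfl fun j hj => ?_
    rw [visitInd_eq_ite (mem_visits_iff (w := paths z x j ω) (hω (x, j)) r), Set.indicator_apply]
    refine if_congr ?_ rfl rfl
    change z x j r.toNNReal ω = y - x ↔ j < θ x ω ∧ x + z x j r.toNNReal ω = y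
    rw [eq_sub_iff_add_eq', and_iff_right (Finset.mem_range.1 hj)]
  · intro j hj
    rw [Set.indicator_of_notMem]
    exact fun hp => hj (Finset.mem_range.2 hp.1)

-- No finiteness is needed: on an infinite set of particles both `ncard` and `toReal` of `∞` give
-- the default value `0`.
omit [IsProbabilityMeasure P] in
omit [NeZero M] in
theorem ae_empirical_eq (h : IsWalkSystem M c (poissonMeasure lam) θ z P) :
    ∀ᵐ ω ∂P, ∀ (r : ℝ) (y : Hier M),
      empirical θ z r.toNNReal y ω = (count θ z r y ω).toReal := by
  filter_upwards [h.ae_count_eq] with ω hω r y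
  rw [hω, empirical, Set.ncard_def]
  rcases Set.finite_or_infinite (particlesAt θ z r.toNNReal y ω) with hf | hf
  · rw [hf.encard_eq_coe_toFinset_card]
    simp
  · rw [hf.encard_eq]
    simp

omit [IsProbabilityMeasure P] in
theorem ae_count_lt_top (hc : 1 < c) (hcM : c < M)
    (h : IsWalkSystem M c (poissonMeasure lam) θ z P) (r : ℝ) (y : Hier M) :
    ∀ᵐ ω ∂P, count θ z r y ω < ∞ :=
  ae_lt_top (h.measurable_count hc hcM r y) (by
    rw [h.lintegral_count hc hcM]
    exact ENNReal.coe_ne_top)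

omit [IsProbabilityMeasure P] in
theorem ae_finite_particlesAt (hc : 1 < c) (hcM : c < M)
    (h : IsWalkSystem M c (poissonMeasure lam) θ z P) (t : ℝ≥0) (y : Hier M) :
    ∀ᵐ ω ∂P, (particlesAt θ z t y ω).Finite := by
  filter_upwards [h.ae_count_eq, h.ae_count_lt_top hc hcM t y] with ω h1 h2
  rw [h1, Real.toNNReal_coe] at h2
  by_contra hinf
  rw [Set.Infinite.encard_eq hinf] at h2
  simp at h2

omit [IsProbabilityMeasure P] in
theorem integrable_empirical (hc : 1 < c) (hcM : c < M)
    (h : IsWalkSystem M c (poissonMeasure lam) θ z P) (t : ℝ≥0) (y : Hier M) :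
    Integrable (empirical θ z t y) P := by
  have h1 : Integrable (fun ω => (count θ z t y ω).toReal) P :=
    integrable_toReal_of_lintegral_ne_top (h.measurable_count hc hcM t y).aemeasurable (by
      rw [h.lintegral_count hc hcM]
      exact ENNReal.coe_ne_top)
  refine h1.congr ?_
  filter_upwards [h.ae_empirical_eq] with ω hω
  rw [← hω, Real.toNNReal_coe]

omit [IsProbabilityMeasure P] in
theorem integral_empirical (hc : 1 < c) (hcM : c < M)
    (h : IsWalkSystem M c (poissonMeasure lam) θ z P) (t : ℝ≥0) (y : Hier M) :
    ∫ ω, empirical θ z t y ω ∂P = lam := by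
  have h1 : ∀ᵐ ω ∂P, empirical θ z t y ω = (count θ z t y ω).toReal := by
    filter_upwards [h.ae_empirical_eq] with ω hω
    rw [← hω, Real.toNNReal_coe]
  rw [integral_congr_ae h1, integral_toReal (h.measurable_count hc hcM t y).aemeasurable
    (h.ae_count_lt_top hc hcM t y), h.lintegral_count hc hcM, ENNReal.coe_toReal]

omit [IsProbabilityMeasure P] in
theorem ae_tsum_siteSum_occ_ne_top (hc : 1 < c) (hcM : c < M)
    (h : IsWalkSystem M c (poissonMeasure lam) θ z P) (τ : ℝ) (y : Hier M) :
    ∀ᵐ ω ∂P, ∑' x, siteSum θ (paths z) (fun x w => occ τ (y - x) w) x ω ≠ ∞ := by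
  have hs := h.isPoissonSystem hc hcM
  have hm : ∀ x : Hier M, Measurable fun w => occ τ (y - x) w := fun x => measurable_occ τ (y - x)
  have h1 := hs.lintegral_tsum_siteSum hm
  rw [(h.isCRandomWalkLaw hc hcM).tsum_lintegral_occ] at h1
  filter_upwards [ae_lt_top (Measurable.tsum fun x => hs.measurable_siteSum hm x)
    (h1.trans_ne (ENNReal.mul_ne_top ENNReal.coe_ne_top ENNReal.ofReal_ne_top))] with ω hω
  exact hω.ne

-- Tonelli: the time integral of the number of particles at `y` is the sum of the times that the
-- individual particles spend there, and this sum is almost surely finite by Campbell's formula.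
omit [IsProbabilityMeasure P] in
theorem ae_integrableOn_empirical (hc : 1 < c) (hcM : c < M)
    (h : IsWalkSystem M c (poissonMeasure lam) θ z P) (τ : ℝ) (y : Hier M) :
    ∀ᵐ ω ∂P, IntegrableOn (fun r => empirical θ z r.toNNReal y ω) (Set.Ioc 0 τ) ∧
      ∫ r in Set.Ioc 0 τ, empirical θ z r.toNNReal y ω =
        ∑' x, siteSum θ (paths z) (fun x w => (occ τ (y - x) w).toReal) x ω := by
  filter_upwards [h.ae_empirical_eq, h.ae_tsum_siteSum_occ_ne_top hc hcM τ y] with ω h1 h2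
  simp only [h1]
  have h3 := (lintegral_count_time (θ := θ) (z := z) τ y ω)
  refine ⟨integrable_toReal_of_lintegral_ne_top (measurable_count_time y ω).aemeasurable
    (h3.trans_ne h2), ?_⟩
  rw [integral_toReal (measurable_count_time y ω).aemeasurable
    (ae_lt_top (measurable_count_time y ω) (h3.trans_ne h2)), h3, ENNReal.tsum_toReal_eq fun x =>
      ne_top_of_le_ne_top h2 (ENNReal.le_tsum x)]
  refine tsum_congr fun x => ?_
  exact ENNReal.toReal_sum fun j _ => occ_ne_top _ _ _

omit [IsProbabilityMeasure P] in
theorem ae_intervalIntegrable_empirical (hc : 1 < c) (hcM : c < M)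
    (h : IsWalkSystem M c (poissonMeasure lam) θ z P) (t : ℝ≥0) (y : Hier M) :
    ∀ᵐ ω ∂P, IntervalIntegrable (fun r => empirical θ z r.toNNReal y ω) volume 0 t := by
  filter_upwards [h.ae_integrableOn_empirical hc hcM t y] with ω hω
  exact (intervalIntegrable_iff_integrableOn_Ioc_of_le t.coe_nonneg).2 hω.1

omit [IsProbabilityMeasure P] in
/-- The occupation time fluctuations in terms of the occupation times of the single particles. -/
theorem ae_occupationFluctuation_eq (hc : 1 < c) (hcM : c < M)
    (h : IsWalkSystem M c (poissonMeasure lam) θ z P) (F : ℝ≥0 → ℝ) (T t : ℝ≥0) :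
    ∀ᵐ ω ∂P, occupationFluctuation P θ z F T t ω = BbDual.ofFun fun y => 1 / F T *
      (∑' x, siteSum θ (paths z) (fun x w => (occ (T * t) (y - x) w).toReal) x ω -
        lam * (T * t)) := by
  filter_upwards [ae_all_iff.2 fun y => h.ae_integrableOn_empirical hc hcM (T * t) y] with ω hω
  unfold occupationFluctuation
  congr 1
  funext y
  congr 1
  simp only [h.integral_empirical hc hcM]
  rw [intervalIntegral.integral_of_le (NNReal.coe_nonneg _), NNReal.coe_mul,
    integral_sub (hω y).1 (integrable_const _), (hω y).2]
  simp [mul_comm, mul_nonneg T.coe_nonneg t.coe_nonneg]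

end IsWalkSystem

end System

/-! ### Asymptotics of the scaled moments -/

section OccupationSum

variable {M : ℕ} [NeZero M] {c : ℝ} {ι : Type*} [Fintype ι]

/-- A linear combination of the occupation times of the points `y i` up to the times `T * t i` by
a walk started at `x`, scaled by `√T`. -/
noncomputable def occSum (t : ι → ℝ≥0) (y : ι → Hier M) (v : ι → ℝ) (T : ℝ≥0) (x : Hier M)
    (w : ℝ≥0 → Hier M) : ℝ :=
  ∑ i, v i * (1 / √(T : ℝ)) * (occ (T * t i) (y i - x) w).toReal

/-- The scaled second moments of occupation times. -/
noncomputable def occCov (M : ℕ) (c : ℝ) (T s t : ℝ≥0) (y : Hier M) : ℝ≥0∞ :=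
  (T : ℝ≥0∞)⁻¹ * ∫⁻ r in Set.Ioc (0 : ℝ) (T * s), ∫⁻ u in Set.Ioc (0 : ℝ) (T * t),
    transENN M c |u - r| y

variable (t : ι → ℝ≥0) (y : ι → Hier M) (v : ι → ℝ)

omit [NeZero M] in
theorem measurable_occSum (T : ℝ≥0) (x : Hier M) : Measurable (occSum t y v T x) := by
  refine Finset.measurable_fun_sum _ fun i _ => ?_
  exact (measurable_occ _ _).ennreal_toReal.const_mul _

omit [NeZero M] in
theorem toReal_occ_le {τ : ℝ} (hτ : 0 ≤ τ) (y : Hier M) (w : ℝ≥0 → Hier M) :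
    (occ τ y w).toReal ≤ τ :=
  ENNReal.toReal_le_of_le_ofReal hτ (occ_le τ y w)

omit [NeZero M] in
theorem abs_occSum_le (T : ℝ≥0) (x : Hier M) (w : ℝ≥0 → Hier M) :
    |occSum t y v T x w| ≤ ∑ i, |v i * (1 / √(T : ℝ))| * (T * t i) := by
  refine (Finset.abs_sum_le_sum_abs _ _).trans (Finset.sum_le_sum fun i _ => ?_)
  rw [abs_mul, abs_of_nonneg (ENNReal.toReal_nonneg (a := occ _ _ _))]
  gcongr
  exact toReal_occ_le (by positivity) _ _

omit [NeZero M] in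
theorem enorm_toReal_occ (τ : ℝ) (y : Hier M) (w : ℝ≥0 → Hier M) :
    ‖(occ τ y w).toReal‖ₑ = occ τ y w := by
  rw [Real.enorm_eq_ofReal ENNReal.toReal_nonneg, ENNReal.ofReal_toReal (occ_ne_top _ _ _)]

variable {μ : Measure (ℝ≥0 → Hier M)}

theorem tsum_lintegral_enorm_occSum_ne_top (hμ : IsCRandomWalkLaw M c μ) (T : ℝ≥0) :
    ∑' x, ∫⁻ w, ‖occSum t y v T x w‖ₑ ∂μ ≠ ∞ := by
  have h1 : ∑' x, ∫⁻ w, ‖occSum t y v T x w‖ₑ ∂μ ≤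
      ∑' x, ∫⁻ w, ∑ i, ‖v i * (1 / √(T : ℝ))‖ₑ * occ (T * t i) (y i - x) w ∂μ := by
    gcongr with x w
    refine (enorm_sum_le _ _).trans (le_of_eq (Finset.sum_congr rfl fun i _ => ?_))
    rw [enorm_mul, enorm_toReal_occ]
  refine ne_top_of_le_ne_top ?_ h1
  have h2 : ∀ x, ∫⁻ w, ∑ i, ‖v i * (1 / √(T : ℝ))‖ₑ * occ (T * t i) (y i - x) w ∂μ =
      ∑ i, ‖v i * (1 / √(T : ℝ))‖ₑ * ∫⁻ w, occ (T * t i) (y i - x) w ∂μ := by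
    intro x
    rw [lintegral_finsetSum _ fun i _ => (measurable_occ _ _).const_mul _]
    exact Finset.sum_congr rfl fun i _ => lintegral_const_mul _ (measurable_occ _ _)
  simp only [h2]
  rw [Summable.tsum_finsetSum fun _ _ => ENNReal.summable]
  refine ENNReal.sum_ne_top.2 fun i _ => ?_
  rw [ENNReal.tsum_mul_left, hμ.tsum_lintegral_occ]
  exact ENNReal.mul_ne_top enorm_ne_top ENNReal.ofReal_ne_top

theorem tsum_lintegral_occ_mul_occ_ne_top (hμ : IsCRandomWalkLaw M c μ) (τ τ' : ℝ)
    (y y' : Hier M) : ∑' x, ∫⁻ w, occ τ (y - x) w * occ τ' (y' - x) w ∂μ ≠ ∞ := by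
  have h1 : ∑' x, ∫⁻ w, occ τ (y - x) w * occ τ' (y' - x) w ∂μ ≤
      ∑' x, ENNReal.ofReal τ * ∫⁻ w, occ τ' (y' - x) w ∂μ := by
    refine ENNReal.tsum_le_tsum fun x => ?_
    rw [← lintegral_const_mul _ (measurable_occ _ _)]
    gcongr with w
    exact occ_le _ _ _
  refine ne_top_of_le_ne_top ?_ h1
  rw [ENNReal.tsum_mul_left, hμ.tsum_lintegral_occ]
  exact ENNReal.mul_ne_top ENNReal.ofReal_ne_top ENNReal.ofReal_ne_top

theorem hasSum_integral_occ_mul_occ (hμ : IsCRandomWalkLaw M c μ) (τ τ' : ℝ) (y y' : Hier M) :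
    HasSum (fun x => ∫ w, (occ τ (y - x) w).toReal * (occ τ' (y' - x) w).toReal ∂μ)
      (∫⁻ r in Set.Ioc 0 τ, ∫⁻ s in Set.Ioc 0 τ', transENN M c |s - r| (y' - y)).toReal := by
  have h0 := tsum_lintegral_occ_mul_occ_ne_top hμ τ τ' y y'
  rw [← hμ.tsum_lintegral_occ_mul_occ]
  have h1 : ∀ x, ∫ w, (occ τ (y - x) w).toReal * (occ τ' (y' - x) w).toReal ∂μ =
      (∫⁻ w, occ τ (y - x) w * occ τ' (y' - x) w ∂μ).toReal := by
    intro x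
    simp only [← ENNReal.toReal_mul]
    exact integral_toReal ((measurable_occ _ _).mul (measurable_occ _ _)).aemeasurable
      (ae_of_all _ fun w => (ENNReal.mul_ne_top (occ_ne_top _ _ _) (occ_ne_top _ _ _)).lt_top)
  simp only [h1]
  rw [ENNReal.tsum_toReal_eq fun x => ENNReal.ne_top_of_tsum_ne_top h0 x]
  exact ENNReal.hasSum_toReal h0

theorem hasSum_integral_occ (hμ : IsCRandomWalkLaw M c μ) {τ : ℝ} (hτ : 0 ≤ τ) (y : Hier M) :
    HasSum (fun x => ∫ w, (occ τ (y - x) w).toReal ∂μ) τ := by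
  have h0 := hμ.tsum_lintegral_occ τ y
  have h1 : ∀ x, ∫ w, (occ τ (y - x) w).toReal ∂μ = (∫⁻ w, occ τ (y - x) w ∂μ).toReal :=
    fun x => integral_toReal (measurable_occ _ _).aemeasurable
      (ae_of_all _ fun w => (occ_ne_top _ _ _).lt_top)
  simp only [h1]
  have h2 := h0.trans_ne ENNReal.ofReal_ne_top
  convert ENNReal.hasSum_toReal h2
  rw [← ENNReal.tsum_toReal_eq fun x => ENNReal.ne_top_of_tsum_ne_top h2 x, h0,
    ENNReal.toReal_ofReal hτ]

omit [NeZero M] in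
theorem integrable_toReal_occ [IsProbabilityMeasure μ] (τ : ℝ) (y : Hier M) :
    Integrable (fun w => (occ τ y w).toReal) μ :=
  Integrable.of_bound (measurable_occ _ _).ennreal_toReal.aestronglyMeasurable
    (ENNReal.ofReal τ).toReal (ae_of_all _ fun w => by
      rw [Real.norm_of_nonneg ENNReal.toReal_nonneg]
      exact ENNReal.toReal_mono ENNReal.ofReal_ne_top (occ_le _ _ _))

omit [NeZero M] in
theorem integrable_toReal_occ_mul [IsProbabilityMeasure μ] (τ τ' : ℝ) (y y' : Hier M) :
    Integrable (fun w => (occ τ y w).toReal * (occ τ' y' w).toReal) μ :=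
  (integrable_toReal_occ τ' y').bdd_mul
    (measurable_occ _ _).ennreal_toReal.aestronglyMeasurable (c := (ENNReal.ofReal τ).toReal)
    (ae_of_all _ fun w => by
      rw [Real.norm_of_nonneg ENNReal.toReal_nonneg]
      exact ENNReal.toReal_mono ENNReal.ofReal_ne_top (occ_le _ _ _))

theorem tsum_integral_occSum (hμ : IsCRandomWalkLaw M c μ) (T : ℝ≥0) :
    ∑' x, ∫ w, occSum t y v T x w ∂μ = ∑ i, v i * (1 / √(T : ℝ)) * (T * t i) := by
  have := hμ.isProbabilityMeasure
  refine HasSum.tsum_eq ?_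
  unfold occSum
  simp only [integral_finsetSum _ fun i _ => (integrable_toReal_occ _ _).const_mul _,
    integral_const_mul]
  exact hasSum_sum fun i _ => (hasSum_integral_occ hμ (by positivity) (y i)).mul_left _

theorem tsum_integral_occSum_sq (hμ : IsCRandomWalkLaw M c μ) (T : ℝ≥0) :
    ∑' x, ∫ w, occSum t y v T x w ^ 2 ∂μ =
      ∑ i, ∑ j, v i * v j * (occCov M c T (t i) (t j) (y j - y i)).toReal := by
  have := hμ.isProbabilityMeasure
  refine HasSum.tsum_eq ?_
  have h1 : ∀ x w, occSum t y v T x w ^ 2 = ∑ i, ∑ j, v i * v j * (T : ℝ)⁻¹ *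
      ((occ (T * t i) (y i - x) w).toReal * (occ (T * t j) (y j - x) w).toReal) := by
    intro x w
    rw [occSum, sq, Finset.sum_mul_sum]
    refine Finset.sum_congr rfl fun i _ => Finset.sum_congr rfl fun j _ => ?_
    have h2 : (T : ℝ)⁻¹ = 1 / √(T : ℝ) * (1 / √(T : ℝ)) := by
      rw [div_mul_div_comm, Real.mul_self_sqrt T.coe_nonneg, one_mul, one_div]
    rw [h2]
    ring
  simp only [h1, integral_finsetSum _ fun i _ => integrable_finsetSum _ fun j _ =>
    (integrable_toReal_occ_mul _ _ _ _).const_mul _,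
    integral_finsetSum _ fun j _ => (integrable_toReal_occ_mul _ _ _ _).const_mul _,
    integral_const_mul]
  refine hasSum_sum fun i _ => hasSum_sum fun j _ => ?_
  have h2 := (hasSum_integral_occ_mul_occ hμ (T * t i) (T * t j) (y i) (y j)).mul_left
    (v i * v j * (T : ℝ)⁻¹)
  -- This includes `T = 0`: the inverse in `ℝ≥0∞` is then `∞`, whose `toReal` is `0`, as is the real
  -- inverse.
  have h3 : (occCov M c T (t i) (t j) (y j - y i)).toReal = (T : ℝ)⁻¹ *
      (∫⁻ r in Set.Ioc (0 : ℝ) (T * t i), ∫⁻ u in Set.Ioc (0 : ℝ) (T * t j),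
        transENN M c |u - r| (y j - y i)).toReal := by
    unfold occCov
    rw [ENNReal.toReal_mul, ENNReal.toReal_inv, ENNReal.coe_toReal]
  rw [h3, ← mul_assoc]
  exact h2

/-- The limit of the scaled second moments of occupation times. -/
noncomputable def greenCov (M : ℕ) (c : ℝ) (s t : ℝ≥0) (y : Hier M) : ℝ :=
  2 * (min s t : ℝ≥0) * (greenENN M c y).toReal

theorem tendsto_occCov (hc : 1 < c) (hcM : c < M) (s t : ℝ≥0) (y : Hier M) :
    Tendsto (fun T => (occCov M c T s t y).toReal) atTop (𝓝 (greenCov M c s t y)) := by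
  have hg : greenENN M c y ≠ ∞ := tsum_stepENN_ne_top hc hcM y
  have h1 := tendsto_lintegral_lintegral_abs_sub (measurable_transENN (M := M) (c := c) y)
    (by rwa [lintegral_transENN]) s t
  rw [lintegral_transENN] at h1
  have h2 := (ENNReal.tendsto_toReal (ENNReal.mul_ne_top (ENNReal.mul_ne_top (by simp)
    ENNReal.coe_ne_top) hg)).comp h1
  have h3 : (2 * (min s t : ℝ≥0) * greenENN M c y).toReal = greenCov M c s t y := by
    unfold greenCov
    rw [ENNReal.toReal_mul, ENNReal.toReal_mul]
    rfl
  rw [← h3]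
  exact h2

theorem tendsto_tsum_integral_occSum_sq (hc : 1 < c) (hcM : c < M)
    (hμ : IsCRandomWalkLaw M c μ) :
    Tendsto (fun T => ∑' x, ∫ w, occSum t y v T x w ^ 2 ∂μ) atTop
      (𝓝 (∑ i, ∑ j, v i * v j * greenCov M c (t i) (t j) (y j - y i))) := by
  simp only [tsum_integral_occSum_sq t y v hμ]
  exact tendsto_finsetSum _ fun i _ => tendsto_finsetSum _ fun j _ =>
    (tendsto_occCov hc hcM _ _ _).const_mul _

/-- The power mean inequality `(Σ a_i)³ ≤ n² Σ a_i³` reduces the linear combination to single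
occupation times. -/
theorem tsum_lintegral_enorm_occSum_pow_three_le (hμ : IsCRandomWalkLaw M c μ) (T : ℝ≥0) :
    ∑' x, ∫⁻ w, ‖occSum t y v T x w‖ₑ ^ 3 ∂μ ≤
      (Fintype.card ι : ℝ≥0∞) ^ 2 * ∑ i, ‖v i * (1 / √(T : ℝ))‖ₑ ^ 3 *
        (ENNReal.ofReal (T * t i) * (12 * greenENN M c 0 ^ 2)) := by
  have h1 : ∀ x w, ‖occSum t y v T x w‖ₑ ^ 3 ≤ (Fintype.card ι : ℝ≥0∞) ^ 2 *
      ∑ i, ‖v i * (1 / √(T : ℝ))‖ₑ ^ 3 * occ (T * t i) (y i - x) w ^ 3 := by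
    intro x w
    have h2 := ENNReal.rpow_sum_le_const_mul_sum_rpow Finset.univ
      (fun i => ‖v i * (1 / √(T : ℝ))‖ₑ * occ (T * t i) (y i - x) w) (p := 3) (by norm_num)
    have h3 : (3 : ℝ) - 1 = (2 : ℕ) := by norm_num
    have h4 : (3 : ℝ) = (3 : ℕ) := by norm_num
    rw [h3] at h2
    rw [h4] at h2
    simp only [ENNReal.rpow_natCast, mul_pow, Finset.card_univ] at h2
    refine le_trans ?_ h2
    gcongr
    refine (enorm_sum_le _ _).trans (le_of_eq (Finset.sum_congr rfl fun i _ => ?_))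
    rw [enorm_mul, enorm_toReal_occ]
  have hm : ∀ i x, Measurable fun w : ℝ≥0 → Hier M => occ (T * t i) (y i - x) w ^ 3 :=
    fun i x => (measurable_occ _ _).pow_const 3
  calc ∑' x, ∫⁻ w, ‖occSum t y v T x w‖ₑ ^ 3 ∂μ
      ≤ ∑' x, ∫⁻ w, (Fintype.card ι : ℝ≥0∞) ^ 2 *
        ∑ i, ‖v i * (1 / √(T : ℝ))‖ₑ ^ 3 * occ (T * t i) (y i - x) w ^ 3 ∂μ := by
        gcongr with x w
        exact h1 x w
    _ = (Fintype.card ι : ℝ≥0∞) ^ 2 * ∑ i, ‖v i * (1 / √(T : ℝ))‖ₑ ^ 3 *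
        ∑' x, ∫⁻ w, occ (T * t i) (y i - x) w ^ 3 ∂μ := by
        have h5 : ∀ x, ∫⁻ w, (Fintype.card ι : ℝ≥0∞) ^ 2 *
            ∑ i, ‖v i * (1 / √(T : ℝ))‖ₑ ^ 3 * occ (T * t i) (y i - x) w ^ 3 ∂μ =
            (Fintype.card ι : ℝ≥0∞) ^ 2 * ∑ i, ‖v i * (1 / √(T : ℝ))‖ₑ ^ 3 *
              ∫⁻ w, occ (T * t i) (y i - x) w ^ 3 ∂μ := by
          intro x
          rw [lintegral_const_mul _ (Finset.measurable_fun_sum _ fun i _ => (hm i x).const_mul _),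
            lintegral_finsetSum _ fun i _ => (hm i x).const_mul _]
          congr 1
          exact Finset.sum_congr rfl fun i _ => lintegral_const_mul _ (hm i x)
        simp only [h5]
        rw [ENNReal.tsum_mul_left, Summable.tsum_finsetSum fun _ _ => ENNReal.summable]
        simp only [ENNReal.tsum_mul_left]
    _ ≤ _ := by
        gcongr with i
        exact hμ.tsum_lintegral_occ_pow_three_le _ _

/-- The scaling contributes `T^(-3/2)` and the third moments grow at most like `T`, which leaves
`T^(-1/2)`. -/
theorem tendsto_tsum_lintegral_enorm_occSum_pow_three (hc : 1 < c) (hcM : c < M)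
    (hμ : IsCRandomWalkLaw M c μ) :
    Tendsto (fun T => ∑' x, ∫⁻ w, ‖occSum t y v T x w‖ₑ ^ 3 ∂μ) atTop (𝓝 0) := by
  have hg : greenENN M c 0 ≠ ∞ := tsum_stepENN_ne_top hc hcM 0
  refine tendsto_of_tendsto_of_tendsto_of_le_of_le tendsto_const_nhds ?_
    (fun _ => bot_le) (tsum_lintegral_enorm_occSum_pow_three_le t y v hμ)
  have h1 : ∀ i, Tendsto (fun T : ℝ≥0 => ‖v i * (1 / √(T : ℝ))‖ₑ ^ 3 *
      (ENNReal.ofReal (T * t i) * (12 * greenENN M c 0 ^ 2))) atTop (𝓝 0) := by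
    intro i
    have h2 : ∀ T : ℝ≥0, ‖v i * (1 / √(T : ℝ))‖ₑ ^ 3 * ENNReal.ofReal (T * t i) =
        ENNReal.ofReal (|v i| ^ 3 * t i * (√(T : ℝ))⁻¹) := by
      intro T
      rw [Real.enorm_eq_ofReal_abs, ← ENNReal.ofReal_pow (abs_nonneg _),
        ← ENNReal.ofReal_mul (by positivity)]
      congr 1
      rw [abs_mul, abs_of_nonneg (a := 1 / √(T : ℝ)) (by positivity)]
      rcases eq_or_ne (√(T : ℝ)) 0 with h0 | h0
      · simp [h0]
      · nth_rw 2 [← Real.mul_self_sqrt T.coe_nonneg]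
        field_simp
    simp only [← mul_assoc, h2]
    have h3 : Tendsto (fun T : ℝ≥0 => ENNReal.ofReal (|v i| ^ 3 * t i * (√(T : ℝ))⁻¹)) atTop
        (𝓝 0) := by
      have h4 : Tendsto (fun T : ℝ≥0 => (√(T : ℝ))⁻¹) atTop (𝓝 0) :=
        tendsto_inv_atTop_zero.comp (Real.tendsto_sqrt_atTop.comp
          (NNReal.tendsto_coe_atTop.2 tendsto_id))
      simpa using ENNReal.tendsto_ofReal (h4.const_mul (|v i| ^ 3 * t i))
    have h5 := ENNReal.Tendsto.mul_const (b := 12 * greenENN M c 0 ^ 2) h3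
      (Or.inr (ENNReal.mul_ne_top (by simp) (ENNReal.pow_ne_top hg)))
    simpa [mul_assoc] using h5
  have h6 := ENNReal.Tendsto.const_mul (a := (Fintype.card ι : ℝ≥0∞) ^ 2)
    (tendsto_finsetSum Finset.univ fun i _ => h1 i)
    (Or.inr (ENNReal.pow_ne_top (ENNReal.natCast_ne_top _)))
  simpa using h6

end OccupationSum

/-! ### Characteristic functions of the fluctuations -/

section System

open IsPoissonSystem

variable {M : ℕ} [NeZero M] {c : ℝ} {Ω : Type*} [MeasurableSpace Ω] {P : Measure Ω}
  [IsProbabilityMeasure P] {lam : ℝ≥0} {θ : Hier M → Ω → ℕ}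
  {z : Hier M → ℕ → ℝ≥0 → Ω → Hier M} {ι : Type*} [Fintype ι]

theorem BbDual.ofFun_point (u : Hier M → ℝ) (x : Hier M) :
    BbDual.ofFun u (Bb.point x) = u x := by
  change ∑' w, u w * (Pi.single x 1 : Hier M → ℝ) w = u x
  rw [tsum_eq_single x fun w hw => by rw [Pi.single_eq_of_ne hw, mul_zero]]
  simp

theorem IsWalkSystem.ae_sum_occupationFluctuation_eq (hc : 1 < c) (hcM : c < M)
    (h : IsWalkSystem M c (poissonMeasure lam) θ z P) (t : ι → ℝ≥0) (y : ι → Hier M)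
    (v : ι → ℝ) (T : ℝ≥0) :
    ∀ᵐ ω ∂P, ∑ i, v i * occupationFluctuation P θ z (fun T => √(T : ℝ)) T (t i) ω
        (Bb.point (y i)) =
      ∑' x, siteSum θ (paths z) (occSum t y v T) x ω -
        lam * ∑' x, ∫ w, occSum t y v T x w ∂(P.map (paths z 0 0)) := by
  have hμ := h.isCRandomWalkLaw hc hcM
  have h1 : ∀ᵐ ω ∂P, ∀ i, Summable fun x =>
      siteSum θ (paths z) (fun x w => (occ (T * t i) (y i - x) w).toReal) x ω := by
    refine ae_all_iff.2 fun i => (h.isPoissonSystem hc hcM).ae_summable_siteSum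
      (fun x => (measurable_occ _ _).ennreal_toReal) ?_
    simp only [enorm_toReal_occ, hμ.tsum_lintegral_occ]
    exact ENNReal.ofReal_ne_top
  filter_upwards [h1, ae_all_iff.2 fun i =>
    h.ae_occupationFluctuation_eq hc hcM (fun T => √(T : ℝ)) T (t i)] with ω h2 h3
  have h4 : ∀ x, siteSum θ (paths z) (occSum t y v T) x ω = ∑ i, v i * (1 / √(T : ℝ)) *
      siteSum θ (paths z) (fun x w => (occ (T * t i) (y i - x) w).toReal) x ω := by
    intro x
    simp only [siteSum, occSum, Finset.mul_sum]
    exact Finset.sum_comm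
  simp only [h3, BbDual.ofFun_point, h4]
  rw [Summable.tsum_finsetSum fun i _ => (h2 i).mul_left _, tsum_integral_occSum t y v hμ,
    Finset.mul_sum, ← Finset.sum_sub_distrib]
  refine Finset.sum_congr rfl fun i _ => ?_
  rw [tsum_mul_left]
  ring

/-- Convergence of the characteristic functions of the finite dimensional distributions of the
occupation time fluctuations. -/
theorem IsWalkSystem.tendsto_integral_exp_occupationFluctuation (hc : 1 < c) (hcM : c < M)
    (h : IsWalkSystem M c (poissonMeasure lam) θ z P) (t : ι → ℝ≥0) (y : ι → Hier M)
    (v : ι → ℝ) :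
    Tendsto (fun T => ∫ ω, Complex.exp ((∑ i, v i *
      occupationFluctuation P θ z (fun T => √(T : ℝ)) T (t i) ω (Bb.point (y i)) : ℝ) *
        Complex.I) ∂P) atTop
      (𝓝 (Complex.exp (-(lam *
        (∑ i, ∑ j, v i * v j * greenCov M c (t i) (t j) (y j - y i)) / 2 : ℝ)))) := by
  have hμ := h.isCRandomWalkLaw hc hcM
  have := hμ.isProbabilityMeasure
  refine ((h.isPoissonSystem hc hcM).tendsto_integral_exp_siteSum
    (fun T => measurable_occSum t y v T) (fun T => abs_occSum_le t y v T)
    (tsum_lintegral_enorm_occSum_ne_top t y v hμ)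
    (tendsto_tsum_integral_occSum_sq t y v hc hcM hμ)
    (tendsto_tsum_lintegral_enorm_occSum_pow_three t y v hc hcM hμ)).congr fun T => ?_
  refine integral_congr_ae ?_
  filter_upwards [h.ae_sum_occupationFluctuation_eq hc hcM t y v T] with ω hω
  rw [hω]

/-- The quadratic form is a limit of sums of expected squares. This makes the limiting kernel
admissible as a covariance. -/
theorem IsCRandomWalkLaw.sum_mul_greenCov_nonneg {μ : Measure (ℝ≥0 → Hier M)}
    (hμ : IsCRandomWalkLaw M c μ) (hc : 1 < c) (hcM : c < M) (t : ι → ℝ≥0) (y : ι → Hier M)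
    (v : ι → ℝ) : 0 ≤ ∑ i, ∑ j, v i * v j * greenCov M c (t i) (t j) (y j - y i) :=
  ge_of_tendsto' (tendsto_tsum_integral_occSum_sq t y v hc hcM hμ) fun _ =>
    tsum_nonneg fun _ => integral_nonneg fun _ => sq_nonneg _

end System

/-! ### Isonormal processes from independent standard normal variables -/

section Isonormal

theorem norm_exp_mul_I_sub_exp_mul_I_le (a b : ℝ) :
    ‖Complex.exp (a * Complex.I) - Complex.exp (b * Complex.I)‖ ≤ |a - b| := by
  have h1 : Complex.exp (a * Complex.I) - Complex.exp (b * Complex.I) =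
      Complex.exp (b * Complex.I) * (Complex.exp (Complex.I * (a - b : ℝ)) - 1) := by
    rw [mul_sub, ← Complex.exp_add, mul_one]
    congr 2
    push_cast
    ring
  rw [h1, norm_mul, Complex.norm_exp_ofReal_mul_I, one_mul]
  exact Real.norm_exp_I_mul_ofReal_sub_one_le

variable {Ω : Type*} [MeasurableSpace Ω] {P : Measure Ω} [IsProbabilityMeasure P]

/-- The map `x ↦ exp (i x)` is 1-Lipschitz, and on a probability space the `L¹` norm is at most the
`L²` norm. The resulting continuity carries Gaussian laws from finite sums to `L²` limits. -/
theorem norm_charFun_map_sub_le (f g : Lp ℝ 2 P) (u : ℝ) :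
    ‖charFun (P.map f) u - charFun (P.map g) u‖ ≤ |u| * ‖f - g‖ := by
  have h0 : ∀ f : Lp ℝ 2 P, AEStronglyMeasurable f P := Lp.aestronglyMeasurable
  have hc : ∀ f : Lp ℝ 2 P, charFun (P.map f) u =
      ∫ ω, Complex.exp ((u * f ω : ℝ) * Complex.I) ∂P := fun f => by
    rw [charFun_apply_real, integral_map (h0 f).aemeasurable (by fun_prop)]
    push_cast
    rfl
  have hi : ∀ f : Lp ℝ 2 P, Integrable (fun ω => Complex.exp ((u * f ω : ℝ) * Complex.I)) P :=
    fun f => Integrable.of_bound (by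
      have := h0 f
      fun_prop) 1 (ae_of_all _ fun ω => (Complex.norm_exp_ofReal_mul_I _).le)
  have h1 : Integrable (fun ω => |f ω - g ω|) P :=
    (((Lp.memLp f).integrable (by norm_num)).sub ((Lp.memLp g).integrable (by norm_num))).abs
  rw [hc, hc, ← integral_sub (hi f) (hi g)]
  calc ‖∫ ω, (Complex.exp ((u * f ω : ℝ) * Complex.I) -
        Complex.exp ((u * g ω : ℝ) * Complex.I)) ∂P‖
      ≤ ∫ ω, |u| * |f ω - g ω| ∂P := by
        refine norm_integral_le_of_norm_le (h1.const_mul _) (ae_of_all _ fun ω => ?_)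
        refine (norm_exp_mul_I_sub_exp_mul_I_le _ _).trans (le_of_eq ?_)
        rw [← mul_sub, abs_mul]
    _ = |u| * ∫ ω, ‖(f - g) ω‖ ∂P := by
        rw [integral_const_mul]
        congr 1
        refine integral_congr_ae ?_
        filter_upwards [Lp.coeFn_sub f g] with ω hω
        rw [hω, Pi.sub_apply, Real.norm_eq_abs]
    _ ≤ |u| * ‖f - g‖ := by
        gcongr
        rw [integral_norm_eq_lintegral_enorm (h0 _), Lp.norm_def, ← eLpNorm_one_eq_lintegral_enorm]
        exact ENNReal.toReal_mono (Lp.eLpNorm_ne_top _)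
          (eLpNorm_le_eLpNorm_of_exponent_le (by norm_num) (h0 _))

theorem continuous_charFun_map (u : ℝ) :
    Continuous fun f : Lp ℝ 2 P => charFun (P.map f) u := by
  refine (LipschitzWith.of_dist_le_mul (K := ‖u‖₊) fun f g => ?_).continuous
  rw [dist_eq_norm, dist_eq_norm]
  exact norm_charFun_map_sub_le f g u

variable (ι : Type*)

/-- The law of a family of independent standard normal random variables. -/
noncomputable def stdGaussianPi : Measure (ι → ℝ) := Measure.infinitePi fun _ => gaussianReal 0 1

instance : IsProbabilityMeasure (stdGaussianPi ι) :=
  inferInstanceAs (IsProbabilityMeasure (Measure.infinitePi _))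

variable {ι}

theorem map_eval_stdGaussianPi (i : ι) :
    (stdGaussianPi ι).map (fun ω => ω i) = gaussianReal 0 1 :=
  Measure.infinitePi_map_eval _ i

theorem iIndepFun_eval_stdGaussianPi :
    iIndepFun (fun (i : ι) (ω : ι → ℝ) => ω i) (stdGaussianPi ι) :=
  iIndepFun_infinitePi (X := fun _ x => x) fun _ => measurable_id

theorem memLp_eval_stdGaussianPi (i : ι) :
    MemLp (fun ω : ι → ℝ => ω i) 2 (stdGaussianPi ι) := by
  have h := memLp_id_gaussianReal' (μ := 0) (v := 1) 2 (by norm_num)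
  rw [← map_eval_stdGaussianPi i] at h
  exact h.comp_of_map (measurable_pi_apply i).aemeasurable

/-- The coordinates, as elements of the `L²` space. -/
noncomputable def coordLp (i : ι) : Lp ℝ 2 (stdGaussianPi ι) :=
  (memLp_eval_stdGaussianPi i).toLp _

theorem integral_eval_stdGaussianPi (i : ι) : ∫ ω, ω i ∂stdGaussianPi ι = 0 := by
  rw [← integral_map (φ := fun ω : ι → ℝ => ω i) (f := fun x => x)
    (measurable_pi_apply i).aemeasurable aestronglyMeasurable_id, map_eval_stdGaussianPi,
    integral_id_gaussianReal]

theorem integral_eval_sq_stdGaussianPi (i : ι) : ∫ ω, ω i * ω i ∂stdGaussianPi ι = 1 := by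
  have h := variance_fun_id_gaussianReal (μ := 0) (v := 1)
  rw [variance_eq_integral measurable_id'.aemeasurable, integral_id_gaussianReal,
    ← map_eval_stdGaussianPi i, integral_map (measurable_pi_apply i).aemeasurable
      (by fun_prop)] at h
  simpa [sq] using h

theorem orthonormal_coordLp : Orthonormal ℝ (coordLp : ι → Lp ℝ 2 (stdGaussianPi ι)) := by
  classical
  rw [orthonormal_iff_ite]
  intro i j
  have h1 : inner ℝ (coordLp i) (coordLp j) = ∫ ω, ω i * ω j ∂stdGaussianPi ι := by
    rw [L2.inner_def]
    refine integral_congr_ae ?_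
    filter_upwards [(memLp_eval_stdGaussianPi i).coeFn_toLp,
      (memLp_eval_stdGaussianPi j).coeFn_toLp] with ω hi hj
    rw [coordLp, coordLp, hi, hj]
    exact mul_comm _ _
  rw [h1]
  split_ifs with hij
  · subst hij
    exact integral_eval_sq_stdGaussianPi i
  · rw [((iIndepFun_eval_stdGaussianPi (ι := ι)).indepFun hij).integral_fun_mul_eq_mul_integral
      (measurable_pi_apply i).aestronglyMeasurable (measurable_pi_apply j).aestronglyMeasurable,
      integral_eval_stdGaussianPi, zero_mul]

theorem charFun_map_sum_coordLp (s : Finset ι) (a : ι → ℝ) (u : ℝ) :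
    charFun ((stdGaussianPi ι).map (∑ i ∈ s, a i • coordLp i : Lp ℝ 2 (stdGaussianPi ι))) u =
      Complex.exp (-((∑ i ∈ s, a i ^ 2 : ℝ) * u ^ 2 / 2)) := by
  have h1 : (∑ i ∈ s, a i • coordLp i : Lp ℝ 2 (stdGaussianPi ι)) =ᵐ[stdGaussianPi ι]
      ∑ i ∈ s, fun ω : ι → ℝ => a i * ω i := by
    have h2 : ∀ᵐ ω ∂stdGaussianPi ι, ∀ i ∈ s, (a i • coordLp i : Lp ℝ 2 (stdGaussianPi ι)) ω =
        a i * ω i := by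
      refine (ae_ball_iff s.countable_toSet).2 fun i _ => ?_
      filter_upwards [Lp.coeFn_smul (a i) (coordLp i),
        (memLp_eval_stdGaussianPi i).coeFn_toLp] with ω h3 h4
      rw [h3, Pi.smul_apply, coordLp, h4, smul_eq_mul]
    filter_upwards [h2, Lp.coeFn_finsetSum s fun i => (a i • coordLp i)] with ω h3 h4
    rw [h4, Finset.sum_apply, Finset.sum_apply]
    exact Finset.sum_congr rfl h3
  rw [Measure.map_congr h1, iIndepFun.charFun_map_finsetSum_eq_prod, Finset.prod_apply]
  · have h5 : ∀ i, charFun ((stdGaussianPi ι).map fun ω => a i * ω i) u =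
        Complex.exp (-((a i ^ 2 : ℝ) * u ^ 2 / 2)) := by
      intro i
      have h6 : (stdGaussianPi ι).map (fun ω => a i * ω i) =
          ((stdGaussianPi ι).map fun ω => ω i).map (a i * ·) :=
        (Measure.map_map (by fun_prop) (by fun_prop)).symm
      rw [h6, map_eval_stdGaussianPi, gaussianReal_map_const_mul, charFun_gaussianReal]
      congr 1
      push_cast
      simp
    simp only [h5]
    rw [← Complex.exp_sum]
    congr 1
    push_cast
    rw [Finset.sum_neg_distrib, Finset.sum_mul, Finset.sum_div]
  · intro i _
    have h7 : Measurable fun ω : ι → ℝ => a i * ω i := by fun_prop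
    exact h7.aemeasurable
  · exact ((iIndepFun_eval_stdGaussianPi (ι := ι)).comp (fun i x => a i * x)
      fun i => by fun_prop).restrict s

end Isonormal

/-- Every Hilbert space embeds isometrically into a Gaussian Hilbert space. -/
theorem exists_isonormal (H : Type) [NormedAddCommGroup H] [InnerProductSpace ℝ H]
    [CompleteSpace H] :
    ∃ (Ω : Type) (_ : MeasurableSpace Ω) (P : Measure Ω) (_ : IsProbabilityMeasure P)
      (W : H →ₗᵢ[ℝ] Lp ℝ 2 P), ∀ h, P.map (W h) = gaussianReal 0 (‖h‖₊ ^ 2) := by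
  -- The basis may be uncountable. Its vectors are sent to independent standard normal coordinates,
  -- which are orthonormal in `L²`, so the linear extension is isometric.
  obtain ⟨w, b, -⟩ := exists_hilbertBasis ℝ H
  have ho := (orthonormal_coordLp (ι := w)).orthogonalFamily
  refine ⟨w → ℝ, inferInstance, stdGaussianPi w, inferInstance,
    ho.linearIsometry.comp b.repr.toLinearIsometry, fun h => ?_⟩
  refine Measure.ext_of_charFun (funext fun u => ?_)
  set a : w → ℝ := fun i => b.repr h i with ha
  have h1 : Tendsto (fun s : Finset w =>
      charFun ((stdGaussianPi w).map (∑ i ∈ s, a i • coordLp i : Lp ℝ 2 (stdGaussianPi w))) u)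
      atTop (𝓝 (charFun ((stdGaussianPi w).map (ho.linearIsometry (b.repr h))) u)) :=
    ((continuous_charFun_map u).tendsto _).comp (ho.hasSum_linearIsometry (b.repr h))
  have h2 : HasSum (fun i => a i ^ 2) (‖h‖ ^ 2) := by
    have h3 := b.hasSum_inner_mul_inner h h
    rw [real_inner_self_eq_norm_sq] at h3
    refine h3.congr_fun fun i => ?_
    rw [ha]
    simp only [b.repr_apply_apply]
    rw [real_inner_comm, sq]
  have h4 : Tendsto (fun s : Finset w => Complex.exp (-((∑ i ∈ s, a i ^ 2 : ℝ) * u ^ 2 / 2)))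
      atTop (𝓝 (Complex.exp (-((‖h‖ ^ 2 : ℝ) * u ^ 2 / 2)))) := by
    have h5 : Continuous fun x : ℝ => Complex.exp (-(x * u ^ 2 / 2)) := by fun_prop
    exact (h5.tendsto _).comp h2
  simp only [charFun_map_sum_coordLp] at h1
  rw [charFun_gaussianReal]
  refine (tendsto_nhds_unique h1 h4).trans ?_
  congr 1
  push_cast
  simp

/-! ### Convergence in law from finitely many coordinates -/

section WeakConvergence

/-- Lévy's convergence theorem along a countably generated filter. -/
theorem tendsto_probabilityMeasure_of_tendsto_charFun {E : Type*} [NormedAddCommGroup E]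
    [InnerProductSpace ℝ E] [FiniteDimensional ℝ E] [MeasurableSpace E] [BorelSpace E] {ι : Type*}
    {l : Filter ι} [l.IsCountablyGenerated] {μ : ι → ProbabilityMeasure E}
    {ν : ProbabilityMeasure E}
    (h : ∀ t, Tendsto (fun i => charFun (μ i) t) l (𝓝 (charFun (ν : Measure E) t))) : Tendsto μ l (𝓝 ν) :=
  tendsto_of_seq_tendsto fun _ hu =>
    ProbabilityMeasure.tendsto_of_tendsto_charFun fun t => (h t).comp hu

variable {E κ : Type*} {Φ : E → κ → ℝ}

/-- The open cylinder sets generated by finitely many of the functions `Φ · k`. -/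
def openCylinders (Φ : E → κ → ℝ) : Set (Set E) :=
  {s | ∃ (A : Finset κ) (V : Set (A → ℝ)), IsOpen V ∧ s = (fun e (a : A) => Φ e a) ⁻¹' V}

theorem union_mem_openCylinders {s t : Set E} (hs : s ∈ openCylinders Φ)
    (ht : t ∈ openCylinders Φ) : s ∪ t ∈ openCylinders Φ := by
  classical
  obtain ⟨A, V, hV, rfl⟩ := hs
  obtain ⟨B, W, hW, rfl⟩ := ht
  refine ⟨A ∪ B,
    ((fun x (a : A) => x ⟨a, Finset.mem_union_left B a.2⟩) ⁻¹' V) ∪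
      ((fun x (b : B) => x ⟨b, Finset.mem_union_right A b.2⟩) ⁻¹' W),
    (hV.preimage (by fun_prop)).union (hW.preimage (by fun_prop)), rfl⟩

theorem biUnion_mem_openCylinders (T : Finset (Set E)) (hT : ∀ s ∈ T, s ∈ openCylinders Φ) :
    ⋃ s ∈ T, s ∈ openCylinders Φ := by
  classical
  induction T using Finset.induction with
  | empty => exact ⟨∅, ∅, isOpen_empty, by simp⟩
  | insert s T _ ih =>
    rw [Finset.set_biUnion_insert]
    exact union_mem_openCylinders (hT s (Finset.mem_insert_self s T))
      (ih fun s' hs' => hT s' (Finset.mem_insert_of_mem hs'))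

variable [TopologicalSpace E]

theorem exists_mem_openCylinders (hΦ : IsInducing Φ) {u : Set E} (hu : IsOpen u) {x : E}
    (hx : x ∈ u) : ∃ s ∈ openCylinders Φ, s ∈ 𝓝 x ∧ s ⊆ u := by
  obtain ⟨U, hU, rfl⟩ := hΦ.isOpen_iff.1 hu
  obtain ⟨A, V, hV, hVU⟩ := isOpen_pi_iff.1 hU (Φ x) hx
  have hopen : IsOpen (Set.pi Set.univ fun a : A => V a) :=
    isOpen_set_pi Set.finite_univ fun a _ => (hV a a.2).1
  have hc : Continuous fun e (a : A) => Φ e a :=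
    continuous_pi fun a => (continuous_apply (a : κ)).comp hΦ.continuous
  refine ⟨_, ⟨A, _, hopen, rfl⟩, (hopen.preimage hc).mem_nhds fun a _ => (hV a a.2).2, ?_⟩
  intro e he
  exact hVU fun a ha => he ⟨a, ha⟩ trivial

/-- The finite dimensional marginals, as elements of a Euclidean space. -/
def marginal (Φ : E → κ → ℝ) (A : Finset κ) (e : E) : EuclideanSpace ℝ A :=
  WithLp.toLp 2 fun a => Φ e a

theorem continuous_marginal (hΦ : IsInducing Φ) (A : Finset κ) : Continuous (marginal Φ A) :=
  (PiLp.continuous_toLp 2 fun _ : A => ℝ).comp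
    (continuous_pi fun a => (continuous_apply (a : κ)).comp hΦ.continuous)

theorem charFun_map_marginal [MeasurableSpace E] [OpensMeasurableSpace E] (hΦ : IsInducing Φ)
    (A : Finset κ) {Ω : Type*} [MeasurableSpace Ω] {P : Measure Ω} {X : Ω → E}
    (hX : AEMeasurable X P) (v : EuclideanSpace ℝ A) :
    charFun ((P.map X).map (marginal Φ A)) v =
      ∫ ω, Complex.exp ((∑ a, v a * Φ (X ω) a : ℝ) * Complex.I) ∂P := by
  have hm : Measurable (marginal Φ A) := (continuous_marginal hΦ A).measurable
  rw [charFun_apply, integral_map hm.aemeasurable (by fun_prop),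
    integral_map hX (Measurable.aestronglyMeasurable (by fun_prop))]
  refine integral_congr_ae (ae_of_all _ fun ω => ?_)
  simp only [PiLp.inner_apply]
  rfl

/-- Convergence in law in a space that embeds into a countable product of lines follows from
the convergence of the characteristic functions of the finite dimensional marginals. -/
theorem tendstoInDistribution_of_tendsto_integral_exp [SecondCountableTopology E]
    [MeasurableSpace E] [OpensMeasurableSpace E] (hΦ : IsInducing Φ) {ι Ω Ω' : Type*}
    [MeasurableSpace Ω] [MeasurableSpace Ω'] {P : Measure Ω} [IsProbabilityMeasure P]
    {P' : Measure Ω'} [IsProbabilityMeasure P'] {X : ι → Ω → E} {Y : Ω' → E} {l : Filter ι}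
    [l.IsCountablyGenerated] (hX : ∀ i, AEMeasurable (X i) P) (hY : AEMeasurable Y P')
    (h : ∀ (A : Finset κ) (v : A → ℝ), Tendsto
      (fun i => ∫ ω, Complex.exp ((∑ a, v a * Φ (X i ω) a : ℝ) * Complex.I) ∂P) l
      (𝓝 (∫ ω, Complex.exp ((∑ a, v a * Φ (Y ω) a : ℝ) * Complex.I) ∂P'))) :
    TendstoInDistribution X l Y (fun _ => P) P' := by
  rcases l.eq_or_neBot with rfl | hl
  · exact ⟨hX, hY, tendsto_bot⟩
  refine ⟨hX, hY, ?_⟩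
  have hm : ∀ A : Finset κ, Measurable (marginal Φ A) := fun A =>
    (continuous_marginal hΦ A).measurable
  set μ : ι → ProbabilityMeasure E := fun i => ⟨P.map (X i), Measure.isProbabilityMeasure_map (hX i)⟩
    with hμ
  set ν : ProbabilityMeasure E := ⟨P'.map Y, Measure.isProbabilityMeasure_map hY⟩ with hν
  have hfin : ∀ A : Finset κ, Tendsto (fun i => (μ i).map (hm A).aemeasurable) l
      (𝓝 (ν.map (hm A).aemeasurable)) := by
    intro A
    refine tendsto_probabilityMeasure_of_tendsto_charFun fun v => ?_
    change Tendsto (fun i => charFun ((P.map (X i)).map (marginal Φ A)) v) l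
      (𝓝 (charFun ((P'.map Y).map (marginal Φ A)) v))
    rw [charFun_map_marginal hΦ A hY]
    simp only [charFun_map_marginal hΦ A (hX _)]
    exact h A v
  -- Portmanteau: an open `G` is approximated from inside, up to small mass of the limit law, by a
  -- finite union of open cylinders. Such a union depends on finitely many coordinates, for which
  -- Lévy's theorem has given convergence already.
  refine tendsto_of_forall_isOpen_le_liminf' fun G hG => ?_
  refine le_of_forall_lt fun r hr => ?_
  lift r to ℝ≥0 using hr.ne_top
  have hr' : r < ν G := by
    rwa [← ENNReal.coe_lt_coe, ProbabilityMeasure.ennreal_coeFn_eq_coeFn_toMeasure]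
  obtain ⟨T, hT, hrT, hTG⟩ := ProbabilityMeasure.exists_lt_measure_biUnion_of_isOpen
    (S := openCylinders Φ) ν (fun u hu x hx => exists_mem_openCylinders hΦ hu hx) hG hr'
  obtain ⟨A, V, hV, hTV⟩ := biUnion_mem_openCylinders T hT
  rw [hTV] at hrT hTG
  have hV' : IsOpen ((fun x : EuclideanSpace ℝ A => (x : A → ℝ)) ⁻¹' V) :=
    hV.preimage (PiLp.continuous_ofLp 2 fun _ : A => ℝ)
  have h1 := ProbabilityMeasure.le_liminf_measure_open_of_tendsto (hfin A) hV'
  simp only [ProbabilityMeasure.toMeasure_map, Measure.map_apply (hm A) hV'.measurableSet] at h1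
  rw [← ENNReal.coe_lt_coe, ProbabilityMeasure.ennreal_coeFn_eq_coeFn_toMeasure] at hrT
  refine (hrT.trans_le h1).trans_le (liminf_le_liminf (Eventually.of_forall fun i => ?_))
  exact measure_mono hTG

end WeakConvergence

/-! ### Gaussian processes with a prescribed covariance kernel -/

section GaussianProcess

section Hilbert

variable {H : Type*} [NormedAddCommGroup H] [InnerProductSpace ℝ H] {Ω : Type*}
  [MeasurableSpace Ω] {P : Measure Ω} [IsProbabilityMeasure P] {W : H →ₗᵢ[ℝ] Lp ℝ 2 P}

omit [IsProbabilityMeasure P] in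
theorem ae_sum_mul_isonormal (W : H →ₗᵢ[ℝ] Lp ℝ 2 P) {ι : Type*} (s : Finset ι) (a : ι → ℝ)
    (k : ι → H) : W (∑ i ∈ s, a i • k i) =ᵐ[P] fun ω => ∑ i ∈ s, a i * W (k i) ω := by
  have h1 : ∀ᵐ ω ∂P, ∀ i ∈ s, (a i • W (k i) : Lp ℝ 2 P) ω = a i * W (k i) ω := by
    refine (ae_ball_iff s.countable_toSet).2 fun i _ => ?_
    filter_upwards [Lp.coeFn_smul (a i) (W (k i))] with ω hω
    rw [hω, Pi.smul_apply, smul_eq_mul]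
  have h2 : W (∑ i ∈ s, a i • k i) = ∑ i ∈ s, a i • W (k i) := by
    simp only [map_sum, map_smul]
  rw [h2]
  filter_upwards [h1, Lp.coeFn_finsetSum s fun i => a i • W (k i)] with ω h3 h4
  rw [h4, Finset.sum_apply]
  exact Finset.sum_congr rfl h3

omit [IsProbabilityMeasure P] in
theorem isGaussianProcess_isonormal (hW : ∀ h, P.map (W h) = gaussianReal 0 (‖h‖₊ ^ 2)) :
    IsGaussianProcess (fun h ω => W h ω) P where
  hasGaussianLaw I := by
    classical
    -- A linear functional of finitely many values `W i` is almost surely `W` of the corresponding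
    -- linear combination of the vectors `i`, whose norm gives the variance.
    refine ⟨isGaussian_of_map_eq_gaussianReal fun L =>
      ⟨0, ‖∑ i : I, L (Pi.single i 1) • (i : H)‖₊ ^ 2, ?_⟩⟩
    have hm : ∀ h, AEMeasurable (W h) P := fun h => (Lp.aestronglyMeasurable _).aemeasurable
    have hmI : AEMeasurable (fun ω => I.restrict fun h => W h ω) P :=
      aemeasurable_pi_iff.2 fun i => hm i
    rw [AEMeasurable.map_map_of_aemeasurable L.continuous.aemeasurable hmI, ← hW]
    refine Measure.map_congr ?_
    filter_upwards [ae_sum_mul_isonormal W Finset.univ (fun i : I => L (Pi.single i 1))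
      fun i => (i : H)] with ω hω
    rw [hω, Function.comp_apply]
    exact (LinearMap.pi_apply_eq_sum_univ L.toLinearMap _).trans
      (Finset.sum_congr rfl fun i _ => by
        rw [smul_eq_mul, mul_comm]
        refine congrArg (· * _) (congrArg L (funext fun j => ?_))
        simp [Pi.single_apply, eq_comm])

omit [IsProbabilityMeasure P] in
theorem integral_isonormal (hW : ∀ h, P.map (W h) = gaussianReal 0 (‖h‖₊ ^ 2)) (h : H) :
    ∫ ω, W h ω ∂P = 0 := by
  rw [← integral_map (φ := W h) (f := fun x => x) (Lp.aestronglyMeasurable _).aemeasurable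
    aestronglyMeasurable_id, hW, integral_id_gaussianReal]

omit [IsProbabilityMeasure P] in
theorem integral_isonormal_mul (W : H →ₗᵢ[ℝ] Lp ℝ 2 P) (h k : H) :
    ∫ ω, W h ω * W k ω ∂P = inner ℝ h k := by
  rw [← W.inner_map_map, L2.inner_def]
  exact integral_congr_ae (ae_of_all _ fun ω => mul_comm _ _)

omit [IsProbabilityMeasure P] in
theorem integral_exp_isonormal (hW : ∀ h, P.map (W h) = gaussianReal 0 (‖h‖₊ ^ 2)) (h : H) :
    ∫ ω, Complex.exp ((W h ω : ℝ) * Complex.I) ∂P = Complex.exp (-(inner ℝ h h / 2 : ℝ)) := by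
  have h1 := charFun_gaussianReal (μ := 0) (v := ‖h‖₊ ^ 2) 1
  rw [← hW h, charFun_apply_real, integral_map (Lp.aestronglyMeasurable _).aemeasurable
    (by fun_prop)] at h1
  simp only [Complex.ofReal_one, one_mul] at h1
  rw [h1, real_inner_self_eq_norm_sq]
  congr 1
  push_cast
  simp

end Hilbert

/-- A positive semidefinite kernel is the Gram matrix of a family of vectors of a Hilbert
space. -/
theorem exists_inner_eq_kernel {X : Type} {K : X → X → ℝ} (hs : ∀ x y, K x y = K y x)
    (hp : ∀ (s : Finset X) (v : s → ℝ), 0 ≤ ∑ x, ∑ y, v x * v y * K x y) :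
    ∃ (H : Type) (_ : NormedAddCommGroup H) (_ : InnerProductSpace ℝ H) (_ : CompleteSpace H)
      (k : X → H), ∀ x y, inner ℝ (k x) (k y) = K x y := by
  -- Reproducing kernels are operator-valued here, so the scalar kernel acts by multiplication on
  -- `ℝ`. The Gram vectors are the kernel functions applied to `1`.
  set A : Matrix X X (ℝ →L[ℝ] ℝ) := Matrix.of fun x y => K x y • ContinuousLinearMap.id ℝ ℝ
    with hA
  have hherm : A.IsHermitian := by
    ext x y
    rw [Matrix.conjTranspose_apply, hA, Matrix.of_apply, Matrix.of_apply, star_smul,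
      ContinuousLinearMap.star_eq_adjoint, ContinuousLinearMap.adjoint_id, hs x y]
    simp
  have hpos : A.PosSemidef := by
    have h0 : A.PosSemidef ↔ A.IsHermitian ∧ ∀ v : X →₀ ℝ, 0 ≤ RCLike.re
        (v.sum fun x w => v.sum fun x' w' => inner ℝ (A x' x w) w') :=
      (RKHS.posSemidef_tfae (K := A)).out 0 2
    refine h0.2 ⟨hherm, fun v => ?_⟩
    have h1 := hp v.support fun x => v x
    have h2 : (v.sum fun x w => v.sum fun x' w' => inner ℝ (A x' x w) w') =
        ∑ x : v.support, ∑ y : v.support, v x * v y * K x y := by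
      simp only [Finsupp.sum]
      rw [← Finset.sum_coe_sort]
      refine Finset.sum_congr rfl fun x _ => ?_
      rw [← Finset.sum_coe_sort]
      refine Finset.sum_congr rfl fun y _ => ?_
      simp [hA, hs x y]
      ring
    rw [h2]
    exact h1
  have : Fact A.PosSemidef := ⟨hpos⟩
  refine ⟨RKHS.OfKernel A, inferInstance, inferInstance, inferInstance,
    fun x => RKHS.kerFun (RKHS.OfKernel A) x 1, fun x y => ?_⟩
  have h3 := RKHS.kernel_inner (H := RKHS.OfKernel A) y x 1 1
  rw [RKHS.OfKernel.kernel_ofKernel] at h3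
  rw [← h3]
  simp [hA, hs x y]

end GaussianProcess

/-! ### Borel structure and topology of the dual space -/

section Dual

variable {M : ℕ} [NeZero M] {Ω : Type*} [MeasurableSpace Ω] {P : Measure Ω}

/-- The dual is embedded in a countable product of lines, on which the Borel and product σ-algebras
coincide. Measurability can therefore be tested on indicators of points. -/
theorem BbDual.measurableSpace_eq : (inferInstance : MeasurableSpace (BbDual M)) =
    MeasurableSpace.comap (fun μ (x : Hier M) => μ (Bb.point x)) MeasurableSpace.pi := by
  have h1 : (inferInstance : MeasurableSpace (BbDual M)) = borel (BbDual M) := rfl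
  rw [h1, (BbDual.isInducing (M := M)).eq_induced, borel_comap, ← BorelSpace.measurable_eq]

theorem BbDual.measurable_iff {X : Ω → BbDual M} :
    Measurable X ↔ ∀ x, Measurable fun ω => X ω (Bb.point x) := by
  have h1 : Measurable X ↔ Measurable ((fun μ (x : Hier M) => μ (Bb.point x)) ∘ X) := by
    rw [← measurable_comap_iff, ← BbDual.measurableSpace_eq]
  rw [h1, measurable_pi_iff]
  rfl

theorem BbDual.ofFun_apply (u : Hier M → ℝ) (φ : Bb M) : BbDual.ofFun u φ =
    ∑ x ∈ (Bb.finite_support φ).toFinset, (φ : Hier M → ℝ) x * u x := by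
  rw [BbDual.eval_eq_sum]
  simp only [BbDual.ofFun_point]

theorem BbDual.isInducing_pi (n : ℕ) : IsInducing fun (μ : Fin n → BbDual M)
    (p : Fin n × Hier M) => μ p.1 (Bb.point p.2) := by
  refine ⟨?_⟩
  rw [Pi.topologicalSpace, Pi.topologicalSpace, induced_iInf, iInf_prod]
  refine iInf_congr fun k => ?_
  rw [(BbDual.isInducing (M := M)).eq_induced, Pi.topologicalSpace, induced_iInf, induced_iInf]
  refine iInf_congr fun x => ?_
  simp only [induced_compose]
  rfl

end Dual

/-! ### Symmetry of the limiting covariance -/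

section Green

variable {M : ℕ} [NeZero M] {c : ℝ}

omit [NeZero M] in
theorem greenENN_neg (y : Hier M) :
    greenENN M c (-y) = greenENN M c y := by
  rw [← lintegral_transENN, ← lintegral_transENN]
  simp only [transENN_neg]

omit [NeZero M] in
theorem greenCov_comm (s t : ℝ≥0) (x y : Hier M) :
    greenCov M c s t (y - x) = greenCov M c t s (x - y) := by
  unfold greenCov
  rw [min_comm, ← greenENN_neg, neg_sub]

end Green

/-! ### Measurability of the fluctuations and construction of the limit -/

section System

variable {M : ℕ} [NeZero M] {c : ℝ} {Ω : Type*} [MeasurableSpace Ω] {P : Measure Ω}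
  [IsProbabilityMeasure P] {lam : ℝ≥0} {θ : Hier M → Ω → ℕ}
  {z : Hier M → ℕ → ℝ≥0 → Ω → Hier M}

omit [IsProbabilityMeasure P] in
theorem IsWalkSystem.aemeasurable_occupationFluctuation (hc : 1 < c) (hcM : c < M)
    (h : IsWalkSystem M c (poissonMeasure lam) θ z P) (F : ℝ≥0 → ℝ) (T t : ℝ≥0) :
    AEMeasurable (occupationFluctuation P θ z F T t) P := by
  have hs := h.isPoissonSystem hc hcM
  have hm : ∀ y, Measurable fun ω =>
      ∑' x, IsPoissonSystem.siteSum θ (paths z) (fun x w => occ (T * t) (y - x) w) x ω := fun y =>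
    Measurable.tsum fun x => hs.measurable_siteSum (fun x => measurable_occ (T * t) (y - x)) x
  have h1 : ∀ᵐ ω ∂P, ∀ y, ∑' x, IsPoissonSystem.siteSum θ (paths z)
      (fun x w => occ (T * t) (y - x) w) x ω ≠ ∞ :=
    ae_all_iff.2 fun y => h.ae_tsum_siteSum_occ_ne_top hc hcM (T * t) y
  -- In this version `toReal` is applied after the summation, because countable sums in `ℝ≥0∞` are
  -- measurable without any convergence condition.
  refine ⟨fun ω => BbDual.ofFun fun y => 1 / F T *
    ((∑' x, IsPoissonSystem.siteSum θ (paths z) (fun x w => occ (T * t) (y - x) w) x ω).toReal -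
      lam * (T * t)), BbDual.measurable_iff.2 fun y => ?_, ?_⟩
  · simp only [BbDual.ofFun_point]
    exact ((hm y).ennreal_toReal.sub_const _).const_mul _
  · filter_upwards [h1, h.ae_occupationFluctuation_eq hc hcM F T t] with ω h2 h3
    rw [h3]
    congr 1
    funext y
    rw [ENNReal.tsum_toReal_eq fun x => ENNReal.ne_top_of_tsum_ne_top (h2 y) x]
    congr 2
    refine tsum_congr fun x => ?_
    exact (ENNReal.toReal_sum fun j _ => occ_ne_top _ _ _).symm

/-- The Gaussian limit process. -/
theorem exists_gaussian_dual (hc : 1 < c) (hcM : c < M) {μ : Measure (ℝ≥0 → Hier M)}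
    (hμ : IsCRandomWalkLaw M c μ) (lam : ℝ≥0) :
    ∃ (Ω' : Type) (_ : MeasurableSpace Ω') (P' : Measure Ω') (_ : IsProbabilityMeasure P')
      (X : ℝ≥0 → Ω' → BbDual M), IsCenteredGaussianDual X P' ∧
      (∀ (s t : ℝ≥0) (φ ψ : Bb M), ∫ ω, X s ω φ * X t ω ψ ∂P' =
        2 * lam * (min s t : ℝ≥0) * BbDual.ofFun (potential c φ) ψ) ∧
      ∀ (ι : Type) [Fintype ι] (t : ι → ℝ≥0) (y : ι → Hier M) (v : ι → ℝ),
        ∫ ω, Complex.exp ((∑ i, v i * X (t i) ω (Bb.point (y i)) : ℝ) * Complex.I) ∂P' =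
          Complex.exp (-(lam *
            (∑ i, ∑ j, v i * v j * greenCov M c (t i) (t j) (y j - y i)) / 2 : ℝ)) := by
  obtain ⟨H, _, _, _, k, hk⟩ := exists_inner_eq_kernel
    (K := fun p q : ℝ≥0 × Hier M => lam * greenCov M c p.1 q.1 (q.2 - p.2))
    (fun p q => by rw [greenCov_comm]) (fun s v => by
      have h1 := mul_nonneg lam.coe_nonneg (hμ.sum_mul_greenCov_nonneg hc hcM
        (fun p : s => p.1.1) (fun p : s => p.1.2) v)
      simp only [Finset.mul_sum] at h1
      exact h1.trans_eq (Finset.sum_congr rfl fun p _ => Finset.sum_congr rfl fun q _ =>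
        mul_left_comm _ _ _))
  obtain ⟨Ω', _, P', _, W, hW⟩ := exists_isonormal H
  -- Only the values at points are taken from `W`, whose linearity holds merely almost surely for
  -- each combination; `BbDual.ofFun` then gives a linear functional for every `ω`.
  set X : ℝ≥0 → Ω' → BbDual M := fun t ω => BbDual.ofFun fun x => W (k (t, x)) ω with hX
  set g : ℝ≥0 × Bb M → H := fun p => ∑ x ∈ (Bb.finite_support p.2).toFinset,
    (p.2 : Hier M → ℝ) x • k (p.1, x) with hg
  have hXg : ∀ t φ, (fun ω => X t ω φ) =ᵐ[P'] W (g (t, φ)) := by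
    intro t φ
    filter_upwards [ae_sum_mul_isonormal W (Bb.finite_support φ).toFinset (φ : Hier M → ℝ)
      fun x => k (t, x)] with ω hω
    rw [hω, hX, BbDual.ofFun_apply]
  refine ⟨Ω', inferInstance, P', inferInstance, X, ⟨fun t => ?_, ?_, fun t φ => ?_⟩,
    fun s t φ ψ => ?_, fun ι _ t y v => ?_⟩
  · refine BbDual.measurable_iff.2 fun x => ?_
    simp only [hX, BbDual.ofFun_point]
    exact (Lp.stronglyMeasurable _).measurable
  · exact ((isGaussianProcess_isonormal hW).comp_right g).congr fun p => (hXg p.1 p.2).symm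
  · rw [integral_congr_ae (hXg t φ), integral_isonormal hW]
  · have h1 : (fun ω => X s ω φ * X t ω ψ) =ᵐ[P'] fun ω => W (g (s, φ)) ω * W (g (t, ψ)) ω :=
      (hXg s φ).mul (hXg t ψ)
    rw [integral_congr_ae h1, integral_isonormal_mul, hg, BbDual.ofFun_apply, sum_inner,
      Finset.mul_sum]
    simp only [inner_sum, potential_eq_sum hc hcM]
    rw [Finset.sum_comm]
    refine Finset.sum_congr rfl fun y _ => ?_
    rw [Finset.mul_sum, Finset.mul_sum]
    refine Finset.sum_congr rfl fun x _ => ?_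
    rw [inner_smul_left, inner_smul_right, hk, greenCov_comm, greenCov, min_comm]
    simp only [conj_trivial]
    ring
  · have h1 : (fun ω => ∑ i, v i * X (t i) ω (Bb.point (y i))) =ᵐ[P']
        W (∑ i, v i • k (t i, y i)) := by
      filter_upwards [ae_sum_mul_isonormal W Finset.univ v fun i => k (t i, y i)] with ω hω
      rw [hω]
      simp only [hX, BbDual.ofFun_point]
    have h2 := integral_exp_isonormal hW (∑ i, v i • k (t i, y i))
    rw [sum_inner] at h2
    simp only [inner_sum, inner_smul_left, inner_smul_right, hk, conj_trivial] at h2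
    rw [Finset.mul_sum]
    simp only [Finset.mul_sum]
    refine (integral_congr_ae ?_).trans (h2.trans ?_)
    · filter_upwards [h1] with ω hω
      rw [hω]
    · congr 4
      refine Finset.sum_congr rfl fun i _ => Finset.sum_congr rfl fun j _ => ?_
      ring

end System

/-! ### The limit theorem -/

theorem proposition2p8 (M : ℕ) [NeZero M] (hM : 1 < M) (c : ℝ) (hc : 1 < c) (hcM : c < M)
    {Ω : Type*} [MeasurableSpace Ω] (P : Measure Ω) [IsProbabilityMeasure P]
    (lam : ℝ≥0) (θ : Hier M → Ω → ℕ) (z : Hier M → ℕ → ℝ≥0 → Ω → Hier M)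
    (hsys : IsWalkSystem M c (poissonMeasure lam) θ z P) :
    -- the potential operator is well defined
    (∀ (φ : Bb M) (x : Hier M),
      IntegrableOn (fun t => semigroup c t φ x) (Set.Ioi (0 : ℝ))) ∧
    -- the occupation time fluctuation process is well defined
    (∀ (t : ℝ≥0) (x : Hier M),
      (∀ᵐ ω ∂P, (particlesAt θ z t x ω).Finite) ∧
      Integrable (empirical θ z t x) P ∧
      ∀ᵐ ω ∂P, IntervalIntegrable (fun r => empirical θ z r.toNNReal x ω) volume 0 t) ∧
    -- convergence
    ∃ (Ω' : Type) (_ : MeasurableSpace Ω') (P' : Measure Ω') (_ : IsProbabilityMeasure P')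
      (X : ℝ≥0 → Ω' → BbDual M),
      IsCenteredGaussianDual X P' ∧
      (∀ (s t : ℝ≥0) (φ ψ : Bb M), ∫ ω, X s ω φ * X t ω ψ ∂P' =
        2 * (∫ k, (k : ℝ) ∂poissonMeasure lam) * (min s t : ℝ≥0) *
          BbDual.ofFun (potential c φ) ψ) ∧
      TendstoFDD (occupationFluctuation P θ z (fun T => √(T : ℝ))) atTop X P P' := by
  refine ⟨integrableOn_semigroup hc hcM, fun t x => ⟨hsys.ae_finite_particlesAt hc hcM t x,
    hsys.integrable_empirical hc hcM t x, hsys.ae_intervalIntegrable_empirical hc hcM t x⟩, ?_⟩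
  obtain ⟨Ω', _, P', _, X, hX, hcov, hchar⟩ :=
    exists_gaussian_dual hc hcM (hsys.isCRandomWalkLaw hc hcM) lam
  refine ⟨Ω', inferInstance, P', inferInstance, X, hX, ?_, fun n t => ?_⟩
  · rw [integral_natCast_poissonMeasure]
    exact hcov
  · refine tendstoInDistribution_of_tendsto_integral_exp (BbDual.isInducing_pi n)
      (fun T => aemeasurable_pi_iff.2 fun k =>
        hsys.aemeasurable_occupationFluctuation hc hcM _ T (t k))
      (measurable_pi_iff.2 fun k => hX.measurable (t k)).aemeasurable fun A v => ?_
    rw [hchar A (fun a => t a.1.1) (fun a => a.1.2) v]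
    exact hsys.tendsto_integral_exp_occupationFluctuation hc hcM (fun a : A => t a.1.1)
      (fun a => a.1.2) v
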